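/- Let $\varepsilon,\sigma,\alpha,C>0$. For $\beta,B>0$ let $\text{Hölder}^{\beta}(B)$ be the set of $h:\mathbb R\to\mathbb R$ that are $k$ times continuously differentiable with $|h^{(k)}(t)-h^{(k)}(t')|\le B|t-t'|^{\beta-k}$ for all $t,t'\in\mathbb R$, where $k$ is the largest integer strictly less than $\beta$ (so $\text{Hölder}^1(1)$ is the set of $1$-Lipschitz functions). Let $$H^\alpha(C)=\{f_h: h\in \text{Hölder}^\alpha(C)\cap\text{Hölder}^1(1)\},\qquad f_h(t_1,t_2)=\mathbf 1_{\{t_2<h(t_1)\}}\ \text{ on } [0,1]^2 .$$ For $f\in H^\alpha(C)$ and $n\ge1$, let $x_{i,j}$, $0\le i,j\le n-1$, be the average of $f$ over $[\frac in,\frac{i+1}n)\times[\frac jn,\frac{j+1}n)$, and observe $y_{i,j}=x_{i,j}+z_{i,j}$ with $z_{i,j}$ i.i.d. $N(0,\sigma^2)$; indices are extended $n$-periodically. For an integer $\delta\ge1$ put $\rho^2=(2\delta+1)^2-1$ and $$d_\delta^2(y_{i,j},y_{p,q})=\frac1{\rho^2}\Big(\sum_{m=-\delta}^{\delta}\sum_{\ell=-\delta}^{\delta}|y_{i+\ell,j+m}-y_{p+\ell,q+m}|^2-|y_{i,j}-y_{p,q}|^2\Big).$$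 The nonlocal means (NLM) estimator with patch half-width $\delta$ and threshold parameter $t$ is $$\hat f^N_{i,j}=\frac{\sum_{p,q=0}^{n-1} w_{i,j}(p,q)\,y_{p,q}}{\sum_{p,q=0}^{n-1} w_{i,j}(p,q)},\qquad w_{i,j}(p,q)=\begin{cases}1&\text{if } d_\delta^2(y_{i,j},y_{p,q})\le 2\sigma^2+t,\\0&\text{otherwise.}\end{cases}$$ Run NLM with $\delta=\delta_n=\lfloor 2(\log n)^{1/2+\varepsilon}\rfloor$ and $t=t_n=2\sigma^2/(\log n)^{\varepsilon/2}$, and let $R_n(f,\hat f^N)=\mathbb E\big(\frac1{n^2}\sum_{i,j=0}^{n-1}(x_{i,j}-\hat f^N_{i,j})^2\big)$. Then, as $n\to\infty$, $$\sup_{f\in H^\alpha(C)}R_n(f,\hat f^N)=O\Big(\frac{(\log n)^{1/2+\varepsilon}}{n}\Big),$$ that is, there are a constant $c$ and an $n_0$, depending only on $\varepsilon,\sigma,\alpha,C$, such that the supremum is at most $c\,(\log n)^{1/2+\varepsilon}/n$ for all $n>n_0$. -/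

import Mathlib

open MeasureTheory ProbabilityTheory
open scoped ENNReal

noncomputable section

/-- The Hölder class of order `α > 0` with constant `C` on the real line. The order of
differentiation is the largest integer strictly less than `α`, so that order `1` means Lipschitz. -/
def IsHolder (α C : ℝ) (h : ℝ → ℝ) : Prop :=
  ContDiff ℝ ((⌈α⌉₊ - 1 : ℕ) : ℕ∞) h ∧
    ∀ t t' : ℝ, |iteratedDeriv (⌈α⌉₊ - 1) h t - iteratedDeriv (⌈α⌉₊ - 1) h t'|
      ≤ C * |t - t'| ^ (α - ((⌈α⌉₊ - 1 : ℕ) : ℝ))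

/-- The image with value `1` below the graph of `h` and `0` on and above it. Only its values on
the unit square are ever used. -/
def horizonImage (h : ℝ → ℝ) (p : ℝ × ℝ) : ℝ :=
  Set.indicator {q : ℝ × ℝ | q.2 < h q.1} (fun _ => 1) p

/-- The Horizon class `H^α(C)`. -/
def horizonClass (α C : ℝ) : Set (ℝ × ℝ → ℝ) :=
  {f | ∃ h : ℝ → ℝ, IsHolder α C h ∧ IsHolder 1 1 h ∧ f = horizonImage h}

/-- An `n × n` array of pixel values. Indexing by `ZMod n` (representatives `0, …, n - 1`)
is the periodic extension at the image boundaries. -/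
abbrev PixelArray (n : ℕ) : Type := ZMod n × ZMod n → ℝ

/-- `[i/n, (i+1)/n) × [j/n, (j+1)/n)`. -/
def pixel (n : ℕ) (p : ZMod n × ZMod n) : Set (ℝ × ℝ) :=
  Set.Ico ((p.1.val : ℝ) / n) (((p.1.val : ℝ) + 1) / n) ×ˢ
    Set.Ico ((p.2.val : ℝ) / n) (((p.2.val : ℝ) + 1) / n)

/-- The averages of `f` over the pixels. -/
def pixelAverages (n : ℕ) (f : ℝ × ℝ → ℝ) : PixelArray n :=
  fun p => ⨍ q in pixel n p, f q

/-- The law of an array of independent `N(0, σ²)` variables. -/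
def noiseLaw (n : ℕ) [NeZero n] (σ : ℝ) : Measure (PixelArray n) :=
  Measure.pi fun _ => gaussianReal 0 (σ ^ 2).toNNReal

/-- The mean-square risk of the estimator `est`, which maps the observed array `x + z` to an
estimate of the array `x` of pixel averages of `f`. -/
def risk (n : ℕ) [NeZero n] (σ : ℝ) (est : PixelArray n → PixelArray n)
    (f : ℝ × ℝ → ℝ) : ℝ≥0∞ :=
  ∫⁻ z, ENNReal.ofReal (1 / (n : ℝ) ^ 2 *
    ∑ p : ZMod n × ZMod n,
      (pixelAverages n f p - est (pixelAverages n f + z) p) ^ 2) ∂(noiseLaw n σ)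

/-- The worst-case risk over a class `F` of images. -/
def worstCaseRisk (n : ℕ) [NeZero n] (σ : ℝ) (est : PixelArray n → PixelArray n)
    (F : Set (ℝ × ℝ → ℝ)) : ℝ≥0∞ :=
  ⨆ f ∈ F, risk n σ est f

/-- The squared distance between the patches of half-width `δ` around `p` and `q`,
with the centre pixel left out. -/
def patchDistSq {n : ℕ} (δ : ℕ) (y : PixelArray n) (p q : ZMod n × ZMod n) : ℝ :=
  1 / ((2 * (δ : ℝ) + 1) ^ 2 - 1) *
    ((∑ m ∈ Finset.Icc (-(δ : ℤ)) δ, ∑ l ∈ Finset.Icc (-(δ : ℤ)) δ,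
        |y (p.1 + (l : ZMod n), p.2 + (m : ZMod n))
          - y (q.1 + (l : ZMod n), q.2 + (m : ZMod n))| ^ 2)
      - |y p - y q| ^ 2)

/-- The weight of pixel `q` in the estimate at pixel `p`. -/
def nlmWeight {n : ℕ} (σ : ℝ) (δ : ℕ) (t : ℝ) (y : PixelArray n)
    (p q : ZMod n × ZMod n) : ℝ :=
  if patchDistSq δ y p q ≤ 2 * σ ^ 2 + t then 1 else 0

/-- The nonlocal means estimator with 0/1 weights. -/
def nlm (n : ℕ) [NeZero n] (σ : ℝ) (δ : ℕ) (t : ℝ) (y : PixelArray n) : PixelArray n :=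
  fun p => (∑ q, nlmWeight σ δ t y p q * y q) / ∑ q, nlmWeight σ δ t y p q

/-- The patch half-width: the integers `k` with `|k| ≤ 2 (log n)^(1/2+ε)` are those with
`|k| ≤ patchHalfWidth ε n`. -/
def patchHalfWidth (ε : ℝ) (n : ℕ) : ℕ :=
  ⌊2 * Real.log n ^ (1 / 2 + ε)⌋₊

/-- The threshold parameter. -/
def thresholdParam (ε σ : ℝ) (n : ℕ) : ℝ :=
  2 * σ ^ 2 / Real.log n ^ (ε / 2)

end

/-! Call a pixel flat if its patch, centre included, meets only one of the two values of the image.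
The horizon is 1-Lipschitz, so all but `n * (8 * δ + 5)` of the `n ^ 2` pixels are flat, and δ is of
order (log n)^(1/2+ε). The rate therefore follows once the total squared error is of order B = `n *
(8 * δ + 5)`. This needs a bounded mean-square error at every pixel, and a total error O(B) over the
flat pixels. Below, N is the number of offsets in a patch, of order (log n)^(1+2ε).

Flat pixels (`sum_flat_lintegral_sq_sub_patchMean_le`). Outside an event of superpolynomially small
probability, all patch sums of the noise are within a relative error τ of order (log n)^(-ε/2) of
their means (`concentrated`). The estimator at a flat pixel then averages over the whole set F of
flat pixels of the same value, over none of the other value, and over at most B further pixels. The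
mean-square error is of order 1/|F| + B²/|F|², which sums to O(B) over F if |F| ≥ B. If |F| < B, the
bounded error at each pixel suffices.

Every pixel p (`sum_lintegral_sq_selWeight_patchEnergy_le`). The bias is at most 1. The noise is
harder: the selection depends on the noise that is averaged, and bounding by the largest z_q² would
lose a factor log n. Since the centre is left out of patches, z_q does not enter the energy that
decides about q itself, unless q lies in the patch around p, and it enters at most N other energies.
If at least 2N pixels are selected, the weight of q is thus independent of z_q up to a factor 2. If
fewer are selected, the part z_q² > K is a Gaussian tail that beats the factor N. For z_q² ≤ K,
setting z_q to 0 moves every energy by at most G, and the weight is again nearly independent of z_q,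
provided that raising the threshold by 4G at most quadruples the number of selected pixels.

It remains to see that this stability fails with probability O(1/K) (`mul_measure_unstableSet_le`).
Multiplying the noise in the patch around p by 1+κ raises all energies at p except that of p itself,
with slope at least σ²N/2 in κ, so a suitable step in κ acts like lowering the threshold by 4G. A
count cannot fall below a quarter of itself, ending below 2N, more than log(8N) times. The law of
the noise changes by a bounded factor over J such steps, so all steps are about equally likely to
show instability, whose probability is then of order log(8N)/J. There is room for J above K·log(8N)
because √N ≥ (log n)^(1/2+ε) exceeds the size √(log n) of the largest noise by a power of log n. -/

/-! ### Gaussian noise: independence and exponential moments. -/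

/-- The law of a family of independent centred Gaussian variables with standard deviation `σ`. -/
noncomputable def gaussNoise (V : Type*) [Fintype V] (σ : ℝ) : Measure (V → ℝ) :=
  Measure.pi fun _ => gaussianReal 0 (σ ^ 2).toNNReal

instance isProbabilityMeasure_gaussNoise (V : Type*) [Fintype V] (σ : ℝ) :
    IsProbabilityMeasure (gaussNoise V σ) := by
  unfold gaussNoise; infer_instance

lemma lintegral_mul_of_dependsOn {V : Type*} [Fintype V] [DecidableEq V] {ν : V → Measure ℝ}
    [∀ i, IsProbabilityMeasure (ν i)] {A B : Finset V} (hAB : Disjoint A B)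
    {F H : (V → ℝ) → ℝ≥0∞} (hF : Measurable F) (hH : Measurable H)
    (hFA : DependsOn F (A : Set V)) (hHB : DependsOn H (B : Set V)) :
    ∫⁻ z, F z * H z ∂Measure.pi ν = (∫⁻ z, F z ∂Measure.pi ν) * ∫⁻ z, H z ∂Measure.pi ν := by
  have hind := (iIndepFun_pi (μ := ν) (X := fun _ x => x) fun i => aemeasurable_id).indepFun_finset
    A B hAB fun i => measurable_pi_apply i
  have key : ∀ (C : Finset V), Measurable fun (w : C → ℝ) (i : V) =>
      if h : i ∈ C then w ⟨i, h⟩ else 0 := by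
    intro C
    refine measurable_pi_lambda _ fun i => ?_
    by_cases h : i ∈ C
    · simpa [h] using measurable_pi_apply _
    · simp [h]
  have hFe : F = (fun w : A → ℝ => F fun i => if h : i ∈ A then w ⟨i, h⟩ else 0) ∘
      fun (z : V → ℝ) (i : A) => z i := by
    funext z
    refine hFA fun i hi => ?_
    simp only [Finset.mem_coe] at hi
    simp [hi]
  have hHe : H = (fun w : B → ℝ => H fun i => if h : i ∈ B then w ⟨i, h⟩ else 0) ∘
      fun (z : V → ℝ) (i : B) => z i := by
    funext z
    refine hHB fun i hi => ?_
    simp only [Finset.mem_coe] at hi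
    simp [hi]
  refine lintegral_mul_eq_lintegral_mul_lintegral_of_indepFun'' hF.aemeasurable hH.aemeasurable ?_
  rw [hFe, hHe]
  exact hind.comp (hF.comp (key A)) (hH.comp (key B))

lemma lintegral_gaussNoise_eval {V : Type*} [Fintype V] (σ : ℝ) (a : V) {f : ℝ → ℝ≥0∞}
    (hf : Measurable f) :
    ∫⁻ z, f (z a) ∂gaussNoise V σ = ∫⁻ x, f x ∂gaussianReal 0 (σ ^ 2).toNNReal :=
  (measurePreserving_eval (fun _ : V => gaussianReal 0 (σ ^ 2).toNNReal) a).lintegral_comp hf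

/-- Invariance under `Function.update z q` is the form in which "F does not depend on the noise at
q" is used throughout. -/
lemma lintegral_eval_mul_of_update {V : Type*} [Fintype V] [DecidableEq V] (σ : ℝ) (q : V)
    {f : ℝ → ℝ≥0∞} (hf : Measurable f) {F : (V → ℝ) → ℝ≥0∞} (hF : Measurable F)
    (hFq : ∀ z c, F (Function.update z q c) = F z) :
    ∫⁻ z, f (z q) * F z ∂gaussNoise V σ =
      (∫⁻ x, f x ∂gaussianReal 0 (σ ^ 2).toNNReal) * ∫⁻ z, F z ∂gaussNoise V σ := by
  rw [← lintegral_gaussNoise_eval σ q hf]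
  refine lintegral_mul_of_dependsOn (A := {q}) (B := Finset.univ.erase q) (by simp)
    (hf.comp (measurable_pi_apply q)) hF (fun z w h => by rw [h q (by simp)]) fun z w h => ?_
  rw [← hFq z (w q)]
  congr 1
  funext i
  by_cases hi : i = q
  · subst hi; simp
  · simpa [hi] using h i (by simp [hi])

/-- Completing the square. The identity serves both the exponential moments of x² and the density of
a rescaled Gaussian. -/
lemma exp_sq_mul_gaussianPDF {σ : ℝ} (hσ : 0 < σ) {s b : ℝ} (hb : b = 1 - 2 * s * σ ^ 2)
    (hb0 : 0 < b) (x : ℝ) :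
    ENNReal.ofReal (Real.exp (s * x ^ 2)) * gaussianPDF 0 (σ ^ 2).toNNReal x =
      ENNReal.ofReal (√b)⁻¹ * gaussianPDF 0 (σ ^ 2 / b).toNNReal x := by
  have hσ2 : (0 : ℝ) ≤ σ ^ 2 := by positivity
  have hσb : (0 : ℝ) ≤ σ ^ 2 / b := by positivity
  simp only [gaussianPDF, gaussianPDFReal, Real.coe_toNNReal _ hσ2, Real.coe_toNNReal _ hσb]
  rw [← ENNReal.ofReal_mul (by positivity), ← ENNReal.ofReal_mul (by positivity)]
  congr 1
  have h1 : √(2 * Real.pi * (σ ^ 2 / b)) = √(2 * Real.pi * σ ^ 2) / √b := by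
    rw [← mul_div_assoc, Real.sqrt_div (by positivity)]
  have h2 : Real.exp (-(x - 0) ^ 2 / (2 * (σ ^ 2 / b))) =
      Real.exp (s * x ^ 2) * Real.exp (-(x - 0) ^ 2 / (2 * σ ^ 2)) := by
    rw [← Real.exp_add]
    congr 1
    field_simp
    rw [hb]; ring
  have h3 : 0 < √b := Real.sqrt_pos.2 hb0
  have h4 : 0 < √(2 * Real.pi * σ ^ 2) := Real.sqrt_pos.2 (by positivity)
  rw [h1, h2]
  field_simp

lemma toNNReal_sq_ne_zero {σ : ℝ} (hσ : 0 < σ) : (σ ^ 2).toNNReal ≠ 0 := by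
  simp [hσ.ne']

lemma lintegral_exp_sq_gaussianReal {σ : ℝ} (hσ : 0 < σ) {s : ℝ} (hb0 : 0 < 1 - 2 * s * σ ^ 2) :
    ∫⁻ x, ENNReal.ofReal (Real.exp (s * x ^ 2)) ∂gaussianReal 0 (σ ^ 2).toNNReal =
      ENNReal.ofReal (√(1 - 2 * s * σ ^ 2))⁻¹ := by
  rw [gaussianReal_of_var_ne_zero 0 (toNNReal_sq_ne_zero hσ),
    lintegral_withDensity_eq_lintegral_mul _ (measurable_gaussianPDF _ _) (by fun_prop)]
  simp only [Pi.mul_apply]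
  simp_rw [mul_comm (gaussianPDF _ _ _), exp_sq_mul_gaussianPDF hσ rfl hb0]
  rw [lintegral_const_mul _ (measurable_gaussianPDF _ _), lintegral_gaussianPDF_eq_one, mul_one]
  have : 0 < σ ^ 2 / (1 - 2 * s * σ ^ 2) := by positivity
  simpa using this

/-- Since (1 - a)(1 + a + 2a²) = 1 + a²(1 - 2a) ≥ 1. The second-order term is what later gives
Bernstein-type bounds. -/
lemma inv_sqrt_one_sub_le_exp {a : ℝ} (ha : a ≤ 1 / 2) :
    (√(1 - a))⁻¹ ≤ Real.exp (a / 2 + a ^ 2) := by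
  have h1 : 0 < 1 - a := by linarith
  have h2 : 1 ≤ (1 - a) * Real.exp (a + 2 * a ^ 2) := by
    have := Real.add_one_le_exp (a + 2 * a ^ 2)
    nlinarith [mul_le_mul_of_nonneg_left this h1.le, mul_nonneg (sq_nonneg a) (by linarith : 0 ≤ 1 - 2 * a)]
  have h3 : Real.exp (a / 2 + a ^ 2) = √(Real.exp (a + 2 * a ^ 2)) := by
    rw [← Real.exp_half]; congr 1; ring
  rw [h3, inv_le_iff_one_le_mul₀ (Real.sqrt_pos.2 h1), ← Real.sqrt_mul (Real.exp_pos _).le,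
    Real.one_le_sqrt]
  linarith

lemma lintegral_exp_sq_gaussianReal_le {σ : ℝ} (hσ : 0 < σ) {s : ℝ} (hs : s * σ ^ 2 ≤ 1 / 4) :
    ∫⁻ x, ENNReal.ofReal (Real.exp (s * x ^ 2)) ∂gaussianReal 0 (σ ^ 2).toNNReal ≤
      ENNReal.ofReal (Real.exp (s * σ ^ 2 + 4 * s ^ 2 * σ ^ 4)) := by
  rw [lintegral_exp_sq_gaussianReal hσ (by linarith)]
  refine ENNReal.ofReal_le_ofReal ((inv_sqrt_one_sub_le_exp (by linarith)).trans_eq ?_)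
  congr 1; ring

lemma lintegral_exp_mul_gaussianReal (σ : ℝ) (s : ℝ) :
    ∫⁻ x, ENNReal.ofReal (Real.exp (s * x)) ∂gaussianReal 0 (σ ^ 2).toNNReal =
      ENNReal.ofReal (Real.exp (s ^ 2 * σ ^ 2 / 2)) := by
  rw [← ofReal_integral_eq_lintegral_ofReal (integrable_exp_mul_gaussianReal s)
    (Filter.Eventually.of_forall fun x => (Real.exp_pos _).le)]
  have := congrFun (mgf_fun_id_gaussianReal (μ := 0) (v := (σ ^ 2).toNNReal)) s
  simp only [mgf] at this
  rw [this, Real.coe_toNNReal _ (sq_nonneg σ)]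
  congr 2; ring

lemma lintegral_sq_gaussianReal (σ : ℝ) :
    ∫⁻ x, ENNReal.ofReal (x ^ 2) ∂gaussianReal 0 (σ ^ 2).toNNReal = ENNReal.ofReal (σ ^ 2) := by
  have hL : MemLp id 2 (gaussianReal 0 (σ ^ 2).toNNReal) := memLp_id_gaussianReal' 2 (by simp)
  have h := variance_eq_sub hL
  rw [variance_id_gaussianReal] at h
  have h0 : ∫ x, x ∂gaussianReal 0 (σ ^ 2).toNNReal = 0 := integral_id_gaussianReal
  rw [← ofReal_integral_eq_lintegral_ofReal (by simpa using hL.integrable_sq)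
    (Filter.Eventually.of_forall fun x => sq_nonneg x)]
  congr 1
  simpa [h0, Real.coe_toNNReal _ (sq_nonneg σ)] using h.symm

lemma lintegral_exp_sq_quarter_le {σ : ℝ} (hσ : 0 < σ) :
    ∫⁻ x, ENNReal.ofReal (Real.exp (1 / (4 * σ ^ 2) * x ^ 2)) ∂gaussianReal 0 (σ ^ 2).toNNReal ≤
      ENNReal.ofReal 2 := by
  have h : 1 - 2 * (1 / (4 * σ ^ 2)) * σ ^ 2 = 1 / 2 := by field_simp; norm_num
  rw [lintegral_exp_sq_gaussianReal hσ (by rw [h]; norm_num), h]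
  refine ENNReal.ofReal_le_ofReal ?_
  rw [inv_le_comm₀ (by positivity) (by norm_num)]
  exact Real.le_sqrt_of_sq_le (by norm_num)

/-- Exponential Markov inequality with exp(x²/(4σ²)): half of the exponent pays for the factor x²,
the other half gives the decay in K. -/
lemma lintegral_sq_tail_gaussianReal_le {σ : ℝ} (hσ : 0 < σ) (K : ℝ) :
    ∫⁻ x, ENNReal.ofReal (if x ^ 2 ≤ K then 0 else x ^ 2) ∂gaussianReal 0 (σ ^ 2).toNNReal ≤
      ENNReal.ofReal (16 * σ ^ 2 * Real.exp (-K / (8 * σ ^ 2))) := by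
  calc _ ≤ ∫⁻ x, ENNReal.ofReal (8 * σ ^ 2 * Real.exp (-K / (8 * σ ^ 2))) *
        ENNReal.ofReal (Real.exp (1 / (4 * σ ^ 2) * x ^ 2)) ∂gaussianReal 0 (σ ^ 2).toNNReal := by
        refine lintegral_mono fun x => ?_
        rw [← ENNReal.ofReal_mul (by positivity)]
        refine ENNReal.ofReal_le_ofReal ?_
        split_ifs with h
        · positivity
        · push Not at h
          have h1 : x ^ 2 ≤ 8 * σ ^ 2 * Real.exp (x ^ 2 / (8 * σ ^ 2)) := by
            have := Real.add_one_le_exp (x ^ 2 / (8 * σ ^ 2))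
            have h2 : x ^ 2 = 8 * σ ^ 2 * (x ^ 2 / (8 * σ ^ 2)) := by field_simp
            nlinarith [mul_le_mul_of_nonneg_left this (by positivity : 0 ≤ 8 * σ ^ 2), sq_pos_of_pos hσ]
          have h3 : Real.exp (x ^ 2 / (8 * σ ^ 2)) ≤
              Real.exp (-K / (8 * σ ^ 2)) * Real.exp (1 / (4 * σ ^ 2) * x ^ 2) := by
            rw [← Real.exp_add]
            refine Real.exp_le_exp.2 ?_
            have : -K / (8 * σ ^ 2) + 1 / (4 * σ ^ 2) * x ^ 2 =
              x ^ 2 / (8 * σ ^ 2) + (x ^ 2 - K) / (8 * σ ^ 2) := by field_simp; ring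
            rw [this]
            have : 0 ≤ (x ^ 2 - K) / (8 * σ ^ 2) := div_nonneg (by linarith) (by positivity)
            linarith
          calc x ^ 2 ≤ _ := h1
            _ ≤ _ := by rw [mul_assoc (8 * σ ^ 2)]; gcongr
    _ ≤ ENNReal.ofReal (8 * σ ^ 2 * Real.exp (-K / (8 * σ ^ 2))) * ENNReal.ofReal 2 := by
        rw [lintegral_const_mul _ (by fun_prop)]
        gcongr
        exact lintegral_exp_sq_quarter_le hσ
    _ = _ := by
        rw [← ENNReal.ofReal_mul (by positivity)]
        congr 1; ring

lemma gaussianReal_sq_gt_le {σ : ℝ} (hσ : 0 < σ) (K : ℝ) :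
    gaussianReal 0 (σ ^ 2).toNNReal {x | K < x ^ 2} ≤
      ENNReal.ofReal (2 * Real.exp (-K / (4 * σ ^ 2))) := by
  have hm : MeasurableSet {x : ℝ | K < x ^ 2} := measurableSet_lt (by fun_prop) (by fun_prop)
  rw [← lintegral_indicator_one hm]
  calc _ ≤ ∫⁻ x, ENNReal.ofReal (Real.exp (-K / (4 * σ ^ 2))) *
        ENNReal.ofReal (Real.exp (1 / (4 * σ ^ 2) * x ^ 2)) ∂gaussianReal 0 (σ ^ 2).toNNReal := by
        refine lintegral_mono fun x => ?_
        rw [← ENNReal.ofReal_mul (by positivity), ← Real.exp_add]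
        by_cases h : K < x ^ 2
        · simp only [Set.indicator, Set.mem_ofPred_eq, h, if_true, Pi.one_apply]
          rw [ENNReal.one_le_ofReal]
          refine Real.one_le_exp ?_
          have : -K / (4 * σ ^ 2) + 1 / (4 * σ ^ 2) * x ^ 2 = (x ^ 2 - K) / (4 * σ ^ 2) := by
            field_simp; ring
          rw [this]
          exact div_nonneg (by linarith) (by positivity)
        · simp [Set.indicator, h]
    _ ≤ ENNReal.ofReal (Real.exp (-K / (4 * σ ^ 2))) * ENNReal.ofReal 2 := by
        rw [lintegral_const_mul _ (by fun_prop)]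
        gcongr
        exact lintegral_exp_sq_quarter_le hσ
    _ = _ := by
        rw [← ENNReal.ofReal_mul (by positivity)]
        congr 1; ring

/-- Given z a, the exponent is linear in z b; integrating z b out leaves an exponential moment of (z
a)². -/
lemma lintegral_exp_mul_mul_le {V : Type*} [Fintype V] [DecidableEq V] {σ : ℝ} (hσ : 0 < σ)
    {a b : V} (hab : a ≠ b) {s : ℝ} (hs : s ^ 2 * σ ^ 4 ≤ 1 / 2) :
    ∫⁻ z, ENNReal.ofReal (Real.exp (s * (z a * z b))) ∂gaussNoise V σ ≤
      ENNReal.ofReal (Real.exp (s ^ 2 * σ ^ 4)) := by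
  have hind : IndepFun (fun z : V → ℝ => z a) (fun z => z b) (gaussNoise V σ) :=
    (iIndepFun_pi (μ := fun _ : V => gaussianReal 0 (σ ^ 2).toNNReal) (X := fun _ x => x)
      fun i => aemeasurable_id).indepFun hab
  have hmap := (indepFun_iff_map_prod_eq_prod_map_map (measurable_pi_apply a).aemeasurable
    (measurable_pi_apply b).aemeasurable).1 hind
  have e : ∀ i : V, (gaussNoise V σ).map (fun z => z i) = gaussianReal 0 (σ ^ 2).toNNReal :=
    fun i => (measurePreserving_eval (fun _ : V => gaussianReal 0 (σ ^ 2).toNNReal) i).map_eq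
  have hm : Measurable fun w : ℝ × ℝ => ENNReal.ofReal (Real.exp (s * (w.1 * w.2))) := by fun_prop
  have := lintegral_map (μ := gaussNoise V σ) hm
    ((measurable_pi_apply a).prodMk (measurable_pi_apply b))
  simp only at this
  rw [← this, hmap, e, e, lintegral_prod _ hm.aemeasurable]
  simp_rw [← mul_assoc, lintegral_exp_mul_gaussianReal]
  calc _ = ∫⁻ x, ENNReal.ofReal (Real.exp (s ^ 2 * σ ^ 2 / 2 * x ^ 2))
        ∂gaussianReal 0 (σ ^ 2).toNNReal := by
        refine lintegral_congr fun x => ?_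
        congr 2; ring
    _ ≤ _ := lintegral_exp_sq_gaussianReal_le hσ (by nlinarith)
    _ ≤ _ := by
        refine ENNReal.ofReal_le_ofReal (Real.exp_le_exp.2 ?_)
        have h : 0 ≤ s ^ 2 * σ ^ 4 := by positivity
        nlinarith [mul_le_mul_of_nonneg_left hs h]

/-! ### Change of measure under scaling of some coordinates. -/

lemma pi_withDensity_eq {V : Type*} [Fintype V] {ν : V → Measure ℝ}
    [∀ i, IsProbabilityMeasure (ν i)] {r : V → ℝ → ℝ≥0∞} (hr : ∀ i, Measurable (r i))
    [∀ i, SigmaFinite ((ν i).withDensity (r i))] :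
    Measure.pi (fun i => (ν i).withDensity (r i)) =
      (Measure.pi ν).withDensity fun z => ∏ i, r i (z i) := by
  refine Measure.pi_eq fun s hs => ?_
  have hm : MeasurableSet (Set.univ.pi s) := MeasurableSet.univ_pi hs
  rw [withDensity_apply _ hm, ← lintegral_indicator hm]
  have : ∀ z : V → ℝ, (Set.univ.pi s).indicator (fun z => ∏ i, r i (z i)) z =
      ∏ i, (s i).indicator (r i) (z i) := by
    intro z
    by_cases h : z ∈ Set.univ.pi s
    · rw [Set.indicator_of_mem h]
      exact Finset.prod_congr rfl fun i _ => (Set.indicator_of_mem (h i trivial) _).symm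
    · rw [Set.indicator_of_notMem h]
      simp only [Set.mem_pi, Set.mem_univ, forall_const, not_forall] at h
      obtain ⟨i, hi⟩ := h
      exact (Finset.prod_eq_zero (Finset.mem_univ i) (Set.indicator_of_notMem hi _)).symm
  simp_rw [this]
  rw [lintegral_prod_eq_prod_lintegral_of_indepFun Finset.univ
    (fun i (z : V → ℝ) => (s i).indicator (r i) (z i))
    (iIndepFun_pi (μ := ν) fun i => ((hr i).indicator (hs i)).aemeasurable)
    fun i => ((hr i).indicator (hs i)).comp (measurable_pi_apply i)]
  refine Finset.prod_congr rfl fun i _ => ?_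
  rw [(measurePreserving_eval ν i).lintegral_comp ((hr i).indicator (hs i)),
    lintegral_indicator (hs i), withDensity_apply _ (hs i)]

/-- Multiplication of the coordinates in `U` by `1 + κ`. -/
def scaleOn {V : Type*} [DecidableEq V] (U : Finset V) (κ : ℝ) (z : V → ℝ) (i : V) : ℝ :=
  (if i ∈ U then 1 + κ else 1) * z i

lemma measurable_scaleOn {V : Type*} [DecidableEq V] (U : Finset V) (κ : ℝ) :
    Measurable (scaleOn U κ) :=
  measurable_pi_lambda _ fun i => (measurable_pi_apply i).const_mul _

lemma gaussianReal_eq_withDensity_scale {σ : ℝ} (hσ : 0 < σ) {c : ℝ} (hc : 0 < c) :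
    gaussianReal 0 (σ ^ 2).toNNReal = ((gaussianReal 0 (σ ^ 2).toNNReal).map (c * ·)).withDensity
      fun x => ENNReal.ofReal (c * Real.exp (-((1 - (c ^ 2)⁻¹) / (2 * σ ^ 2)) * x ^ 2)) := by
  have hc2 : 0 < c ^ 2 := by positivity
  have hv : NNReal.mk (c ^ 2) (sq_nonneg _) * (σ ^ 2).toNNReal = (σ ^ 2 / (c ^ 2)⁻¹).toNNReal := by
    ext
    rw [Real.coe_toNNReal _ (by positivity)]
    simp only [NNReal.coe_mul, NNReal.coe_mk, div_inv_eq_mul,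
      Real.coe_toNNReal _ (sq_nonneg σ)]
    ring
  rw [gaussianReal_map_const_mul, mul_zero, hv, gaussianReal_of_var_ne_zero 0
    (toNNReal_sq_ne_zero hσ), gaussianReal_of_var_ne_zero 0
    (Real.toNNReal_pos.2 (by positivity)).ne', ← withDensity_mul _ (measurable_gaussianPDF _ _) (by fun_prop)]
  congr 1
  funext x
  have h := exp_sq_mul_gaussianPDF hσ (s := (1 - (c ^ 2)⁻¹) / (2 * σ ^ 2)) (b := (c ^ 2)⁻¹)
    (by field_simp; ring) (by positivity) x
  rw [Real.sqrt_inv, Real.sqrt_sq hc.le, inv_inv] at h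
  rw [Pi.mul_apply, mul_comm, ENNReal.ofReal_mul hc.le, mul_right_comm, ← h, mul_right_comm,
    ← ENNReal.ofReal_mul (Real.exp_pos _).le, ← Real.exp_add]
  simp

/-- The density of the noise law relative to the scaled law is (1+κ)^|U| exp(-s ∑ z²) with sσ² = κ +
O(κ²). The first-order terms cancel when ∑ z² is σ²|U|; a deficit X costs κX/σ², and the second
order costs 2κ²|U|. -/
lemma gaussNoise_le_scaleOn {V : Type*} [Fintype V] [DecidableEq V] {σ : ℝ} (hσ : 0 < σ)
    (U : Finset V) {κ X : ℝ} (hκ : 0 ≤ κ) (hX : 0 ≤ X) {B : Set (V → ℝ)} (hBm : MeasurableSet B)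
    (hB : ∀ z ∈ B, σ ^ 2 * U.card - X ≤ ∑ i ∈ U, z i ^ 2) :
    gaussNoise V σ B ≤ ENNReal.ofReal (Real.exp (κ * X / σ ^ 2 + 2 * κ ^ 2 * U.card)) *
      gaussNoise V σ (scaleOn U κ ⁻¹' B) := by
  set c : V → ℝ := fun i => if i ∈ U then 1 + κ else 1 with hc
  have hc0 : ∀ i, 0 < c i := fun i => by simp only [hc]; split_ifs <;> linarith
  set ν := gaussianReal 0 (σ ^ 2).toNNReal with hν
  set r : V → ℝ → ℝ≥0∞ := fun i x =>
    ENNReal.ofReal (c i * Real.exp (-((1 - (c i ^ 2)⁻¹) / (2 * σ ^ 2)) * x ^ 2)) with hr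
  have hrm : ∀ i, Measurable (r i) := fun i => by simp only [hr]; fun_prop
  have hdens : ∀ i, ν = (ν.map (c i * ·)).withDensity (r i) := fun i =>
    gaussianReal_eq_withDensity_scale hσ (hc0 i)
  have hp : ∀ i, IsProbabilityMeasure (ν.map (c i * ·)) := fun i =>
    Measure.isProbabilityMeasure_map (by fun_prop)
  have hs : ∀ i, SigmaFinite ((ν.map (c i * ·)).withDensity (r i)) := fun i => by
    rw [← hdens]; infer_instance
  have e1 : gaussNoise V σ = (Measure.pi fun i => ν.map (c i * ·)).withDensity
      fun z => ∏ i, r i (z i) := by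
    rw [← pi_withDensity_eq hrm]
    unfold gaussNoise
    congr 1
    funext i
    exact hdens i
  have e2 : (Measure.pi fun i => ν.map (c i * ·)) = (gaussNoise V σ).map (scaleOn U κ) := by
    rw [← Measure.pi_map_pi fun i => by fun_prop]
    rfl
  have e3 : ∀ z ∈ B, ∏ i, r i (z i) ≤
      ENNReal.ofReal (Real.exp (κ * X / σ ^ 2 + 2 * κ ^ 2 * U.card)) := by
    intro z hz
    rw [← ENNReal.ofReal_prod_of_nonneg fun i _ => mul_nonneg (hc0 i).le (Real.exp_pos _).le]
    refine ENNReal.ofReal_le_ofReal ?_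
    set s := (1 - ((1 + κ) ^ 2)⁻¹) / (2 * σ ^ 2) with hsdef
    have h1 : ∏ i, c i * Real.exp (-((1 - (c i ^ 2)⁻¹) / (2 * σ ^ 2)) * z i ^ 2) =
        ∏ i ∈ U, (1 + κ) * Real.exp (-s * z i ^ 2) := by
      rw [← Finset.prod_subset (Finset.subset_univ U)]
      · refine Finset.prod_congr rfl fun i hi => ?_
        simp [hc, hi, hsdef]
      · intro i _ hi
        simp [hc, hi]
    have hsσ : s * σ ^ 2 = (1 - ((1 + κ) ^ 2)⁻¹) / 2 := by rw [hsdef]; field_simp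
    have hinv : (1 - ((1 + κ) ^ 2)⁻¹) = (2 * κ + κ ^ 2) / (1 + κ) ^ 2 := by field_simp; ring
    have hlow : κ - 2 * κ ^ 2 ≤ s * σ ^ 2 := by
      rw [hsσ, hinv, le_div_iff₀ (by norm_num), le_div_iff₀ (by positivity)]
      nlinarith [pow_nonneg hκ 2, pow_nonneg hκ 3, pow_nonneg hκ 4]
    have hup : s * σ ^ 2 ≤ κ := by
      rw [hsσ, hinv, div_le_iff₀ (by norm_num), div_le_iff₀ (by positivity)]
      nlinarith [pow_nonneg hκ 2, pow_nonneg hκ 3]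
    have hs0 : 0 ≤ s * σ ^ 2 := by
      rw [hsσ, hinv]; positivity
    have hs0' : 0 ≤ s := by
      by_contra h
      push Not at h
      nlinarith [mul_neg_of_neg_of_pos h (sq_pos_of_pos hσ)]
    rw [h1, Finset.prod_mul_distrib, Finset.prod_const, ← Real.exp_sum, ← Finset.mul_sum]
    calc (1 + κ) ^ U.card * Real.exp (-s * ∑ i ∈ U, z i ^ 2)
        ≤ Real.exp κ ^ U.card * Real.exp (-s * ∑ i ∈ U, z i ^ 2) := by
          gcongr
          linarith [Real.add_one_le_exp κ]
      _ = Real.exp (U.card * κ + -s * ∑ i ∈ U, z i ^ 2) := by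
          rw [← Real.exp_nat_mul, ← Real.exp_add]
      _ ≤ _ := by
          refine Real.exp_le_exp.2 ?_
          have h2 := mul_le_mul_of_nonneg_left (hB z hz) hs0'
          have h3 : s * X ≤ κ * X / σ ^ 2 := by
            rw [le_div_iff₀ (by positivity)]
            nlinarith [mul_le_mul_of_nonneg_right hup hX]
          have h4 := mul_le_mul_of_nonneg_right hlow (Nat.cast_nonneg (α := ℝ) U.card)
          nlinarith
  calc gaussNoise V σ B = ∫⁻ z in B, ∏ i, r i (z i) ∂(Measure.pi fun i => ν.map (c i * ·)) := by
        rw [e1, withDensity_apply _ hBm]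
    _ ≤ ∫⁻ z in B, ENNReal.ofReal (Real.exp (κ * X / σ ^ 2 + 2 * κ ^ 2 * U.card))
          ∂(Measure.pi fun i => ν.map (c i * ·)) := setLIntegral_mono measurable_const e3
    _ = _ := by
        rw [setLIntegral_const, e2, Measure.map_apply (measurable_scaleOn U κ) hBm]

/-! ### Chernoff bounds for patch sums of the noise. -/

lemma measure_ge_le_lintegral_exp {Ω : Type*} [MeasurableSpace Ω] {μ : Measure Ω} {Y : Ω → ℝ}
    (hY : Measurable Y) {x B : ℝ} (h : ∫⁻ ω, ENNReal.ofReal (Real.exp (Y ω)) ∂μ ≤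
      ENNReal.ofReal (Real.exp B)) :
    μ {ω | x ≤ Y ω} ≤ ENNReal.ofReal (Real.exp (B - x)) := by
  have hm : MeasurableSet {ω | x ≤ Y ω} := measurableSet_le measurable_const hY
  rw [← lintegral_indicator_one hm]
  calc _ ≤ ∫⁻ ω, ENNReal.ofReal (Real.exp (-x)) * ENNReal.ofReal (Real.exp (Y ω)) ∂μ := by
        refine lintegral_mono fun ω => ?_
        rw [← ENNReal.ofReal_mul (by positivity), ← Real.exp_add]
        by_cases h : x ≤ Y ω
        · simp only [Set.indicator, Set.mem_ofPred_eq, h, if_true, Pi.one_apply]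
          rw [ENNReal.one_le_ofReal]
          exact Real.one_le_exp (by linarith)
        · simp [Set.indicator, h]
    _ ≤ ENNReal.ofReal (Real.exp (-x)) * ENNReal.ofReal (Real.exp B) := by
        rw [lintegral_const_mul _ (by fun_prop)]
        gcongr
    _ = _ := by
        rw [← ENNReal.ofReal_mul (by positivity), ← Real.exp_add]
        congr 2; ring

lemma lintegral_exp_sum_le {V ι : Type*} [Fintype V] [DecidableEq V] (σ : ℝ)
    {I : Finset ι} {Y : ι → (V → ℝ) → ℝ} (hY : ∀ l, Measurable (Y l)) {A : ι → Finset V}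
    (hYA : ∀ l, DependsOn (Y l) (A l : Set V))
    (hA : ∀ l ∈ I, ∀ l' ∈ I, l ≠ l' → Disjoint (A l) (A l')) {b : ℝ}
    (hb : ∀ l ∈ I, ∫⁻ z, ENNReal.ofReal (Real.exp (Y l z)) ∂gaussNoise V σ ≤
      ENNReal.ofReal (Real.exp b)) :
    ∫⁻ z, ENNReal.ofReal (Real.exp (∑ l ∈ I, Y l z)) ∂gaussNoise V σ ≤
      ENNReal.ofReal (Real.exp (I.card * b)) := by
  classical
  induction I using Finset.induction_on with
  | empty => simp
  | insert a s ha ih =>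
    have hd : Disjoint (A a) (s.biUnion A) := by
      rw [Finset.disjoint_biUnion_right]
      intro l hl
      exact hA a (by simp) l (by simp [hl]) (by rintro rfl; exact ha hl)
    have hsum : ∀ z, ENNReal.ofReal (Real.exp (∑ l ∈ insert a s, Y l z)) =
        ENNReal.ofReal (Real.exp (Y a z)) * ENNReal.ofReal (Real.exp (∑ l ∈ s, Y l z)) := by
      intro z
      rw [Finset.sum_insert ha, Real.exp_add, ENNReal.ofReal_mul (Real.exp_pos _).le]
    simp_rw [hsum]
    rw [gaussNoise, lintegral_mul_of_dependsOn hd (by fun_prop) (by fun_prop)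
      (fun z w h => by rw [hYA a h])
      (fun z w h => by
        congr 2
        refine Finset.sum_congr rfl fun l hl => hYA l fun i hi => h i ?_
        simp only [Finset.mem_coe, Finset.mem_biUnion]
        exact ⟨l, hl, hi⟩)]
    calc _ ≤ ENNReal.ofReal (Real.exp b) * ENNReal.ofReal (Real.exp (s.card * b)) :=
          mul_le_mul' (hb a (by simp)) (ih
            (fun l hl l' hl' => hA l (by simp [hl]) l' (by simp [hl']))
            fun l hl => hb l (by simp [hl]))
      _ = _ := by
          rw [← ENNReal.ofReal_mul (Real.exp_pos _).le, ← Real.exp_add,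
            Finset.card_insert_of_notMem ha]
          congr 2
          push_cast; ring

lemma measure_abs_ge_le {Ω : Type*} [MeasurableSpace Ω] {μ : Measure Ω} {Y : Ω → ℝ} {x : ℝ} {B : ℝ≥0∞}
    (h1 : μ {z | x ≤ Y z} ≤ B) (h2 : μ {z | x ≤ -Y z} ≤ B) : μ {z | x ≤ |Y z|} ≤ 2 * B := by
  calc μ {z | x ≤ |Y z|} ≤ μ ({z | x ≤ Y z} ∪ {z | x ≤ -Y z}) := by
        refine measure_mono fun z hz => ?_
        simpa [le_abs] using hz
    _ ≤ _ := (measure_union_le _ _).trans (by rw [two_mul]; gcongr)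

section Concentration

variable {V : Type*} [Fintype V] [DecidableEq V] [AddCommGroup V] {σ : ℝ}

lemma lintegral_exp_sum_sq_le (hσ : 0 < σ) (p : V) (I : Finset V) {s : ℝ}
    (hs : s * σ ^ 2 ≤ 1 / 4) :
    ∫⁻ z, ENNReal.ofReal (Real.exp (∑ l ∈ I, s * z (p + l) ^ 2)) ∂gaussNoise V σ ≤
      ENNReal.ofReal (Real.exp (I.card * (s * σ ^ 2 + 4 * s ^ 2 * σ ^ 4))) := by
  refine lintegral_exp_sum_le σ (A := fun l => {p + l}) (fun l => by fun_prop)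
    (fun l z w h => by rw [h (p + l) (by simp)]) (fun l _ l' _ h => by simpa using h)
    fun l _ => ?_
  rw [lintegral_gaussNoise_eval σ (p + l)
    (f := fun x => ENNReal.ofReal (Real.exp (s * x ^ 2))) (by fun_prop)]
  exact lintegral_exp_sq_gaussianReal_le hσ hs

/-- Concentration of sums of squares of noise variables. -/
lemma gaussNoise_sum_sq_le (hσ : 0 < σ) (p : V) {I : Finset V} {N : ℕ} (hI : I.card ≤ N)
    {τ : ℝ} (hτ0 : 0 ≤ τ) (hτ : τ ≤ 1) :
    gaussNoise V σ {z | τ * σ ^ 2 * N ≤ |∑ l ∈ I, z (p + l) ^ 2 - σ ^ 2 * I.card|} ≤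
      ENNReal.ofReal (4 * Real.exp (-(τ ^ 2 * N / 16))) := by
  have hIN : (I.card : ℝ) ≤ N := by exact_mod_cast hI
  -- Both signs of s are treated at once, one for each tail. This size of s makes the quadratic term
  -- τ²/16 per offset, half of the exponent τ²/8 gained at the threshold.
  have key : ∀ s : ℝ, s ^ 2 = (τ / (8 * σ ^ 2)) ^ 2 → s * σ ^ 2 ≤ 1 / 4 →
      gaussNoise V σ {z | τ ^ 2 * N / 8 ≤ ∑ l ∈ I, s * z (p + l) ^ 2 - s * σ ^ 2 * I.card} ≤
      ENNReal.ofReal (Real.exp (-(τ ^ 2 * N / 16))) := by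
    intro s hs2 hs
    have h := measure_ge_le_lintegral_exp (x := τ ^ 2 * N / 8 + s * σ ^ 2 * I.card) (by fun_prop)
      (lintegral_exp_sum_sq_le hσ p I hs)
    refine (measure_mono fun z hz => ?_).trans (h.trans (ENNReal.ofReal_le_ofReal
      (Real.exp_le_exp.2 ?_)))
    · simp only [Set.mem_ofPred_eq] at hz ⊢; linarith
    · have : 4 * s ^ 2 * σ ^ 4 = τ ^ 2 / 16 := by rw [hs2]; field_simp; ring
      rw [this]
      nlinarith [mul_le_mul_of_nonneg_left hIN (sq_nonneg τ)]
  have hsσ : τ / (8 * σ ^ 2) * σ ^ 2 = τ / 8 := by field_simp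
  have h1 := key (τ / (8 * σ ^ 2)) rfl (by rw [hsσ]; linarith)
  have h2 := key (-(τ / (8 * σ ^ 2))) (by ring) (by rw [neg_mul, hsσ]; linarith)
  have h0 : (0 : ℝ) ≤ τ / (8 * σ ^ 2) := by positivity
  have conv : ∀ w : ℝ, τ * σ ^ 2 * N ≤ w → τ ^ 2 * N / 8 ≤ τ / (8 * σ ^ 2) * w := by
    intro w hw
    calc τ ^ 2 * N / 8 = τ / (8 * σ ^ 2) * (τ * σ ^ 2 * N) := by field_simp
      _ ≤ _ := by gcongr
  refine (measure_abs_ge_le (B := ENNReal.ofReal (Real.exp (-(τ ^ 2 * N / 16))))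
    ((measure_mono fun z hz => ?_).trans h1) ((measure_mono fun z hz => ?_).trans h2)).trans ?_
  · have := conv _ hz
    simp only [Set.mem_ofPred_eq, ← Finset.mul_sum]
    linarith
  · have := conv _ hz
    simp only [Set.mem_ofPred_eq, ← Finset.mul_sum]
    linarith
  · rw [show (2 : ℝ≥0∞) = ENNReal.ofReal 2 by simp, ← ENNReal.ofReal_mul (by norm_num)]
    refine ENNReal.ofReal_le_ofReal ?_
    linarith [Real.exp_pos (-(τ ^ 2 * N / 16))]

/-- Concentration of linear combinations of noise variables. -/
lemma gaussNoise_sum_le (hσ : 0 < σ) (p : V) {I : Finset V} {N : ℕ} (hI : I.card ≤ N)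
    {c : V → ℝ} (hc : ∀ l, |c l| ≤ 1) (τ : ℝ) (hτ0 : 0 ≤ τ) :
    gaussNoise V σ {z | τ * σ * N ≤ |∑ l ∈ I, c l * z (p + l)|} ≤
      ENNReal.ofReal (4 * Real.exp (-(τ ^ 2 * N / 16))) := by
  have hIN : (I.card : ℝ) ≤ N := by exact_mod_cast hI
  have key : ∀ s : ℝ, s ^ 2 = (τ / σ) ^ 2 →
      gaussNoise V σ {z | τ ^ 2 * N ≤ ∑ l ∈ I, s * c l * z (p + l)} ≤
      ENNReal.ofReal (Real.exp (-(τ ^ 2 * N / 16))) := by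
    intro s hs2
    have h0 : ∫⁻ z, ENNReal.ofReal (Real.exp (∑ l ∈ I, s * c l * z (p + l))) ∂gaussNoise V σ ≤
        ENNReal.ofReal (Real.exp (I.card * (τ ^ 2 / 2))) := by
      refine lintegral_exp_sum_le σ (A := fun l => {p + l}) (fun l => by fun_prop)
        (fun l z w h => by rw [h (p + l) (by simp)]) (fun l _ l' _ h => by simpa using h)
        fun l _ => ?_
      rw [lintegral_gaussNoise_eval σ (p + l)
        (f := fun x => ENNReal.ofReal (Real.exp (s * c l * x))) (by fun_prop),
        lintegral_exp_mul_gaussianReal]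
      refine ENNReal.ofReal_le_ofReal (Real.exp_le_exp.2 ?_)
      have h1 : c l ^ 2 ≤ 1 := by rw [sq_le_one_iff_abs_le_one]; exact hc l
      have h2 : (τ / σ) ^ 2 * σ ^ 2 = τ ^ 2 := by field_simp
      calc (s * c l) ^ 2 * σ ^ 2 / 2 = c l ^ 2 * (s ^ 2 * σ ^ 2) / 2 := by ring
        _ ≤ 1 * (s ^ 2 * σ ^ 2) / 2 := by gcongr
        _ = _ := by rw [hs2, h2]; ring
    have h := measure_ge_le_lintegral_exp (x := τ ^ 2 * N) (by fun_prop) h0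
    refine h.trans (ENNReal.ofReal_le_ofReal (Real.exp_le_exp.2 ?_))
    nlinarith [mul_le_mul_of_nonneg_left hIN (sq_nonneg τ),
      mul_nonneg (sq_nonneg τ) (Nat.cast_nonneg (α := ℝ) N)]
  have conv : ∀ w : ℝ, τ * σ * N ≤ w → τ ^ 2 * N ≤ τ / σ * w := by
    intro w hw
    calc τ ^ 2 * N = τ / σ * (τ * σ * N) := by field_simp
      _ ≤ _ := by gcongr
  refine (measure_abs_ge_le (B := ENNReal.ofReal (Real.exp (-(τ ^ 2 * N / 16))))
    ((measure_mono fun z hz => ?_).trans (key (τ / σ) rfl))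
    ((measure_mono fun z hz => ?_).trans (key (-(τ / σ)) (by ring)))).trans ?_
  · have := conv _ hz
    simp only [Set.mem_ofPred_eq, mul_assoc, ← Finset.mul_sum]
    linarith
  · have := conv _ hz
    simp only [Set.mem_ofPred_eq, mul_assoc, ← Finset.mul_sum]
    linarith
  · rw [show (2 : ℝ≥0∞) = ENNReal.ofReal 2 by simp, ← ENNReal.ofReal_mul (by norm_num)]
    refine ENNReal.ofReal_le_ofReal ?_
    linarith [Real.exp_pos (-(τ ^ 2 * N / 16))]

/-- For every nonzero shift, `O` can be coloured with two colours such that points of `O` that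
differ by the shift get different colours. -/
def ShiftBicolorable (O : Finset V) : Prop :=
  ∀ k : V, k ≠ 0 → ∃ c : V → Bool, ∀ l ∈ O, l + k ∈ O → c (l + k) ≠ c l

/-- The patches around p and q may overlap, but p + l' = q + l forces l' = l + (q - p). Without such
pairs in I, the summands use disjoint sets of coordinates and are independent. -/
lemma gaussNoise_sum_mul_class_le (hσ : 0 < σ) {p q : V} (hpq : p ≠ q) {I : Finset V}
    (hd : ∀ l ∈ I, l + (q - p) ∉ I) {N : ℕ} (hI : I.card ≤ N) {τ : ℝ} (hτ0 : 0 ≤ τ)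
    (hτ : τ ≤ 1) :
    gaussNoise V σ {z | τ * σ ^ 2 * N / 2 ≤ |∑ l ∈ I, z (p + l) * z (q + l)|} ≤
      2 * ENNReal.ofReal (Real.exp (-(τ ^ 2 * N / 16))) := by
  have hIN : (I.card : ℝ) ≤ N := by exact_mod_cast hI
  have key : ∀ s : ℝ, s ^ 2 = (τ / (4 * σ ^ 2)) ^ 2 →
      gaussNoise V σ {z | τ ^ 2 * N / 8 ≤ ∑ l ∈ I, s * (z (p + l) * z (q + l))} ≤
      ENNReal.ofReal (Real.exp (-(τ ^ 2 * N / 16))) := by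
    intro s hs2
    have hs4 : s ^ 2 * σ ^ 4 = τ ^ 2 / 16 := by rw [hs2]; field_simp; norm_num
    have h0 : ∫⁻ z, ENNReal.ofReal (Real.exp (∑ l ∈ I, s * (z (p + l) * z (q + l))))
        ∂gaussNoise V σ ≤ ENNReal.ofReal (Real.exp (I.card * (s ^ 2 * σ ^ 4))) := by
      refine lintegral_exp_sum_le σ (A := fun l => {p + l, q + l}) (fun l => by fun_prop)
        (fun l z w h => by rw [h (p + l) (by simp), h (q + l) (by simp)]) ?_
        fun l _ => lintegral_exp_mul_mul_le hσ (by simpa using hpq) (by rw [hs4]; nlinarith)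
      intro l hl l' hl' hll
      have e1 : p + l ≠ q + l' := fun h => hd l' hl' (by
        have : l' + (q - p) = l := by rw [← add_sub_assoc, add_comm l' q, ← h]; abel
        rwa [this])
      have e2 : q + l ≠ p + l' := fun h => hd l hl (by
        have : l + (q - p) = l' := by rw [← add_sub_assoc, add_comm l q, h]; abel
        rwa [this])
      rw [Finset.disjoint_left]
      intro v hv hv'
      simp only [Finset.mem_insert, Finset.mem_singleton] at hv hv'
      rcases hv with rfl | rfl <;> rcases hv' with h | h
      · exact hll (add_left_cancel h)
      · exact e1 h
      · exact e2 h
      · exact hll (add_left_cancel h)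
    have h := measure_ge_le_lintegral_exp (x := τ ^ 2 * N / 8) (by fun_prop) h0
    refine h.trans (ENNReal.ofReal_le_ofReal (Real.exp_le_exp.2 ?_))
    rw [hs4]
    nlinarith [mul_le_mul_of_nonneg_left hIN (sq_nonneg τ)]
  have conv : ∀ w : ℝ, τ * σ ^ 2 * N / 2 ≤ w → τ ^ 2 * N / 8 ≤ τ / (4 * σ ^ 2) * w := by
    intro w hw
    calc τ ^ 2 * N / 8 = τ / (4 * σ ^ 2) * (τ * σ ^ 2 * N / 2) := by field_simp; ring
      _ ≤ _ := by gcongr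
  refine measure_abs_ge_le
    ((measure_mono fun z hz => ?_).trans (key (τ / (4 * σ ^ 2)) rfl))
    ((measure_mono fun z hz => ?_).trans (key (-(τ / (4 * σ ^ 2))) (by ring)))
  · have := conv _ hz
    simp only [Set.mem_ofPred_eq, ← Finset.mul_sum]
    linarith
  · have := conv _ hz
    simp only [Set.mem_ofPred_eq, ← Finset.mul_sum]
    linarith

/-- Concentration of the correlation of two different noise patches. -/
lemma gaussNoise_sum_mul_le (hσ : 0 < σ) {O : Finset V} (hO : ShiftBicolorable O) {p q : V}
    (hpq : p ≠ q) {I : Finset V} (hIsub : I ⊆ O) {N : ℕ} (hI : I.card ≤ N) {τ : ℝ} (hτ0 : 0 ≤ τ)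
    (hτ : τ ≤ 1) :
    gaussNoise V σ {z | τ * σ ^ 2 * N ≤ |∑ l ∈ I, z (p + l) * z (q + l)|} ≤
      ENNReal.ofReal (4 * Real.exp (-(τ ^ 2 * N / 16))) := by
  obtain ⟨c, hc⟩ := hO (q - p) (sub_ne_zero.2 hpq.symm)
  have hd : ∀ b : Bool, ∀ l ∈ I.filter (c · = b), l + (q - p) ∉ I.filter (c · = b) := by
    intro b l hl hl'
    rw [Finset.mem_filter] at hl hl'
    exact hc l (hIsub hl.1) (hIsub hl'.1) (hl'.2.trans hl.2.symm)
  have hcard : ∀ b : Bool, (I.filter (c · = b)).card ≤ N := fun b =>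
    (Finset.card_filter_le _ _).trans hI
  have hsub : {z : V → ℝ | τ * σ ^ 2 * N ≤ |∑ l ∈ I, z (p + l) * z (q + l)|} ⊆
      {z | τ * σ ^ 2 * N / 2 ≤ |∑ l ∈ I.filter (c · = true), z (p + l) * z (q + l)|} ∪
      {z | τ * σ ^ 2 * N / 2 ≤ |∑ l ∈ I.filter (c · = false), z (p + l) * z (q + l)|} := by
    intro z hz
    have hs : ∑ l ∈ I, z (p + l) * z (q + l) = ∑ l ∈ I.filter (c · = true), z (p + l) * z (q + l) +
        ∑ l ∈ I.filter (c · = false), z (p + l) * z (q + l) := by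
      rw [← Finset.sum_filter_add_sum_filter_not I (c · = true)]
      simp
    by_contra h
    simp only [Set.mem_union, Set.mem_ofPred_eq, not_or, not_le] at h hz
    rw [hs] at hz
    linarith [abs_add_le (∑ l ∈ I.filter (c · = true), z (p + l) * z (q + l))
      (∑ l ∈ I.filter (c · = false), z (p + l) * z (q + l))]
  refine ((measure_mono hsub).trans (measure_union_le _ _)).trans ?_
  refine (add_le_add (gaussNoise_sum_mul_class_le hσ hpq (hd true) (hcard true) hτ0 hτ)
    (gaussNoise_sum_mul_class_le hσ hpq (hd false) (hcard false) hτ0 hτ)).trans_eq ?_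
  rw [ENNReal.ofReal_mul (by norm_num), ← add_mul]
  congr 1
  norm_num

end Concentration

/-! ### Weights of selected indices and their dependence on one noise variable. -/

/-- The number of indices `q` with `e q z ≤ v`. -/
noncomputable def countLe {V : Type*} [Fintype V] (e : V → (V → ℝ) → ℝ) (v : ℝ) (z : V → ℝ) : ℕ :=
  (Finset.univ.filter fun q => e q z ≤ v).card

/-- The normalized weight of `q` among the indices with `e q z ≤ v`. -/
noncomputable def selWeight {V : Type*} [Fintype V] (e : V → (V → ℝ) → ℝ) (v : ℝ) (q : V)
    (z : V → ℝ) : ℝ≥0∞ :=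
  if e q z ≤ v then (countLe e v z : ℝ≥0∞)⁻¹ else 0

lemma ENNReal.inv_le_mul_inv_of_le {a b c : ℝ≥0∞} (hc : c ≠ 0) (hc' : c ≠ ∞) (h : a ≤ c * b) :
    b⁻¹ ≤ c * a⁻¹ := by
  have h1 : (c * b)⁻¹ ≤ a⁻¹ := ENNReal.inv_le_inv.2 h
  calc b⁻¹ = c * (c * b)⁻¹ := by
        rw [ENNReal.mul_inv (Or.inl hc) (Or.inl hc'), ← mul_assoc, ENNReal.mul_inv_cancel hc hc',
          one_mul]
    _ ≤ _ := by gcongr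

section Selection

variable {V : Type*} [Fintype V] {e : V → (V → ℝ) → ℝ} {v : ℝ}

lemma countLe_pos {q : V} {z : V → ℝ} (h : e q z ≤ v) : 0 < countLe e v z := by
  classical
  exact Finset.card_pos.2 ⟨q, by simp [h]⟩

lemma countLe_mono {v v' : ℝ} {z z' : V → ℝ} (h : ∀ q, e q z ≤ v → e q z' ≤ v') :
    countLe e v z ≤ countLe e v' z' := by
  classical
  refine Finset.card_le_card fun q hq => ?_
  simp only [Finset.mem_filter, Finset.mem_univ, true_and] at hq ⊢
  exact h q hq

lemma measurable_countLe (he : ∀ q, Measurable (e q)) (v : ℝ) : Measurable (countLe e v) := by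
  classical
  have : countLe e v = fun z => ∑ q, if e q z ≤ v then 1 else 0 := by
    funext z; rw [countLe, Finset.card_filter]
  rw [this]
  exact Finset.measurable_sum _ fun q _ =>
    Measurable.ite (measurableSet_le (he q) measurable_const) measurable_const measurable_const

lemma measurable_selWeight (he : ∀ q, Measurable (e q)) (v : ℝ) (q : V) :
    Measurable (selWeight e v q) := by
  classical
  refine Measurable.ite (measurableSet_le (he q) measurable_const) ?_ measurable_const
  exact Measurable.inv ((measurable_of_countable _).comp (measurable_countLe he v))

lemma sum_selWeight_le (z : V → ℝ) : ∑ q, selWeight e v q z ≤ 1 := by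
  classical
  simp only [selWeight]
  rw [← Finset.sum_filter, Finset.sum_const, nsmul_eq_mul]
  refine (le_of_eq ?_).trans (ENNReal.mul_inv_le_one (countLe e v z : ℝ≥0∞))
  congr

lemma selWeight_le_one (q : V) (z : V → ℝ) : selWeight e v q z ≤ 1 :=
  (Finset.single_le_sum (f := fun q => selWeight e v q z) (fun _ _ => zero_le)
    (Finset.mem_univ q)).trans (sum_selWeight_le z)

lemma sum_lintegral_selWeight_le (he : ∀ q, Measurable (e q)) (v : ℝ)
    (μ : Measure (V → ℝ)) [IsProbabilityMeasure μ] :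
    ∑ q, ∫⁻ z, selWeight e v q z ∂μ ≤ 1 := by
  rw [← lintegral_finsetSum _ fun q _ => measurable_selWeight he v q]
  calc _ ≤ ∫⁻ _, 1 ∂μ := lintegral_mono fun z => sum_selWeight_le z
    _ = 1 := by simp

variable [DecidableEq V] {σ : ℝ}

/-- The decoupling device: L may depend on z q, as long as it lies below an F that does not, and F
is comparable to the weight H that will be summed over q. -/
lemma lintegral_eval_mul_le_of_sandwich {q : V} {f : ℝ → ℝ≥0∞} (hf : Measurable f)
    {L F H : (V → ℝ) → ℝ≥0∞} (hF : Measurable F) (hH : Measurable H)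
    (hFq : ∀ z c, F (Function.update z q c) = F z) {c : ℝ≥0∞}
    (hLF : ∀ z, L z ≤ F z) (hFH : ∀ z, F z ≤ c * H z) :
    ∫⁻ z, f (z q) * L z ∂gaussNoise V σ ≤
      c * (∫⁻ x, f x ∂gaussianReal 0 (σ ^ 2).toNNReal) * ∫⁻ z, H z ∂gaussNoise V σ := by
  calc _ ≤ ∫⁻ z, f (z q) * F z ∂gaussNoise V σ := lintegral_mono fun z => by gcongr; exact hLF z
    _ = _ := lintegral_eval_mul_of_update σ q hf hF hFq
    _ ≤ (∫⁻ x, f x ∂gaussianReal 0 (σ ^ 2).toNNReal) * ∫⁻ z, c * H z ∂gaussNoise V σ := by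
        gcongr with z; exact hFH z
    _ = _ := by rw [lintegral_const_mul _ hH]; ring

/-- The number of indices `q ∉ B` with `e q z ≤ v`. -/
noncomputable def countLeOff (e : V → (V → ℝ) → ℝ) (v : ℝ) (B : Finset V) (z : V → ℝ) : ℕ :=
  (Finset.univ.filter fun q => q ∉ B ∧ e q z ≤ v).card

lemma countLeOff_le (B : Finset V) (z : V → ℝ) : countLeOff e v B z ≤ countLe e v z := by
  classical
  refine Finset.card_le_card fun q hq => ?_
  simp only [Finset.mem_filter, Finset.mem_univ, true_and] at hq ⊢
  exact hq.2

lemma countLe_le_countLeOff_add {B : Finset V} {b : ℕ} (hB : B.card ≤ b) (z : V → ℝ) :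
    countLe e v z ≤ countLeOff e v B z + b := by
  classical
  refine (Finset.card_le_card (t := Finset.univ.filter (fun q => q ∉ B ∧ e q z ≤ v) ∪ B)
    fun q hq => ?_).trans ((Finset.card_union_le _ _).trans (Nat.add_le_add_left hB _))
  simp only [Finset.mem_filter, Finset.mem_univ, true_and, Finset.mem_union] at hq ⊢
  by_cases h : q ∈ B <;> simp [h, hq]

lemma measurable_countLeOff (he : ∀ q, Measurable (e q)) (v : ℝ) (B : Finset V) :
    Measurable (countLeOff e v B) := by
  classical
  have : countLeOff e v B = fun z => ∑ q, if q ∉ B ∧ e q z ≤ v then 1 else 0 := by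
    funext z; rw [countLeOff, Finset.card_filter]
  rw [this]
  exact Finset.measurable_sum _ fun q _ =>
    Measurable.ite ((MeasurableSet.const _).inter (measurableSet_le (he q) measurable_const))
      measurable_const measurable_const

lemma countLeOff_update {B : Finset V} {q : V}
    (hB : ∀ q' ∉ B, ∀ z c, e q' (Function.update z q c) = e q' z) (z : V → ℝ) (c : ℝ) :
    countLeOff e v B (Function.update z q c) = countLeOff e v B z := by
  classical
  unfold countLeOff
  congr 1
  refine Finset.filter_congr fun q' _ => ?_
  by_cases h : q' ∈ B
  · simp [h]
  · simp [h, hB q' h]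

open Classical in
-- Only the indices in B feel z q. When the count is at least 2b, leaving B out keeps at least half
-- of it, so the reciprocal of the count off B is a proxy that is independent of z q.
lemma lintegral_selWeight_of_large_count (he : ∀ q, Measurable (e q)) {q : V} {B : Finset V}
    {b : ℕ} (hBb : B.card ≤ b)
    (hq : ∀ z c, e q (Function.update z q c) = e q z)
    (hB : ∀ q' ∉ B, ∀ z c, e q' (Function.update z q c) = e q' z)
    {f : ℝ → ℝ≥0∞} (hf : Measurable f) :
    ∫⁻ z, f (z q) * (if 2 * b ≤ countLe e v z then selWeight e v q z else 0) ∂gaussNoise V σ ≤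
      2 * (∫⁻ x, f x ∂gaussianReal 0 (σ ^ 2).toNNReal) *
        ∫⁻ z, selWeight e v q z ∂gaussNoise V σ := by
  refine lintegral_eval_mul_le_of_sandwich hf
    (F := fun z => if e q z ≤ v ∧ b ≤ countLeOff e v B z then
      (countLeOff e v B z : ℝ≥0∞)⁻¹ else 0) ?_ (measurable_selWeight he v q) ?_ ?_ ?_
  · refine Measurable.ite ((measurableSet_le (he q) measurable_const).inter
      (measurableSet_le measurable_const (measurable_countLeOff he v B))) ?_ measurable_const
    exact Measurable.inv ((measurable_of_countable _).comp (measurable_countLeOff he v B))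
  · intro z c
    simp only [hq, countLeOff_update hB]
  · intro z
    have h1 := countLe_le_countLeOff_add (e := e) (v := v) hBb z
    have h2 := countLeOff_le (e := e) (v := v) B z
    split_ifs with h h'
    · simp only [selWeight, h'.1, if_true]
      exact ENNReal.inv_le_inv.2 (by exact_mod_cast h2)
    · simp only [selWeight]
      split_ifs with h3
      · exact absurd ⟨h3, by omega⟩ h'
      · exact le_rfl
    · exact zero_le
    · exact le_rfl
  · intro z
    have h1 := countLe_le_countLeOff_add (e := e) (v := v) hBb z
    split_ifs with h
    · simp only [selWeight, h.1, if_true]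
      refine ENNReal.inv_le_mul_inv_of_le (by norm_num) (by norm_num) ?_
      have : countLe e v z ≤ 2 * countLeOff e v B z := by omega
      exact_mod_cast this
    · exact zero_le

open Classical in
-- Here the weight is replaced by 1, at the cost of a factor 3b because the count is below 3b. This
-- is affordable only for an f of tiny mean, namely a Gaussian tail.
lemma lintegral_selWeight_of_small_count (he : ∀ q, Measurable (e q)) {q : V} {B : Finset V}
    {b : ℕ} (hb : 0 < b) (hBb : B.card ≤ b)
    (hq : ∀ z c, e q (Function.update z q c) = e q z)
    (hB : ∀ q' ∉ B, ∀ z c, e q' (Function.update z q c) = e q' z)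
    {f : ℝ → ℝ≥0∞} (hf : Measurable f) :
    ∫⁻ z, f (z q) * (if 2 * b ≤ countLe e v z then 0 else selWeight e v q z) ∂gaussNoise V σ ≤
      (3 * b : ℕ) * (∫⁻ x, f x ∂gaussianReal 0 (σ ^ 2).toNNReal) *
        ∫⁻ z, selWeight e v q z ∂gaussNoise V σ := by
  refine lintegral_eval_mul_le_of_sandwich hf
    (F := fun z => if e q z ≤ v ∧ countLeOff e v B z < 2 * b then 1 else 0) ?_
    (measurable_selWeight he v q) ?_ ?_ ?_
  · exact Measurable.ite ((measurableSet_le (he q) measurable_const).inter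
      (measurableSet_lt (measurable_countLeOff he v B) measurable_const)) measurable_const
      measurable_const
  · intro z c
    simp only [hq, countLeOff_update hB]
  · intro z
    have h2 := countLeOff_le (e := e) (v := v) B z
    split_ifs with h h' h'
    · exact zero_le
    · exact le_rfl
    · exact selWeight_le_one q z
    · simp only [selWeight]
      split_ifs with h3
      · exact absurd ⟨h3, by omega⟩ h'
      · exact le_rfl
  · intro z
    have h1 := countLe_le_countLeOff_add (e := e) (v := v) hBb z
    split_ifs with h
    · simp only [selWeight, h.1, if_true]
      rw [← inv_one]
      refine ENNReal.inv_le_mul_inv_of_le (by simp; omega) (ENNReal.natCast_ne_top _) ?_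
      rw [mul_one]
      have : countLe e v z ≤ 3 * b := by omega
      exact_mod_cast this
    · exact zero_le

open Classical in
/-- If setting one small noise variable to zero moves all `e q'` by at most `G`, then the weights
are nearly independent of that variable as long as the count is stable around the threshold. -/
lemma sum_lintegral_selWeight_of_stable_count (he : ∀ q, Measurable (e q)) {K G : ℝ}
    {Ω₀ : Set (V → ℝ)} (hΩ : MeasurableSet Ω₀)
    (hG : ∀ q, ∀ z ∈ Ω₀, z q ^ 2 ≤ K → ∀ q', |e q' z - e q' (Function.update z q 0)| ≤ G)
    (hK : 1 / 2 ≤ gaussianReal 0 (σ ^ 2).toNNReal {x | x ^ 2 ≤ K}) :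
    ∑ q, ∫⁻ z, ENNReal.ofReal (z q ^ 2) *
      (if z ∈ Ω₀ ∧ z q ^ 2 ≤ K ∧ countLe e (v + 4 * G) z ≤ 4 * countLe e v z then
        selWeight e v q z else 0) ∂gaussNoise V σ ≤
      8 * ENNReal.ofReal (σ ^ 2) * (4 + Fintype.card V * gaussNoise V σ Ω₀ᶜ) := by
  classical
  -- The proxy for the weight: z q is set to zero and the level is raised by G. The built-in
  -- stability between v + G and v + 3G allows a return to the true noise at level v + 2G.
  set X : V → (V → ℝ) → ℝ≥0∞ := fun q z =>
    if e q (Function.update z q 0) ≤ v + G ∧ countLe e (v + 3 * G) (Function.update z q 0) ≤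
        4 * countLe e (v + G) (Function.update z q 0) then
      (countLe e (v + G) (Function.update z q 0) : ℝ≥0∞)⁻¹ else 0 with hX
  have hupd : ∀ q : V, Measurable fun z : V → ℝ => Function.update z q 0 := fun q =>
    measurable_pi_lambda _ fun i => by
      by_cases h : i = q
      · subst h; simp
      · simpa [h] using measurable_pi_apply i
  have hXm : ∀ q, Measurable (X q) := by
    intro q
    have h0 : Measurable fun z : V → ℝ =>
        if e q z ≤ v + G ∧ countLe e (v + 3 * G) z ≤ 4 * countLe e (v + G) z then
          (countLe e (v + G) z : ℝ≥0∞)⁻¹ else 0 := by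
      refine Measurable.ite ((measurableSet_le (he q) measurable_const).inter
        (measurableSet_le (measurable_countLe he _) ((measurable_countLe he _).const_mul 4))) ?_
        measurable_const
      exact Measurable.inv ((measurable_of_countable _).comp (measurable_countLe he _))
    exact h0.comp (hupd q)
  have hXq : ∀ q z c, X q (Function.update z q c) = X q z := by
    intro q z c; simp only [hX, Function.update_idem]
  have hX1 : ∀ q z, X q z ≤ 1 := by
    intro q z
    simp only [hX]
    split_ifs with h
    · rw [ENNReal.inv_le_one]
      exact_mod_cast countLe_pos h.1
    · exact zero_le
  have step1 : ∀ q, ∫⁻ z, ENNReal.ofReal (z q ^ 2) *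
      (if z ∈ Ω₀ ∧ z q ^ 2 ≤ K ∧ countLe e (v + 4 * G) z ≤ 4 * countLe e v z then
        selWeight e v q z else 0) ∂gaussNoise V σ ≤
      4 * ENNReal.ofReal (σ ^ 2) * ∫⁻ z, X q z ∂gaussNoise V σ := by
    intro q
    rw [← lintegral_sq_gaussianReal σ]
    refine lintegral_eval_mul_le_of_sandwich (f := fun x => ENNReal.ofReal (x ^ 2))
      (by fun_prop) (F := fun z => 4 * X q z) ((hXm q).const_mul 4) (hXm q)
      (fun z c => by rw [hXq]) ?_ fun z => le_rfl
    intro z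
    split_ifs with h
    · obtain ⟨hz, hzK, hst⟩ := h
      have hg := hG q z hz hzK
      simp only [selWeight]
      split_ifs with hev
      -- With z' for z after setting z q to zero: count_v(z) ≤ count_{v+G}(z') ≤ count_{v+3G}(z') ≤
      -- count_{v+4G}(z) ≤ 4 count_v(z). So the condition in X holds, and the two weights differ by
      -- at most a factor 4.
      · have c1 : countLe e (v + 3 * G) (Function.update z q 0) ≤ countLe e (v + 4 * G) z :=
          countLe_mono fun q' h => by linarith [(abs_le.1 (hg q')).2]
        have c2 : countLe e v z ≤ countLe e (v + G) (Function.update z q 0) :=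
          countLe_mono fun q' h => by linarith [(abs_le.1 (hg q')).1]
        have hG0 : 0 ≤ G := (abs_nonneg _).trans (hg q)
        have c3 : countLe e (v + G) (Function.update z q 0) ≤
            countLe e (v + 3 * G) (Function.update z q 0) :=
          countLe_mono fun q' h => by linarith
        have hX' : X q z = (countLe e (v + G) (Function.update z q 0) : ℝ≥0∞)⁻¹ :=
          if_pos ⟨by linarith [(abs_le.1 (hg q)).1], by omega⟩
        rw [hX']
        refine ENNReal.inv_le_mul_inv_of_le (by norm_num) (by norm_num) ?_
        have : countLe e (v + G) (Function.update z q 0) ≤ 4 * countLe e v z := by omega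
        exact_mod_cast this
      · exact zero_le
    · exact zero_le
  -- As X q is independent of z q, restricting to z q² ≤ K costs at most a factor 2. On that event
  -- and in Ω₀, X q is at most 4 times the true weight at level v + 2G, and those weights sum to at
  -- most 1.
  have step2 : ∀ q, ∫⁻ z, X q z ∂gaussNoise V σ ≤
      2 * (4 * ∫⁻ z, selWeight e (v + 2 * G) q z ∂gaussNoise V σ + gaussNoise V σ Ω₀ᶜ) := by
    intro q
    have hKm : MeasurableSet {x : ℝ | x ^ 2 ≤ K} := measurableSet_le (by fun_prop) (by fun_prop)
    have h1 := lintegral_eval_mul_of_update σ q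
      (f := Set.indicator {x : ℝ | x ^ 2 ≤ K} 1) (measurable_one.indicator hKm) (hXm q) (hXq q)
    rw [lintegral_indicator_one hKm] at h1
    have h2 : ∫⁻ z, X q z ∂gaussNoise V σ ≤
        2 * ∫⁻ z, Set.indicator {x : ℝ | x ^ 2 ≤ K} 1 (z q) * X q z ∂gaussNoise V σ := by
      rw [h1, ← mul_assoc]
      calc _ = 2 * (1 / 2) * ∫⁻ z, X q z ∂gaussNoise V σ := by
            rw [one_div, ENNReal.mul_inv_cancel (by norm_num) (by norm_num), one_mul]
        _ ≤ _ := by gcongr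
    refine h2.trans ?_
    gcongr
    calc _ ≤ ∫⁻ z, (4 * selWeight e (v + 2 * G) q z + Set.indicator Ω₀ᶜ 1 z) ∂gaussNoise V σ := by
          refine lintegral_mono fun z => ?_
          by_cases hz : z ∈ Ω₀
          · by_cases hzK : z q ^ 2 ≤ K
            · have hg := hG q z hz hzK
              simp only [Set.indicator, Set.mem_ofPred_eq, hzK, if_true, Pi.one_apply, one_mul,
                Set.mem_compl_iff, hz, not_true_eq_false, if_false, add_zero]
              simp only [hX]
              split_ifs with h
              · have c1 : countLe e (v + 2 * G) z ≤
                    countLe e (v + 3 * G) (Function.update z q 0) :=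
                  countLe_mono fun q' h => by linarith [(abs_le.1 (hg q')).1]
                simp only [selWeight]
                rw [if_pos (by linarith [(abs_le.1 (hg q)).2, h.1])]
                refine ENNReal.inv_le_mul_inv_of_le (by norm_num) (by norm_num) ?_
                have : countLe e (v + 2 * G) z ≤
                  4 * countLe e (v + G) (Function.update z q 0) := c1.trans h.2
                exact_mod_cast this
              · exact zero_le
            · simp [Set.indicator, hzK]
          · refine le_trans ?_ le_add_self
            simp only [Set.indicator, Set.mem_compl_iff, hz, not_false_eq_true, if_true,
              Pi.one_apply]
            split_ifs
            · simpa using hX1 q z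
            · simp
      _ = _ := by
          rw [lintegral_add_left ((measurable_selWeight he _ q).const_mul 4),
            lintegral_const_mul _ (measurable_selWeight he _ q), lintegral_indicator_one hΩ.compl]
  calc _ ≤ ∑ q, 4 * ENNReal.ofReal (σ ^ 2) * (2 * (4 * ∫⁻ z, selWeight e (v + 2 * G) q z
        ∂gaussNoise V σ + gaussNoise V σ Ω₀ᶜ)) :=
        Finset.sum_le_sum fun q _ => (step1 q).trans (by gcongr; exact step2 q)
    _ = 8 * ENNReal.ofReal (σ ^ 2) * (4 * ∑ q, ∫⁻ z, selWeight e (v + 2 * G) q z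
        ∂gaussNoise V σ + Fintype.card V * gaussNoise V σ Ω₀ᶜ) := by
        rw [← Finset.mul_sum, ← Finset.mul_sum, Finset.sum_add_distrib, ← Finset.mul_sum,
          Finset.sum_const, Finset.card_univ, nsmul_eq_mul]
        ring
    _ ≤ _ := by
        gcongr
        calc _ ≤ 4 * (1 : ℝ≥0∞) := by
              gcongr
              exact sum_lintegral_selWeight_le he _ _
          _ = 4 := mul_one _

end Selection

/-! ### The noise of a selected average, and the probability of an unstable count. -/

/-- The noise configurations for which the count is small and more than quadruples when the
threshold is raised by `H`. -/
def unstableSet {V : Type*} [Fintype V] (e : V → (V → ℝ) → ℝ) (v H : ℝ) (b : ℕ) :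
    Set (V → ℝ) :=
  {z | 4 * countLe e v z < countLe e (v + H) z ∧ countLe e v z < 2 * b}

lemma measurableSet_unstableSet {V : Type*} [Fintype V] {e : V → (V → ℝ) → ℝ}
    (he : ∀ q, Measurable (e q)) (v H : ℝ) (b : ℕ) : MeasurableSet (unstableSet e v H b) :=
  (measurableSet_lt ((measurable_countLe he v).const_mul 4) (measurable_countLe he _)).inter
    (measurableSet_lt (measurable_countLe he v) measurable_const)

open Classical in
-- Four cases give the four terms: large count (T1), small count with z q² > K (T2), small stable
-- count with z q² ≤ K on Ω₀ (T3), and the exceptional event (T4), where the weights still sum to at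
-- most 1. The set N collects the indices whose own selection may depend on their own noise.
lemma sum_lintegral_sq_selWeight_le {V : Type*} [Fintype V] [DecidableEq V]
    {e : V → (V → ℝ) → ℝ} {v σ : ℝ} (he : ∀ q, Measurable (e q)) {N : Finset V} {b : ℕ}
    (hb : 0 < b) (hN : N.card ≤ b) {B : V → Finset V} (hBb : ∀ q, (B q).card ≤ b)
    (hq : ∀ q ∉ N, ∀ z c, e q (Function.update z q c) = e q z)
    (hB : ∀ q ∉ N, ∀ q' ∉ B q, ∀ z c, e q' (Function.update z q c) = e q' z) {K G : ℝ}
    {Ω₀ : Set (V → ℝ)} (hΩ : MeasurableSet Ω₀)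
    (hG : ∀ q, ∀ z ∈ Ω₀, z q ^ 2 ≤ K → ∀ q', |e q' z - e q' (Function.update z q 0)| ≤ G)
    (hK : 1 / 2 ≤ gaussianReal 0 (σ ^ 2).toNNReal {x | x ^ 2 ≤ K}) :
    ∑ q, ∫⁻ z, ENNReal.ofReal (z q ^ 2) * selWeight e v q z ∂gaussNoise V σ ≤
      3 * ENNReal.ofReal (σ ^ 2) + (4 * b : ℕ) *
        ∫⁻ x, ENNReal.ofReal (if x ^ 2 ≤ K then 0 else x ^ 2) ∂gaussianReal 0 (σ ^ 2).toNNReal +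
      8 * ENNReal.ofReal (σ ^ 2) * (4 + Fintype.card V * gaussNoise V σ Ω₀ᶜ) +
      ENNReal.ofReal K * (gaussNoise V σ Ω₀ᶜ + gaussNoise V σ (unstableSet e v (4 * G) b)) := by
  set μ := gaussNoise V σ with hμ
  set f : ℝ → ℝ≥0∞ := fun x => ENNReal.ofReal (if x ^ 2 ≤ K then 0 else x ^ 2) with hf
  set κ := ∫⁻ x, f x ∂gaussianReal 0 (σ ^ 2).toNNReal with hκ
  set U := unstableSet e v (4 * G) b with hU
  have hUm : MeasurableSet U := measurableSet_unstableSet he _ _ _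
  have hfm : Measurable f := by
    refine ENNReal.measurable_ofReal.comp (Measurable.ite ?_ measurable_const (by fun_prop))
    exact measurableSet_le (by fun_prop) (by fun_prop)
  have hsm := measurable_selWeight he v
  have hlarge : MeasurableSet {z | 2 * b ≤ countLe e v z} :=
    measurableSet_le measurable_const (measurable_countLe he v)
  set T1 : V → (V → ℝ) → ℝ≥0∞ := fun q z => ENNReal.ofReal (z q ^ 2) *
    (if 2 * b ≤ countLe e v z then selWeight e v q z else 0) with hT1
  set T2 : V → (V → ℝ) → ℝ≥0∞ := fun q z => f (z q) *
    (if 2 * b ≤ countLe e v z then 0 else selWeight e v q z) with hT2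
  set T3 : V → (V → ℝ) → ℝ≥0∞ := fun q z => ENNReal.ofReal (z q ^ 2) *
    (if z ∈ Ω₀ ∧ z q ^ 2 ≤ K ∧ countLe e (v + 4 * G) z ≤ 4 * countLe e v z then
        selWeight e v q z else 0) with hT3
  set T4 : V → (V → ℝ) → ℝ≥0∞ := fun q z => ENNReal.ofReal K * ((Ω₀ᶜ ∪ U).indicator 1 z *
    selWeight e v q z) with hT4
  have hsqm : ∀ q : V, Measurable fun z : V → ℝ => ENNReal.ofReal (z q ^ 2) := fun q => by fun_prop
  have hT1m : ∀ q, Measurable (T1 q) := fun q =>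
    (hsqm q).mul (Measurable.ite hlarge (hsm q) measurable_const)
  have hT2m : ∀ q, Measurable (T2 q) := fun q =>
    (hfm.comp (measurable_pi_apply q)).mul (Measurable.ite hlarge measurable_const (hsm q))
  have hT3m : ∀ q, Measurable (T3 q) := fun q => by
    have h : MeasurableSet {z : V → ℝ | z q ^ 2 ≤ K} :=
      measurableSet_le (by fun_prop) measurable_const
    exact (hsqm q).mul (Measurable.ite (hΩ.inter (h.inter (measurableSet_le
      (measurable_countLe he _) ((measurable_countLe he v).const_mul 4)))) (hsm q)
      measurable_const)
  have hT4m : ∀ q, Measurable (T4 q) := fun q =>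
    ((measurable_one.indicator (hΩ.compl.union hUm)).mul (hsm q)).const_mul _
  have hpt : ∀ q z, ENNReal.ofReal (z q ^ 2) * selWeight e v q z ≤
      T1 q z + T2 q z + T3 q z + T4 q z := by
    intro q z
    by_cases h1 : 2 * b ≤ countLe e v z
    · calc _ = T1 q z := by simp [hT1, h1]
        _ ≤ _ := by rw [add_assoc, add_assoc]; exact le_self_add
    by_cases h2 : z q ^ 2 ≤ K
    · by_cases h3 : z ∈ Ω₀ ∧ countLe e (v + 4 * G) z ≤ 4 * countLe e v z
      · calc _ = T3 q z := by simp [hT3, h2, h3]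
          _ ≤ _ := le_add_right le_add_self
      · have hz : z ∈ Ω₀ᶜ ∪ U := by
          by_cases h4 : z ∈ Ω₀
          · right
            refine ⟨?_, by omega⟩
            by_contra h5
            exact h3 ⟨h4, not_lt.1 h5⟩
          · exact Or.inl h4
        calc _ ≤ T4 q z := by
              simp only [hT4, Set.indicator_of_mem hz, Pi.one_apply, one_mul]
              gcongr
          _ ≤ _ := le_add_self
    · calc _ = T2 q z := by simp [hT2, h1, h2, hf]
        _ ≤ _ := le_add_right (le_add_right le_add_self)
  have hsel := sum_lintegral_selWeight_le he v μ
  have hS1 : ∑ q, ∫⁻ z, T1 q z ∂μ ≤ 3 * ENNReal.ofReal (σ ^ 2) := by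
    -- For q in N independence fails, but the weight is at most 1/b and there are at most b such q;
    -- together they cost one more σ².
    have h : ∀ q, ∫⁻ z, T1 q z ∂μ ≤ 2 * ENNReal.ofReal (σ ^ 2) * ∫⁻ z, selWeight e v q z ∂μ +
        if q ∈ N then ENNReal.ofReal (σ ^ 2) * (b : ℝ≥0∞)⁻¹ else 0 := by
      intro q
      by_cases hqN : q ∈ N
      · rw [if_pos hqN]
        refine le_trans ?_ le_add_self
        calc _ ≤ ∫⁻ z, ENNReal.ofReal (z q ^ 2) * (b : ℝ≥0∞)⁻¹ ∂μ := by
              refine lintegral_mono fun z => ?_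
              simp only [hT1]
              gcongr
              split_ifs with h
              · simp only [selWeight]
                split_ifs
                · exact ENNReal.inv_le_inv.2 (by exact_mod_cast (by omega : b ≤ countLe e v z))
                · exact zero_le
              · exact zero_le
          _ = _ := by
              rw [lintegral_mul_const _ (hsqm q), lintegral_gaussNoise_eval σ q
                (f := fun x => ENNReal.ofReal (x ^ 2)) (by fun_prop), lintegral_sq_gaussianReal]
      · refine le_trans ?_ le_self_add
        have := lintegral_selWeight_of_large_count (v := v) (σ := σ) he (hBb q) (hq q hqN)
          (hB q hqN) (f := fun x => ENNReal.ofReal (x ^ 2)) (by fun_prop)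
        rwa [lintegral_sq_gaussianReal] at this
    calc _ ≤ _ := Finset.sum_le_sum fun q _ => h q
      _ = 2 * ENNReal.ofReal (σ ^ 2) * ∑ q, ∫⁻ z, selWeight e v q z ∂μ +
          N.card * (ENNReal.ofReal (σ ^ 2) * (b : ℝ≥0∞)⁻¹) := by
          rw [Finset.sum_add_distrib, ← Finset.mul_sum]
          simp
      _ ≤ 2 * ENNReal.ofReal (σ ^ 2) * 1 + b * (ENNReal.ofReal (σ ^ 2) * (b : ℝ≥0∞)⁻¹) := by
          gcongr
      _ = 3 * ENNReal.ofReal (σ ^ 2) := by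
          rw [mul_left_comm (b : ℝ≥0∞), ENNReal.mul_inv_cancel (by simp; omega)
            (ENNReal.natCast_ne_top _)]
          ring
  have hS2 : ∑ q, ∫⁻ z, T2 q z ∂μ ≤ (4 * b : ℕ) * κ := by
    have h : ∀ q, ∫⁻ z, T2 q z ∂μ ≤ (3 * b : ℕ) * κ * ∫⁻ z, selWeight e v q z ∂μ +
        if q ∈ N then κ else 0 := by
      intro q
      by_cases hqN : q ∈ N
      · rw [if_pos hqN]
        refine le_trans ?_ le_add_self
        rw [hκ, ← lintegral_gaussNoise_eval σ q hfm]
        refine lintegral_mono fun z => ?_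
        simp only [hT2]
        calc _ ≤ f (z q) * 1 := by
              gcongr
              split_ifs
              · exact zero_le
              · exact selWeight_le_one q z
          _ = _ := mul_one _
      · refine le_trans ?_ le_self_add
        exact lintegral_selWeight_of_small_count (v := v) (σ := σ) he hb (hBb q) (hq q hqN)
          (hB q hqN) hfm
    calc _ ≤ _ := Finset.sum_le_sum fun q _ => h q
      _ = (3 * b : ℕ) * κ * ∑ q, ∫⁻ z, selWeight e v q z ∂μ + N.card * κ := by
          rw [Finset.sum_add_distrib, ← Finset.mul_sum]
          simp
      _ ≤ (3 * b : ℕ) * κ * 1 + b * κ := by gcongr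
      _ = _ := by push_cast; ring
  have hS3 := sum_lintegral_selWeight_of_stable_count (σ := σ) (v := v) he hΩ hG hK
  have hS4 : ∑ q, ∫⁻ z, T4 q z ∂μ ≤ ENNReal.ofReal K * (μ Ω₀ᶜ + μ U) := by
    rw [← lintegral_finsetSum _ fun q _ => hT4m q]
    calc _ ≤ ∫⁻ z, ENNReal.ofReal K * (Ω₀ᶜ ∪ U).indicator 1 z ∂μ := by
          refine lintegral_mono fun z => ?_
          simp only [hT4]
          rw [← Finset.mul_sum, ← Finset.mul_sum]
          gcongr
          exact mul_le_of_le_one_right zero_le (sum_selWeight_le z)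
      _ = ENNReal.ofReal K * μ (Ω₀ᶜ ∪ U) := by
          rw [lintegral_const_mul _ (measurable_one.indicator (hΩ.compl.union hUm)),
            lintegral_indicator_one (hΩ.compl.union hUm)]
      _ ≤ _ := by gcongr; exact measure_union_le _ _
  calc _ ≤ ∑ q, ∫⁻ z, (T1 q z + T2 q z + T3 q z + T4 q z) ∂μ :=
        Finset.sum_le_sum fun q _ => lintegral_mono fun z => hpt q z
    _ = ∑ q, ∫⁻ z, T1 q z ∂μ + ∑ q, ∫⁻ z, T2 q z ∂μ + ∑ q, ∫⁻ z, T3 q z ∂μ +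
        ∑ q, ∫⁻ z, T4 q z ∂μ := by
        rw [← Finset.sum_add_distrib, ← Finset.sum_add_distrib, ← Finset.sum_add_distrib]
        refine Finset.sum_congr rfl fun q _ => ?_
        rw [lintegral_add_right _ (hT4m q), lintegral_add_right _ (hT3m q),
          lintegral_add_right _ (hT2m q)]
    _ ≤ _ := add_le_add (add_le_add (add_le_add hS1 hS2) hS3) hS4

open Classical in
/-- A positive nonincreasing sequence drops below a quarter of its previous value, while ending up
below `R`, at most `log (4 R)` times. -/
lemma card_drops_le {a : ℕ → ℕ} {J R : ℕ} (ha : ∀ j ≤ J, 0 < a j)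
    (hmono : ∀ j < J, a (j + 1) ≤ a j) (hR : 0 < R) :
    (((Finset.range J).filter fun j => 4 * a (j + 1) < a j ∧ a (j + 1) < R).card : ℝ) ≤
      Real.log (4 * R) := by
  -- The logarithm of the sequence capped at 4R lies between 0 and log(4R). It is nonincreasing, and
  -- each counted drop lowers it by at least log 4 ≥ 1, the cap being harmless since the drop ends
  -- below R.
  set φ : ℕ → ℝ := fun j => Real.log (min (a j) (4 * R : ℕ) : ℕ) with hφ
  have hpos : ∀ j ≤ J, 0 < min (a j) (4 * R) := fun j hj => lt_min (ha j hj) (by omega)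
  have key : ∀ I ≤ J, (((Finset.range I).filter fun j =>
      4 * a (j + 1) < a j ∧ a (j + 1) < R).card : ℝ) ≤ φ 0 - φ I := by
    intro I
    induction I with
    | zero => simp
    | succ I ih =>
      intro hI
      have ih' := ih (by omega)
      rw [Finset.range_add_one, Finset.filter_insert]
      split_ifs with h
      · rw [Finset.card_insert_of_notMem (by simp)]
        have h4 : φ (I + 1) + 1 ≤ φ I := by
          have h1 : 4 * min (a (I + 1)) (4 * R) ≤ min (a I) (4 * R) := by omega
          have h2 : Real.log (4 * (min (a (I + 1)) (4 * R) : ℕ)) ≤ φ I := by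
            refine Real.log_le_log ?_ (by exact_mod_cast h1)
            have := hpos (I + 1) hI
            positivity
          rw [Real.log_mul (by norm_num) (by have := hpos (I + 1) hI; positivity)] at h2
          have h3 : 1 ≤ Real.log 4 := by
            rw [Real.le_log_iff_exp_le (by norm_num)]
            linarith [Real.exp_one_lt_d9]
          simp only [hφ] at h2 ⊢
          linarith
        push_cast
        linarith
      · have h4 : φ (I + 1) ≤ φ I := by
          refine Real.log_le_log (by exact_mod_cast hpos (I + 1) hI) ?_
          have := hmono I (by omega)
          exact_mod_cast (by omega : min (a (I + 1)) (4 * R) ≤ min (a I) (4 * R))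
        linarith
  refine (key J le_rfl).trans ?_
  have h1 : 0 ≤ φ J := Real.log_nonneg (by exact_mod_cast hpos J le_rfl)
  have h2 : φ 0 ≤ Real.log (4 * R) := by
    refine Real.log_le_log (by exact_mod_cast hpos 0 (Nat.zero_le _)) ?_
    exact_mod_cast min_le_right _ _
  linarith

/-- A nearly measure preserving family of maps that raises all `e q` in steps makes it unlikely
that the count is unstable. -/
lemma mul_measure_unstableSet_le {V : Type*} [Fintype V] {e : V → (V → ℝ) → ℝ} {v H : ℝ} {b J : ℕ}
    (he : ∀ q, Measurable (e q)) (hb : 0 < b) (hH : 0 ≤ H) {μ : Measure (V → ℝ)}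
    [IsProbabilityMeasure μ] {Φ : ℕ → (V → ℝ) → V → ℝ} (hΦ : ∀ j, Measurable (Φ j))
    {A D : Set (V → ℝ)} (hA : MeasurableSet A) (hD : MeasurableSet D) {c : ℝ≥0∞}
    (hc : ∀ j < J, ∀ B, MeasurableSet B → B ⊆ A → μ B ≤ c * μ (Φ (j + 1) ⁻¹' B))
    (hstep : ∀ z ∈ D, ∀ j < J, ∀ q, e q (Φ (j + 1) z) ≤ v + H → e q (Φ j z) ≤ v)
    (hp : ∀ z, ∃ q, e q z ≤ v) :
    J * μ (unstableSet e v H b) ≤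
      J * μ Aᶜ + c * (ENNReal.ofReal (Real.log (8 * b)) + J * μ Dᶜ) := by
  classical
  set U := unstableSet e v H b with hU
  have hUm : MeasurableSet U := measurableSet_unstableSet he _ _ _
  -- Each of the J maps transports the unstable event at the cost of the factor c. For z in D,
  -- instability at Φ (j+1) z is a drop of the count from Φ j z to Φ (j+1) z by more than a factor
  -- 4, so the sum of the J indicators is at most log(8b).
  have h1 : J * μ (U ∩ A) ≤ c * (ENNReal.ofReal (Real.log (8 * b)) + J * μ Dᶜ) := by
    calc J * μ (U ∩ A) = ∑ j ∈ Finset.range J, μ (U ∩ A) := by simp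
      _ ≤ ∑ j ∈ Finset.range J, c * ∫⁻ z, (Φ (j + 1) ⁻¹' U).indicator 1 z ∂μ := by
          refine Finset.sum_le_sum fun j hj => ?_
          rw [lintegral_indicator_one (hΦ _ hUm)]
          refine (hc j (Finset.mem_range.1 hj) _ (hUm.inter hA) Set.inter_subset_right).trans ?_
          gcongr
          exact Set.inter_subset_left
      _ = c * ∫⁻ z, ∑ j ∈ Finset.range J, (Φ (j + 1) ⁻¹' U).indicator 1 z ∂μ := by
          rw [← Finset.mul_sum, lintegral_finsetSum _ fun j _ =>
            measurable_one.indicator (hΦ _ hUm)]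
      _ ≤ c * ∫⁻ z, (ENNReal.ofReal (Real.log (8 * b)) + J * Dᶜ.indicator 1 z) ∂μ := by
          gcongr with z
          by_cases hz : z ∈ D
          · refine le_trans ?_ le_self_add
            have hcount := card_drops_le (a := fun j => countLe e v (Φ j z)) (J := J) (R := 2 * b)
              (fun j _ => by obtain ⟨q, hq⟩ := hp (Φ j z); exact countLe_pos hq)
              (fun j hj => countLe_mono fun q h => hstep z hz j hj q (by linarith)) (by omega)
            calc ∑ j ∈ Finset.range J, (Φ (j + 1) ⁻¹' U).indicator (1 : (V → ℝ) → ℝ≥0∞) z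
                ≤ ∑ j ∈ Finset.range J, if 4 * countLe e v (Φ (j + 1) z) < countLe e v (Φ j z) ∧
                  countLe e v (Φ (j + 1) z) < 2 * b then 1 else 0 := by
                  refine Finset.sum_le_sum fun j hj => ?_
                  by_cases hzU : z ∈ Φ (j + 1) ⁻¹' U
                  · have h2 : countLe e (v + H) (Φ (j + 1) z) ≤ countLe e v (Φ j z) :=
                      countLe_mono fun q h => hstep z hz j (Finset.mem_range.1 hj) q h
                    rw [Set.indicator_of_mem hzU, if_pos ⟨lt_of_lt_of_le hzU.1 h2, hzU.2⟩]
                    exact le_rfl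
                  · rw [Set.indicator_of_notMem hzU]
                    exact zero_le
              _ = ENNReal.ofReal (((Finset.range J).filter fun j =>
                  4 * countLe e v (Φ (j + 1) z) < countLe e v (Φ j z) ∧
                  countLe e v (Φ (j + 1) z) < 2 * b).card : ℝ) := by
                  rw [← Finset.sum_filter]
                  simp
              _ ≤ _ := by
                  refine ENNReal.ofReal_le_ofReal (hcount.trans_eq ?_)
                  congr 1
                  push_cast; ring
          · refine le_trans ?_ le_add_self
            rw [Set.indicator_of_mem (by exact hz : z ∈ Dᶜ), Pi.one_apply, mul_one]
            calc _ ≤ ∑ j ∈ Finset.range J, (1 : ℝ≥0∞) := Finset.sum_le_sum fun j _ =>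
                  Set.indicator_le (fun _ _ => le_rfl) z
              _ = _ := by simp
      _ = _ := by
          rw [lintegral_add_left measurable_const, lintegral_const_mul _
            (measurable_one.indicator hD.compl), lintegral_indicator_one hD.compl]
          simp
  calc J * μ U ≤ J * (μ Aᶜ + μ (U ∩ A)) := by
        gcongr
        calc μ U ≤ μ (Aᶜ ∪ (U ∩ A)) := measure_mono fun z hz => by
              by_cases h : z ∈ A
              · exact Or.inr ⟨hz, h⟩
              · exact Or.inl h
          _ ≤ _ := measure_union_le _ _
    _ ≤ _ := by
        rw [mul_add]
        gcongr

/-! ### Patch energies under a change of one noise variable and under scaling of a patch. -/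

/-- The squared distance of the patches with offsets `O` around `p` and `q`. -/
def patchEnergy {V : Type*} [Add V] (O : Finset V) (y : V → ℝ) (p q : V) : ℝ :=
  ∑ l ∈ O, (y (p + l) - y (q + l)) ^ 2

lemma gaussNoise_exists_abs_gt_le {V : Type*} [Fintype V] {σ : ℝ} (hσ : 0 < σ) {M : ℝ} (hM : 0 ≤ M) :
    gaussNoise V σ {z | ∀ i, |z i| ≤ M}ᶜ ≤
      ENNReal.ofReal (Fintype.card V * (2 * Real.exp (-M ^ 2 / (4 * σ ^ 2)))) := by
  calc _ ≤ gaussNoise V σ (⋃ i, {z | M ^ 2 < z i ^ 2}) := by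
        refine measure_mono fun z hz => ?_
        simp only [Set.mem_compl_iff, Set.mem_ofPred_eq, not_forall, not_le] at hz
        obtain ⟨i, hi⟩ := hz
        refine Set.mem_iUnion.2 ⟨i, ?_⟩
        simp only [Set.mem_ofPred_eq]
        rw [← sq_abs (z i)]
        gcongr
    _ ≤ ∑ i : V, gaussNoise V σ {z | M ^ 2 < z i ^ 2} := measure_iUnion_fintype_le _ _
    _ ≤ ∑ i : V, ENNReal.ofReal (2 * Real.exp (-M ^ 2 / (4 * σ ^ 2))) := by
        refine Finset.sum_le_sum fun i _ => ?_
        have hm : MeasurableSet {x : ℝ | M ^ 2 < x ^ 2} := measurableSet_lt (by fun_prop) (by fun_prop)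
        have := (measurePreserving_eval (fun _ : V => gaussianReal 0 (σ ^ 2).toNNReal)
          i).measure_preimage hm.nullMeasurableSet
        exact this.trans_le (gaussianReal_sq_gt_le hσ _)
    _ = _ := by
        rw [Finset.sum_const, Finset.card_univ, nsmul_eq_mul,
          ENNReal.ofReal_mul (p := (Fintype.card V : ℝ)) (by positivity), ENNReal.ofReal_natCast]

section PatchEnergy

variable {V : Type*} [AddCommGroup V] {O : Finset V} {x : V → ℝ} {p : V} {σ : ℝ}

lemma measurable_patchEnergy (O : Finset V) (x : V → ℝ) (p q : V) :
    Measurable fun z => patchEnergy O (x + z) p q := by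
  unfold patchEnergy
  simp only [Pi.add_apply]
  fun_prop

@[simp]
lemma patchEnergy_self (y : V → ℝ) : patchEnergy O y p p = 0 := by simp [patchEnergy]

variable [DecidableEq V]

lemma patchEnergy_update {q q' : V} (hq : q ∉ O.image (p + ·)) (hq' : q' ∉ O.image (q - ·))
    (z : V → ℝ) (c : ℝ) :
    patchEnergy O (x + Function.update z q c) p q' = patchEnergy O (x + z) p q' := by
  refine Finset.sum_congr rfl fun l hl => ?_
  have h1 : p + l ≠ q := fun h => hq (Finset.mem_image.2 ⟨l, hl, h⟩)
  have h2 : q' + l ≠ q := fun h => hq' (Finset.mem_image.2 ⟨l, hl, by rw [← h]; abel⟩)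
  simp [Function.update_of_ne h1, Function.update_of_ne h2]

/-- The variable z q can enter only the terms l = q - p and l = q - q'. Factoring a difference of
squares, each entry changes the sum by at most √K · 4(M + 1). -/
lemma abs_patchEnergy_sub_update_le (hx : ∀ i, x i ∈ Set.Icc (0 : ℝ) 1) {K M : ℝ}
    {z : V → ℝ} (hz : ∀ i, |z i| ≤ M) {q : V} (hq : z q ^ 2 ≤ K) (q' : V) :
    |patchEnergy O (x + z) p q' - patchEnergy O (x + Function.update z q 0) p q'| ≤
      8 * √K * (M + 1) := by
  have hM : 0 ≤ M := (abs_nonneg _).trans (hz q)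
  have hqK : |z q| ≤ √K := Real.abs_le_sqrt hq
  have hz0 : ∀ i, |Function.update z q 0 i| ≤ M := by
    intro i
    by_cases h : i = q
    · subst h; simpa using hM
    · simpa [h] using hz i
  have hdiff : ∀ i, |z i - Function.update z q 0 i| ≤ √K * (if i = q then 1 else 0) := by
    intro i
    by_cases h : i = q
    · subst h; simpa using hqK
    · simp [h]
  have hterm : ∀ l ∈ O, |((x + z) (p + l) - (x + z) (q' + l)) ^ 2 -
      ((x + Function.update z q 0) (p + l) - (x + Function.update z q 0) (q' + l)) ^ 2| ≤
      4 * √K * (M + 1) * ((if l = q - p then 1 else 0) + (if l = q - q' then 1 else 0)) := by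
    intro l _
    have e1 : (p + l = q) ↔ (l = q - p) := by rw [eq_sub_iff_add_eq, add_comm]
    have e2 : (q' + l = q) ↔ (l = q - q') := by rw [eq_sub_iff_add_eq, add_comm]
    have d1 := hdiff (p + l)
    have d2 := hdiff (q' + l)
    simp only [e1, e2] at d1 d2
    rw [sq_sub_sq, abs_mul]
    simp only [Pi.add_apply]
    have a1 := abs_le.1 (hz (p + l))
    have a2 := abs_le.1 (hz (q' + l))
    have a3 := abs_le.1 (hz0 (p + l))
    have a4 := abs_le.1 (hz0 (q' + l))
    have b1 := hx (p + l)
    have b2 := hx (q' + l)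
    have f1 : |x (p + l) + z (p + l) - (x (q' + l) + z (q' + l)) +
        (x (p + l) + Function.update z q 0 (p + l) -
          (x (q' + l) + Function.update z q 0 (q' + l)))| ≤ 4 * (M + 1) := by
      rw [abs_le]; constructor <;> linarith [b1.1, b1.2, b2.1, b2.2]
    have f2 : |x (p + l) + z (p + l) - (x (q' + l) + z (q' + l)) -
        (x (p + l) + Function.update z q 0 (p + l) -
          (x (q' + l) + Function.update z q 0 (q' + l)))| ≤
        √K * ((if l = q - p then 1 else 0) + (if l = q - q' then 1 else 0)) := by
      have : x (p + l) + z (p + l) - (x (q' + l) + z (q' + l)) -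
        (x (p + l) + Function.update z q 0 (p + l) -
          (x (q' + l) + Function.update z q 0 (q' + l))) =
          (z (p + l) - Function.update z q 0 (p + l)) -
          (z (q' + l) - Function.update z q 0 (q' + l)) := by ring
      rw [this, mul_add]
      exact (abs_sub _ _).trans (add_le_add d1 d2)
    calc _ ≤ 4 * (M + 1) *
          (√K * ((if l = q - p then 1 else 0) + (if l = q - q' then 1 else 0))) := by gcongr
      _ = _ := by ring
  unfold patchEnergy
  rw [← Finset.sum_sub_distrib]
  refine (Finset.abs_sum_le_sum_abs _ _).trans ((Finset.sum_le_sum hterm).trans ?_)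
  rw [← Finset.mul_sum, Finset.sum_add_distrib, Finset.sum_ite_eq', Finset.sum_ite_eq']
  have h1 : (if q - p ∈ O then (1 : ℝ) else 0) ≤ 1 := by split_ifs <;> norm_num
  have h2 : (if q - q' ∈ O then (1 : ℝ) else 0) ≤ 1 := by split_ifs <;> norm_num
  have h3 : 0 ≤ 4 * √K * (M + 1) := by positivity
  nlinarith

/-- The derivative at `κ = 0` of half the patch distance when the noise in the patch around `p` is
multiplied by `1 + κ`. -/
def scaleSlope (O : Finset V) (x : V → ℝ) (p q : V) (z : V → ℝ) : ℝ :=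
  ∑ l ∈ O, (x (p + l) + z (p + l) - (x (q + l) + z (q + l))) *
    (z (p + l) - if q + l ∈ O.image (p + ·) then z (q + l) else 0)

/-- The energy is a quadratic polynomial in κ with nonnegative leading coefficient, so for κ ≥ 0 it
grows at least with its slope at 0. The noise around q is scaled too where the patches overlap,
which is what the conditional term in `scaleSlope` records. -/
lemma patchEnergy_scaleOn_mono {q : V} {z : V → ℝ} {m : ℝ} (hm : m ≤ scaleSlope O x p q z)
    {κ κ' : ℝ} (hκ : 0 ≤ κ) (hκ' : κ ≤ κ') :
    patchEnergy O (x + scaleOn (O.image (p + ·)) κ z) p q + 2 * (κ' - κ) * m ≤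
      patchEnergy O (x + scaleOn (O.image (p + ·)) κ' z) p q := by
  set g : V → ℝ := fun l => z (p + l) - if q + l ∈ O.image (p + ·) then z (q + l) else 0 with hg
  set ζ : V → ℝ := fun l => x (p + l) + z (p + l) - (x (q + l) + z (q + l)) with hζ
  have hform : ∀ κ, patchEnergy O (x + scaleOn (O.image (p + ·)) κ z) p q =
      ∑ l ∈ O, ζ l ^ 2 + 2 * κ * ∑ l ∈ O, ζ l * g l + κ ^ 2 * ∑ l ∈ O, g l ^ 2 := by
    intro κ
    rw [Finset.mul_sum, Finset.mul_sum, ← Finset.sum_add_distrib, ← Finset.sum_add_distrib]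
    refine Finset.sum_congr rfl fun l hl => ?_
    have hpl : p + l ∈ O.image (p + ·) := Finset.mem_image_of_mem _ hl
    simp only [Pi.add_apply, scaleOn, hpl, if_true, hg, hζ]
    split_ifs <;> ring
  rw [hform, hform]
  have h1 : m ≤ ∑ l ∈ O, ζ l * g l := hm
  have h2 : 0 ≤ ∑ l ∈ O, g l ^ 2 := Finset.sum_nonneg fun _ _ => sq_nonneg _
  have h3 : κ ^ 2 ≤ κ' ^ 2 := by gcongr
  nlinarith [mul_le_mul_of_nonneg_right h3 h2, mul_le_mul_of_nonneg_left h1 (sub_nonneg.2 hκ')]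

lemma measurable_scaleSlope (O : Finset V) (x : V → ℝ) (p q : V) :
    Measurable (scaleSlope O x p q) := by
  refine Finset.measurable_sum _ fun l _ => Measurable.mul (by fun_prop) ?_
  split_ifs <;> fun_prop

/-- Expanding the product, ∑ z(p+l)² is the main term of size σ²N. Four cross terms are small, and
the squares from the overlap of the patches have the good sign and are dropped. -/
lemma scaleSlope_ge {q : V} {z : V → ℝ} {s : ℝ} {c : V → ℝ} (hc : ∀ l, c l = x (p + l) - x (q + l))
    (h1 : σ ^ 2 * O.card - 2 * s ≤ ∑ l ∈ O, z (p + l) ^ 2)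
    (h2 : |∑ l ∈ O, c l * z (p + l)| ≤ s)
    (h3 : |∑ l ∈ O.filter (q + · ∈ O.image (p + ·)), c l * z (q + l)| ≤ s)
    (h4 : |∑ l ∈ O, z (p + l) * z (q + l)| ≤ s)
    (h5 : |∑ l ∈ O.filter (q + · ∈ O.image (p + ·)), z (p + l) * z (q + l)| ≤ s) :
    σ ^ 2 * O.card - 6 * s ≤ scaleSlope O x p q z := by
  have hform : scaleSlope O x p q z = ∑ l ∈ O, z (p + l) ^ 2 + ∑ l ∈ O, c l * z (p + l) -
      ∑ l ∈ O.filter (q + · ∈ O.image (p + ·)), c l * z (q + l) -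
      ∑ l ∈ O, z (p + l) * z (q + l) -
      ∑ l ∈ O.filter (q + · ∈ O.image (p + ·)), z (p + l) * z (q + l) +
      ∑ l ∈ O.filter (q + · ∈ O.image (p + ·)), z (q + l) ^ 2 := by
    rw [Finset.sum_filter, Finset.sum_filter, Finset.sum_filter, ← Finset.sum_add_distrib,
      ← Finset.sum_sub_distrib, ← Finset.sum_sub_distrib, ← Finset.sum_sub_distrib,
      ← Finset.sum_add_distrib]
    refine Finset.sum_congr rfl fun l _ => ?_
    rw [hc]
    split_ifs <;> ring
  have h6 : 0 ≤ ∑ l ∈ O.filter (q + · ∈ O.image (p + ·)), z (q + l) ^ 2 :=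
    Finset.sum_nonneg fun _ _ => sq_nonneg _
  rw [hform]
  linarith [(abs_le.1 h2).1, (abs_le.1 h3).2, (abs_le.1 h4).2, (abs_le.1 h5).2]

variable [Fintype V]

/-- Take s = σ²N/8 in `scaleSlope_ge`: the tolerance is 1/4 for the squares and 1/8 for each cross
term, which leaves (1 - 6/8)σ²N. The linear terms use τ = σ/8, whence the minimum with σ² and 1024 =
16 · 64. -/
lemma gaussNoise_scaleSlope_lt_le (hσ : 0 < σ) (hO : ShiftBicolorable O)
    (hx : ∀ i, x i ∈ Set.Icc (0 : ℝ) 1) {q : V} (hpq : p ≠ q) :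
    gaussNoise V σ {z | scaleSlope O x p q z < σ ^ 2 * O.card / 4} ≤
      ENNReal.ofReal (20 * Real.exp (-(min 1 (σ ^ 2) * O.card / 1024))) := by
  set I := O.filter (q + · ∈ O.image (p + ·)) with hI
  have hIsub : I ⊆ O := Finset.filter_subset _ _
  set c : V → ℝ := fun l => x (p + l) - x (q + l) with hc
  have hc1 : ∀ l, |c l| ≤ 1 := fun l => by
    have h1 := hx (p + l)
    have h2 := hx (q + l)
    rw [abs_le]
    constructor <;> simp only [hc] <;> linarith [h1.1, h1.2, h2.1, h2.2]
  set E := ENNReal.ofReal (4 * Real.exp (-(min 1 (σ ^ 2) * O.card / 1024))) with hE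
  have hle : ∀ τ : ℝ, min 1 (σ ^ 2) / 64 ≤ τ ^ 2 →
      ENNReal.ofReal (4 * Real.exp (-(τ ^ 2 * O.card / 16))) ≤ E := by
    intro τ hτ
    refine ENNReal.ofReal_le_ofReal ?_
    gcongr 4 * Real.exp (-?_)
    have := mul_le_mul_of_nonneg_right hτ (Nat.cast_nonneg (α := ℝ) O.card)
    linarith
  have m1 : min 1 (σ ^ 2) ≤ 1 := min_le_left _ _
  have m2 : min 1 (σ ^ 2) ≤ σ ^ 2 := min_le_right _ _
  have p1 := (gaussNoise_sum_sq_le hσ p (le_refl O.card) (τ := 1 / 4) (by norm_num)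
    (by norm_num)).trans (hle _ (by norm_num; linarith))
  have p2 := (gaussNoise_sum_le hσ p (le_refl O.card) hc1 (σ / 8) (by positivity)).trans
    (hle _ (by rw [div_pow]; linarith))
  have p3 := (gaussNoise_sum_le hσ q (Finset.card_le_card hIsub) hc1 (σ / 8) (by positivity)).trans
    (hle _ (by rw [div_pow]; linarith))
  have p4 := (gaussNoise_sum_mul_le hσ hO hpq (Finset.Subset.refl O) (le_refl O.card) (τ := 1 / 8)
    (by norm_num) (by norm_num)).trans (hle _ (by norm_num; linarith))
  have p5 := (gaussNoise_sum_mul_le hσ hO hpq hIsub (Finset.card_le_card hIsub) (τ := 1 / 8)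
    (by norm_num) (by norm_num)).trans (hle _ (by norm_num; linarith))
  have hsub : {z | scaleSlope O x p q z < σ ^ 2 * O.card / 4} ⊆ {z : V → ℝ | 1 / 4 * σ ^ 2 * O.card ≤
        |∑ l ∈ O, z (p + l) ^ 2 - σ ^ 2 * O.card|} ∪
        ({z | σ / 8 * σ * O.card ≤ |∑ l ∈ O, c l * z (p + l)|} ∪
        ({z | σ / 8 * σ * O.card ≤ |∑ l ∈ I, c l * z (q + l)|} ∪
        ({z | 1 / 8 * σ ^ 2 * O.card ≤ |∑ l ∈ O, z (p + l) * z (q + l)|} ∪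
        {z | 1 / 8 * σ ^ 2 * O.card ≤ |∑ l ∈ I, z (p + l) * z (q + l)|}))) := by
    intro z hz
    by_contra hcon
    simp only [Set.mem_union, not_or] at hcon
    obtain ⟨h1, h2, h3, h4, h5⟩ := hcon
    simp only [Set.mem_ofPred_eq, not_le] at h1 h2 h3 h4 h5 hz
    have := scaleSlope_ge (σ := σ) (s := σ ^ 2 * O.card / 8) (c := c) (x := x) (p := p) (q := q)
      (z := z) (O := O) (fun l => rfl) (by linarith [(abs_lt.1 h1).1]) (by linarith) (by linarith)
      (by linarith) (by linarith)
    linarith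
  have hsum := (measure_mono hsub).trans ((measure_union_le (μ := gaussNoise V σ) _ _).trans
    (add_le_add p1 ((measure_union_le _ _).trans (add_le_add p2 ((measure_union_le _ _).trans
      (add_le_add p3 ((measure_union_le _ _).trans (add_le_add p4 p5))))))))
  refine hsum.trans_eq ?_
  rw [show (20 : ℝ) * Real.exp (-(min 1 (σ ^ 2) * O.card / 1024)) =
    5 * (4 * Real.exp (-(min 1 (σ ^ 2) * O.card / 1024))) by ring,
    ENNReal.ofReal_mul (by norm_num), ← hE, show ENNReal.ofReal 5 = 5 by simp]
  ring

end PatchEnergy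

/-! ### Bounded noise of the estimator at an arbitrary pixel. -/

section Variance

variable {V : Type*} [AddCommGroup V] [DecidableEq V] [Fintype V] {O : Finset V} {x : V → ℝ}
  {p : V} {σ : ℝ}

/-- The abstract bound on instability is applied with Φ j scaling the noise in the patch around p by
1 + jκ₁. The pixel p itself has energy 0 and keeps the count positive. -/
lemma mul_gaussNoise_unstableSet_patchEnergy_le (hσ : 0 < σ) (hO : ShiftBicolorable O)
    (hOne : O.Nonempty) (hx : ∀ i, x i ∈ Set.Icc (0 : ℝ) 1) {v K H : ℝ} {J : ℕ} (hv : 0 ≤ v)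
    (hK1 : 1 ≤ K) (hH : 0 ≤ H) (hKO : K ≤ √O.card)
    (hstep : J * (2 * H / (σ ^ 2 * O.card)) * K * √O.card ≤ 1) :
    J * gaussNoise V σ (unstableSet (fun q z => patchEnergy O (x + z) p q) v H O.card) ≤
      J * ENNReal.ofReal (4 * Real.exp (-(K ^ 2 / 16))) +
        ENNReal.ofReal (Real.exp 3) * (ENNReal.ofReal (Real.log (8 * O.card)) +
          J * ENNReal.ofReal (Fintype.card V *
            (20 * Real.exp (-(min 1 (σ ^ 2) * O.card / 1024))))) := by
  set N : ℝ := (O.card : ℝ) with hN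
  have hNpos : 0 < N := Nat.cast_pos.2 hOne.card_pos
  have hsN : 0 < √N := Real.sqrt_pos.2 hNpos
  have hsq : √N * √N = N := Real.mul_self_sqrt hNpos.le
  set U := O.image (p + ·) with hU
  have hUcard : U.card = O.card := Finset.card_image_of_injective _ (add_right_injective p)
  -- A step κ₁ at slope 2 · σ²N/4 raises the energy by exactly H.
  set κ₁ := 2 * H / (σ ^ 2 * N) with hκ₁
  have hκ₁0 : 0 ≤ κ₁ := by positivity
  -- A deficit of K standard deviations, up to a constant, in the sum of squares. Under `hstep` the
  -- scaling then costs at most exp(1 + 2) in probability.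
  set X := σ ^ 2 * K * √N with hX
  have hX0 : 0 ≤ X := by positivity
  have hUsum : ∀ z : V → ℝ, ∑ i ∈ U, z i ^ 2 = ∑ l ∈ O, z (p + l) ^ 2 := fun z =>
    Finset.sum_image fun a _ b _ h => add_left_cancel h
  set A : Set (V → ℝ) := {z | σ ^ 2 * N - X ≤ ∑ l ∈ O, z (p + l) ^ 2} with hA
  have hAm : MeasurableSet A := measurableSet_le measurable_const (by fun_prop)
  set D : Set (V → ℝ) := ⋂ q ∈ {q | q ≠ p}, {z | σ ^ 2 * N / 4 ≤ scaleSlope O x p q z} with hD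
  have hDm : MeasurableSet D := by
    refine MeasurableSet.biInter (Set.to_countable _) fun q _ => ?_
    exact measurableSet_le measurable_const (measurable_scaleSlope O x p q)
  have hμA : gaussNoise V σ Aᶜ ≤ ENNReal.ofReal (4 * Real.exp (-(K ^ 2 / 16))) := by
    have h := gaussNoise_sum_sq_le hσ p (le_refl O.card) (τ := K / √N) (by positivity)
      (by rw [div_le_one hsN]; exact hKO)
    have e1 : (K / √N) ^ 2 * O.card / 16 = K ^ 2 / 16 := by
      rw [← hN, div_pow, Real.sq_sqrt hNpos.le]; field_simp
    rw [e1] at h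
    refine (measure_mono fun z hz => ?_).trans h
    simp only [hA, Set.mem_compl_iff, Set.mem_ofPred_eq, not_le] at hz ⊢
    have e2 : K / √N * σ ^ 2 * O.card = X := by
      rw [← hN, hX]
      nth_rewrite 2 [← hsq]
      field_simp
    rw [e2, le_abs]
    right
    linarith
  have hμD : gaussNoise V σ Dᶜ ≤ ENNReal.ofReal (Fintype.card V *
      (20 * Real.exp (-(min 1 (σ ^ 2) * N / 1024)))) := by
    calc gaussNoise V σ Dᶜ ≤ gaussNoise V σ (⋃ q, {z | q ≠ p ∧
          scaleSlope O x p q z < σ ^ 2 * N / 4}) := by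
          refine measure_mono fun z hz => ?_
          simp only [hD, Set.mem_compl_iff, Set.mem_iInter, Set.mem_ofPred_eq, not_forall,
            not_le] at hz
          obtain ⟨q, hq, h⟩ := hz
          exact Set.mem_iUnion.2 ⟨q, hq, h⟩
      _ ≤ ∑ q, gaussNoise V σ {z | q ≠ p ∧ scaleSlope O x p q z < σ ^ 2 * N / 4} :=
          measure_iUnion_fintype_le _ _
      _ ≤ ∑ _q : V, ENNReal.ofReal (20 * Real.exp (-(min 1 (σ ^ 2) * N / 1024))) := by
          refine Finset.sum_le_sum fun q _ => ?_
          by_cases hq : q = p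
          · simp [hq]
          · exact (measure_mono fun z hz => hz.2).trans
              (gaussNoise_scaleSlope_lt_le hσ hO hx (Ne.symm hq))
      _ = _ := by
          rw [Finset.sum_const, Finset.card_univ, nsmul_eq_mul,
            ENNReal.ofReal_mul (p := (Fintype.card V : ℝ)) (by positivity),
            ENNReal.ofReal_natCast]
  have hmain := mul_measure_unstableSet_le (e := fun q z => patchEnergy O (x + z) p q) (v := v)
    (H := H) (b := O.card) (J := J) (fun q => measurable_patchEnergy O x p q) hOne.card_pos hH
    (μ := gaussNoise V σ) (Φ := fun j => scaleOn U (j * κ₁)) (fun j => measurable_scaleOn U _)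
    hAm hDm (c := ENNReal.ofReal (Real.exp 3)) ?_ ?_ fun z => ⟨p, by simpa using hv⟩
  · refine hmain.trans ?_
    gcongr
  · intro j hj B hBm hBA
    have hκ0 : 0 ≤ ((j + 1 : ℕ) : ℝ) * κ₁ := by positivity
    refine (gaussNoise_le_scaleOn hσ U hκ0 hX0 hBm fun z hz => ?_).trans ?_
    · rw [hUsum, hUcard]; exact hBA hz
    · gcongr
      have hjJ : ((j + 1 : ℕ) : ℝ) ≤ J := by exact_mod_cast hj
      have h1 : ((j + 1 : ℕ) : ℝ) * κ₁ * K * √N ≤ 1 :=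
        le_trans (by gcongr) hstep
      have h2 : ((j + 1 : ℕ) : ℝ) * κ₁ * √N ≤ 1 := by
        refine le_trans ?_ h1
        have : 0 ≤ ((j + 1 : ℕ) : ℝ) * κ₁ * √N := by positivity
        nlinarith
      have e1 : ((j + 1 : ℕ) : ℝ) * κ₁ * X / σ ^ 2 = ((j + 1 : ℕ) : ℝ) * κ₁ * K * √N := by
        rw [hX]; field_simp
      have e2 : 2 * (((j + 1 : ℕ) : ℝ) * κ₁) ^ 2 * (U.card : ℝ) =
          2 * (((j + 1 : ℕ) : ℝ) * κ₁ * √N) ^ 2 := by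
        rw [hUcard, ← hN, mul_pow _ (√N), Real.sq_sqrt hNpos.le]; ring
      rw [e1, e2]
      have h3 : (((j + 1 : ℕ) : ℝ) * κ₁ * √N) ^ 2 ≤ 1 := pow_le_one₀ (by positivity) h2
      linarith
  · intro z hz j _ q hle
    by_cases hq : q = p
    · subst hq; simpa using hv
    · have hslope : σ ^ 2 * N / 4 ≤ scaleSlope O x p q z := by
        have := Set.mem_iInter₂.1 hz q hq
        exact this
      have := patchEnergy_scaleOn_mono hslope (κ := j * κ₁) (κ' := (j + 1 : ℕ) * κ₁)
        (by positivity) (by push_cast; linarith)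
      have e1 : 2 * (((j + 1 : ℕ) : ℝ) * κ₁ - j * κ₁) * (σ ^ 2 * N / 4) = H := by
        rw [hκ₁]; push_cast; field_simp; ring
      rw [e1] at this
      linarith

/-- The mean-square noise of an average over the patches similar to a given patch is bounded. -/
lemma sum_lintegral_sq_selWeight_patchEnergy_le (hσ : 0 < σ) (hO : ShiftBicolorable O)
    (h0 : (0 : V) ∉ O) (hOne : O.Nonempty) (hx : ∀ i, x i ∈ Set.Icc (0 : ℝ) 1) {v K M : ℝ}
    {J : ℕ} (hv : 0 ≤ v) (hK1 : 1 ≤ K) (hM : 0 ≤ M) (hJ : 0 < J) (hKO : K ≤ √O.card)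
    (hstep : J * (2 * (4 * (8 * √K * (M + 1))) / (σ ^ 2 * O.card)) * K * √O.card ≤ 1)
    (hhalf : 2 * Real.exp (-K / (4 * σ ^ 2)) ≤ 1 / 2)
    (htail : 64 * σ ^ 2 * O.card * Real.exp (-K / (8 * σ ^ 2)) ≤ 1)
    (hmax : Fintype.card V * (Fintype.card V * (2 * Real.exp (-M ^ 2 / (4 * σ ^ 2)))) ≤ 1)
    (hmaxK : K * (Fintype.card V * (2 * Real.exp (-M ^ 2 / (4 * σ ^ 2)))) ≤ 1)
    (hKexp : K * (4 * Real.exp (-(K ^ 2 / 16))) ≤ 1)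
    (hJK : K * Real.exp 3 * Real.log (8 * O.card) ≤ J)
    (hslope : K * Real.exp 3 * (Fintype.card V *
      (20 * Real.exp (-(min 1 (σ ^ 2) * O.card / 1024)))) ≤ 1) (p : V) :
    ∑ q, ∫⁻ z, ENNReal.ofReal (z q ^ 2) *
      selWeight (fun q z => patchEnergy O (x + z) p q) v q z ∂gaussNoise V σ ≤
      ENNReal.ofReal (43 * σ ^ 2 + 5) := by
  set e : V → (V → ℝ) → ℝ := fun q z => patchEnergy O (x + z) p q with he
  set Ω₀ : Set (V → ℝ) := {z | ∀ i, |z i| ≤ M} with hΩ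
  have hΩm : MeasurableSet Ω₀ := by
    have : Ω₀ = ⋂ i, {z | |z i| ≤ M} := by ext z; simp [hΩ]
    rw [this]
    exact MeasurableSet.iInter fun i => measurableSet_le (by fun_prop) measurable_const
  set G := 8 * √K * (M + 1) with hG
  have hG0 : 0 ≤ G := by positivity
  have hK0 : 0 ≤ K := by linarith
  have hhalf' : 1 / 2 ≤ gaussianReal 0 (σ ^ 2).toNNReal {x | x ^ 2 ≤ K} := by
    have hm : MeasurableSet {x : ℝ | x ^ 2 ≤ K} := measurableSet_le (by fun_prop) (by fun_prop)
    have h1 := prob_add_prob_compl (μ := gaussianReal 0 (σ ^ 2).toNNReal) hm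
    have h2 : gaussianReal 0 (σ ^ 2).toNNReal {x : ℝ | x ^ 2 ≤ K}ᶜ ≤ 1 / 2 := by
      have h3 : {x : ℝ | x ^ 2 ≤ K}ᶜ = {x | K < x ^ 2} := by ext; simp
      rw [h3]
      refine (gaussianReal_sq_gt_le hσ K).trans ((ENNReal.ofReal_le_ofReal hhalf).trans_eq ?_)
      rw [one_div, one_div, ENNReal.ofReal_inv_of_pos (by norm_num)]
      simp
    by_contra h4
    push Not at h4
    have := ENNReal.add_lt_add_of_lt_of_le (by finiteness) h4 h2
    rw [h1, ENNReal.add_halves] at this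
    exact lt_irrefl _ this
  have hcore := sum_lintegral_sq_selWeight_le (e := e) (v := v) (σ := σ)
    (fun q => measurable_patchEnergy O x p q) (N := O.image (p + ·)) (b := O.card) hOne.card_pos
    Finset.card_image_le (B := fun q => O.image (q - ·)) (fun q => Finset.card_image_le)
    (fun q hq z c => patchEnergy_update hq (fun h => by
      obtain ⟨l, hl, h⟩ := Finset.mem_image.1 h
      exact h0 (by rwa [sub_eq_self.1 h] at hl)) z c)
    (fun q hq q' hq' z c => patchEnergy_update hq hq' z c) hΩm (K := K) (G := G)
    (fun q z hz hzq q' => abs_patchEnergy_sub_update_le hx hz hzq q') hhalf'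
  have hP := gaussNoise_exists_abs_gt_le (V := V) hσ hM
  have hU := mul_gaussNoise_unstableSet_patchEnergy_le (p := p) hσ hO hOne hx (v := v) (K := K)
    (H := 4 * G) (J := J) hv hK1 (by positivity) hKO hstep
  set PU := gaussNoise V σ (unstableSet e v (4 * G) O.card) with hPU
  -- Three contributions of at most 1: a deficit of the patch norm, the log(8N) drops divided by J,
  -- and a small slope for some q.
  have hKU : ENNReal.ofReal K * PU ≤ 3 := by
    have hJ0 : (J : ℝ≥0∞) ≠ 0 := by simp; omega
    have hJt : (J : ℝ≥0∞) ≠ ∞ := ENNReal.natCast_ne_top _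
    have h1 : ENNReal.ofReal K * ENNReal.ofReal (4 * Real.exp (-(K ^ 2 / 16))) ≤ 1 := by
      rw [← ENNReal.ofReal_mul hK0]; simpa using ENNReal.ofReal_le_ofReal hKexp
    have h2 : ENNReal.ofReal K * ENNReal.ofReal (Real.exp 3) *
        ENNReal.ofReal (Real.log (8 * O.card)) ≤ J := by
      rw [← ENNReal.ofReal_mul hK0, ← ENNReal.ofReal_mul (by positivity),
        ← ENNReal.ofReal_natCast]
      exact ENNReal.ofReal_le_ofReal hJK
    have h3 : ENNReal.ofReal K * ENNReal.ofReal (Real.exp 3) * ENNReal.ofReal (Fintype.card V *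
        (20 * Real.exp (-(min 1 (σ ^ 2) * O.card / 1024)))) ≤ 1 := by
      rw [← ENNReal.ofReal_mul hK0, ← ENNReal.ofReal_mul (by positivity)]
      simpa using ENNReal.ofReal_le_ofReal hslope
    rw [← ENNReal.mul_le_mul_iff_right hJ0 hJt]
    calc J * (ENNReal.ofReal K * PU) = ENNReal.ofReal K * (J * PU) := by ring
      _ ≤ ENNReal.ofReal K * (J * ENNReal.ofReal (4 * Real.exp (-(K ^ 2 / 16))) +
        ENNReal.ofReal (Real.exp 3) * (ENNReal.ofReal (Real.log (8 * O.card)) +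
          J * ENNReal.ofReal (Fintype.card V *
            (20 * Real.exp (-(min 1 (σ ^ 2) * O.card / 1024)))))) := by gcongr
      _ = J * (ENNReal.ofReal K * ENNReal.ofReal (4 * Real.exp (-(K ^ 2 / 16)))) +
          ENNReal.ofReal K * ENNReal.ofReal (Real.exp 3) *
            ENNReal.ofReal (Real.log (8 * O.card)) +
          J * (ENNReal.ofReal K * ENNReal.ofReal (Real.exp 3) * ENNReal.ofReal (Fintype.card V *
            (20 * Real.exp (-(min 1 (σ ^ 2) * O.card / 1024))))) := by ring
      _ ≤ J * 1 + J + J * 1 := by gcongr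
      _ = J * 3 := by ring
  have hKP : ENNReal.ofReal K * gaussNoise V σ Ω₀ᶜ ≤ 1 := by
    refine (mul_le_mul' le_rfl hP).trans ?_
    rw [← ENNReal.ofReal_mul hK0]; simpa using ENNReal.ofReal_le_ofReal hmaxK
  have hVP : Fintype.card V * gaussNoise V σ Ω₀ᶜ ≤ 1 := by
    refine (mul_le_mul' le_rfl hP).trans ?_
    rw [← ENNReal.ofReal_natCast (Fintype.card V), ← ENNReal.ofReal_mul (by positivity)]
    simpa using ENNReal.ofReal_le_ofReal hmax
  have hT : (4 * O.card : ℕ) * ∫⁻ x, ENNReal.ofReal (if x ^ 2 ≤ K then 0 else x ^ 2)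
      ∂gaussianReal 0 (σ ^ 2).toNNReal ≤ 1 := by
    refine (mul_le_mul' le_rfl (lintegral_sq_tail_gaussianReal_le hσ K)).trans ?_
    rw [← ENNReal.ofReal_natCast, ← ENNReal.ofReal_mul (by positivity)]
    refine (ENNReal.ofReal_le_ofReal (le_trans (le_of_eq ?_) htail)).trans (by simp)
    push_cast; ring
  calc _ ≤ _ := hcore
    _ ≤ 3 * ENNReal.ofReal (σ ^ 2) + 1 + 8 * ENNReal.ofReal (σ ^ 2) * (4 + 1) + (1 + 3) := by
        rw [mul_add (ENNReal.ofReal K)]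
        gcongr
    _ = 43 * ENNReal.ofReal (σ ^ 2) + 5 := by ring
    _ = _ := by
        rw [ENNReal.ofReal_add (by positivity) (by norm_num), ENNReal.ofReal_mul (by norm_num)]
        simp

end Variance

/-! ### The estimator at flat pixels. -/

/-- The average of the values of `y` at the points whose patch has squared distance at most `v`
from the patch around `p`. -/
noncomputable def patchMean {V : Type*} [Fintype V] [Add V] (O : Finset V) (v : ℝ) (y : V → ℝ)
    (p : V) : ℝ :=
  (∑ q, (if patchEnergy O y p q ≤ v then 1 else 0) * y q) /
    ∑ q, if patchEnergy O y p q ≤ v then (1 : ℝ) else 0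

/-- The noise configurations for which all patch sums are close to their means. -/
def concentrated {V : Type*} [Add V] (O : Finset V) (σ τ : ℝ) : Set (V → ℝ) :=
  {z | (∀ p, |∑ l ∈ O, z (p + l) ^ 2 - σ ^ 2 * O.card| < τ * σ ^ 2 * O.card) ∧
    (∀ p, |∑ l ∈ O, z (p + l)| < τ * σ * O.card) ∧
    ∀ p q, p ≠ q → |∑ l ∈ O, z (p + l) * z (q + l)| < τ * σ ^ 2 * O.card}

/-- Read off from the exponential moment through u² ≤ 2(exp u + exp(-u)) at the scale of one
standard deviation, which gives the constant 8 instead of 1. -/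
lemma lintegral_sq_sum_le {V : Type*} [Fintype V] [DecidableEq V] {σ : ℝ} (hσ : 0 < σ)
    (F : Finset V) :
    ∫⁻ z, ENNReal.ofReal ((∑ i ∈ F, z i) ^ 2) ∂gaussNoise V σ ≤
      ENNReal.ofReal (8 * σ ^ 2 * F.card) := by
  rcases F.eq_empty_or_nonempty with rfl | hF
  · simp
  have hN : (0 : ℝ) < F.card := by exact_mod_cast hF.card_pos
  have hsN : 0 < √(F.card : ℝ) := Real.sqrt_pos.2 hN
  have key : ∀ s : ℝ, s ^ 2 = 1 / (σ ^ 2 * F.card) →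
      ∫⁻ z, ENNReal.ofReal (Real.exp (∑ i ∈ F, s * z i)) ∂gaussNoise V σ ≤ ENNReal.ofReal 2 := by
    intro s hs
    refine (lintegral_exp_sum_le σ (A := fun i => {i}) (fun i => by fun_prop)
      (fun i z w h => by rw [h i (by simp)]) (fun i _ j _ h => by simpa using h)
      (b := s ^ 2 * σ ^ 2 / 2) fun i _ => ?_).trans ?_
    · rw [lintegral_gaussNoise_eval σ i (f := fun x => ENNReal.ofReal (Real.exp (s * x)))
        (by fun_prop), lintegral_exp_mul_gaussianReal]
    · refine ENNReal.ofReal_le_ofReal ?_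
      have : F.card * (s ^ 2 * σ ^ 2 / 2) = 1 / 2 := by rw [hs]; field_simp
      rw [this]
      have h1 : Real.exp (1 / 2) ^ 2 = Real.exp 1 := by rw [← Real.exp_nat_mul]; norm_num
      nlinarith [Real.exp_one_lt_d9, Real.exp_pos (1 / 2 : ℝ)]
  set s := 1 / (σ * √(F.card : ℝ)) with hs
  have hs2 : s ^ 2 = 1 / (σ ^ 2 * F.card) := by
    rw [hs, div_pow, mul_pow, Real.sq_sqrt hN.le, one_pow]
  calc _ ≤ ∫⁻ z, ENNReal.ofReal (2 * (σ ^ 2 * F.card)) *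
        (ENNReal.ofReal (Real.exp (∑ i ∈ F, s * z i)) +
          ENNReal.ofReal (Real.exp (∑ i ∈ F, (-s) * z i))) ∂gaussNoise V σ := by
        refine lintegral_mono fun z => ?_
        rw [← ENNReal.ofReal_add (by positivity) (by positivity),
          ← ENNReal.ofReal_mul (by positivity)]
        refine ENNReal.ofReal_le_ofReal ?_
        rw [← Finset.mul_sum, ← Finset.mul_sum]
        set X := ∑ i ∈ F, z i
        have h1 : (s * X) ^ 2 ≤ 2 * (Real.exp (s * X) + Real.exp (-(s * X))) := by
          have h4 := Real.quadratic_le_exp_of_nonneg (abs_nonneg (s * X))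
          rw [sq_abs] at h4
          have h5 := Real.exp_pos (s * X)
          have h6 := Real.exp_pos (-(s * X))
          rcases abs_cases (s * X) with h | h <;> rw [h.1] at h4 <;> linarith [h.2]
        have h2 : σ ^ 2 * F.card * (s * X) ^ 2 = X ^ 2 := by rw [mul_pow, hs2]; field_simp
        have h3 : 0 < σ ^ 2 * F.card := by positivity
        rw [neg_mul]
        nlinarith
    _ = ENNReal.ofReal (2 * (σ ^ 2 * F.card)) *
        (∫⁻ z, ENNReal.ofReal (Real.exp (∑ i ∈ F, s * z i)) ∂gaussNoise V σ +
          ∫⁻ z, ENNReal.ofReal (Real.exp (∑ i ∈ F, (-s) * z i)) ∂gaussNoise V σ) := by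
        rw [lintegral_const_mul _ (by fun_prop), lintegral_add_left (by fun_prop)]
    _ ≤ ENNReal.ofReal (2 * (σ ^ 2 * F.card)) * (ENNReal.ofReal 2 + ENNReal.ofReal 2) := by
        gcongr
        · exact key s hs2
        · exact key (-s) (by rw [neg_sq, hs2])
    _ = _ := by
        rw [← ENNReal.ofReal_add (by norm_num) (by norm_num), ← ENNReal.ofReal_mul (by positivity)]
        congr 1; ring

lemma lintegral_sum_one_add_sq {V : Type*} [Fintype V] (σ : ℝ) (E : Finset V) :
    ∫⁻ z, ENNReal.ofReal (∑ q ∈ E, (1 + z q ^ 2)) ∂gaussNoise V σ =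
      ENNReal.ofReal (E.card * (1 + σ ^ 2)) := by
  simp_rw [ENNReal.ofReal_sum_of_nonneg fun (q : V) _ => add_nonneg zero_le_one (sq_nonneg _)]
  rw [lintegral_finsetSum _ fun q _ => by fun_prop]
  have : ∀ q ∈ E, ∫⁻ z, ENNReal.ofReal (1 + z q ^ 2) ∂gaussNoise V σ =
      ENNReal.ofReal (1 + σ ^ 2) := by
    intro q _
    simp_rw [ENNReal.ofReal_add zero_le_one (sq_nonneg _)]
    rw [lintegral_add_left (by fun_prop), lintegral_gaussNoise_eval σ q
      (f := fun x => ENNReal.ofReal (x ^ 2)) (by fun_prop), lintegral_sq_gaussianReal]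
    simp
  rw [Finset.sum_congr rfl this, Finset.sum_const, nsmul_eq_mul,
    ENNReal.ofReal_mul (by positivity), ENNReal.ofReal_natCast]

lemma lintegral_flat_le {V : Type*} [Fintype V] [DecidableEq V] {σ : ℝ} (hσ : 0 < σ)
    {F E : Finset V} {B : ℝ} (hF : 0 < F.card)
    (hE : (E.card : ℝ) ≤ B) :
    ∫⁻ z, ENNReal.ofReal ((F.card ^ 2 : ℝ)⁻¹ * (2 * (∑ q ∈ F, z q) ^ 2 + 4 * (E.card : ℝ) *
        ∑ q ∈ E, (1 + z q ^ 2))) ∂gaussNoise V σ ≤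
      ENNReal.ofReal ((F.card ^ 2 : ℝ)⁻¹ * (16 * σ ^ 2 * F.card + 4 * B ^ 2 * (1 + σ ^ 2))) := by
  have hs : ∀ z : V → ℝ, 0 ≤ ∑ q ∈ E, (1 + z q ^ 2) := fun z =>
    Finset.sum_nonneg fun _ _ => by positivity
  have e : ∀ z : V → ℝ, ENNReal.ofReal ((F.card ^ 2 : ℝ)⁻¹ * (2 * (∑ q ∈ F, z q) ^ 2 +
      4 * (E.card : ℝ) * ∑ q ∈ E, (1 + z q ^ 2))) = ENNReal.ofReal ((F.card ^ 2 : ℝ)⁻¹) *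
      (ENNReal.ofReal 2 * ENNReal.ofReal ((∑ q ∈ F, z q) ^ 2) + ENNReal.ofReal (4 * (E.card : ℝ)) *
        ENNReal.ofReal (∑ q ∈ E, (1 + z q ^ 2))) := fun z => by
    rw [ENNReal.ofReal_mul (by positivity), ENNReal.ofReal_add (by positivity)
      (mul_nonneg (by positivity) (hs z)), ENNReal.ofReal_mul (by norm_num),
      ENNReal.ofReal_mul (q := ∑ q ∈ E, (1 + z q ^ 2)) (by positivity)]
  simp_rw [e]
  rw [lintegral_const_mul _ (by fun_prop), lintegral_add_left (by fun_prop),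
    lintegral_const_mul _ (by fun_prop), lintegral_const_mul _ (by fun_prop),
    lintegral_sum_one_add_sq, ENNReal.ofReal_mul (p := (F.card ^ 2 : ℝ)⁻¹) (by positivity)]
  gcongr
  refine (add_le_add (mul_le_mul' le_rfl (lintegral_sq_sum_le hσ F)) le_rfl).trans ?_
  rw [← ENNReal.ofReal_mul (by norm_num), ← ENNReal.ofReal_mul (by positivity),
    ← ENNReal.ofReal_add (by positivity) (by positivity)]
  refine ENNReal.ofReal_le_ofReal ?_
  have : (E.card : ℝ) ^ 2 ≤ B ^ 2 := by gcongr
  nlinarith [sq_nonneg σ]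

section FarClass

variable {V : Type*} [AddCommGroup V] {O : Finset V} {x : V → ℝ} {v σ τ : ℝ}

lemma patchEnergy_add_eq {p q : V} {c : ℝ} (hc : ∀ l ∈ O, x (p + l) - x (q + l) = c)
    (z : V → ℝ) :
    patchEnergy O (x + z) p q = c ^ 2 * O.card + 2 * c * (∑ l ∈ O, z (p + l) - ∑ l ∈ O, z (q + l)) +
      ∑ l ∈ O, z (p + l) ^ 2 + ∑ l ∈ O, z (q + l) ^ 2 - 2 * ∑ l ∈ O, z (p + l) * z (q + l) := by
  have h : ∀ l ∈ O, ((x + z) (p + l) - (x + z) (q + l)) ^ 2 = c ^ 2 +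
      2 * c * (z (p + l) - z (q + l)) + z (p + l) ^ 2 + z (q + l) ^ 2 -
      2 * (z (p + l) * z (q + l)) := by
    intro l hl
    rw [← hc l hl]
    simp only [Pi.add_apply]
    ring
  rw [patchEnergy, Finset.sum_congr rfl h, Finset.sum_sub_distrib, Finset.sum_add_distrib,
    Finset.sum_add_distrib, Finset.sum_add_distrib, Finset.sum_const, nsmul_eq_mul,
    ← Finset.mul_sum, ← Finset.mul_sum, Finset.sum_sub_distrib]
  ring

/-- When the clean patches agree, only noise remains: 2σ²N from the squares, plus deviations of at
most τσ²N for each square sum and 2τσ²N for the correlation. -/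
lemma patchEnergy_le_of_concentrated {p q : V} {z : V → ℝ} (hz : z ∈ concentrated O σ τ)
    (hv : O.card * (2 * σ ^ 2 + 4 * τ * σ ^ 2) ≤ v) (hv0 : 0 ≤ v)
    (hc : ∀ l ∈ O, x (p + l) = x (q + l)) : patchEnergy O (x + z) p q ≤ v := by
  by_cases hpq : p = q
  · subst hpq; simpa using hv0
  rw [patchEnergy_add_eq (c := 0) fun l hl => by rw [hc l hl, sub_self]]
  linarith [(abs_lt.1 (hz.1 p)).2, (abs_lt.1 (hz.1 q)).2, (abs_lt.1 (hz.2.2 p q hpq)).1]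

/-- A constant gap of ±1 adds N to the energy. The terms linear in the noise take back less than
4τσN, and the quadratic deviations less than 4τσ²N. -/
lemma lt_patchEnergy_of_concentrated {p q : V} {z : V → ℝ} (hz : z ∈ concentrated O σ τ)
    (hpq : p ≠ q) (hv : v ≤ O.card * (1 - 4 * τ * σ + 2 * σ ^ 2 - 4 * τ * σ ^ 2))
    (hc : (∀ l ∈ O, x (p + l) - x (q + l) = 1) ∨ ∀ l ∈ O, x (p + l) - x (q + l) = -1) :
    v < patchEnergy O (x + z) p q := by
  have h1 := (abs_lt.1 (hz.1 p)).1
  have h2 := (abs_lt.1 (hz.1 q)).1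
  have h3 := (abs_lt.1 (hz.2.2 p q hpq)).2
  have h4 := abs_lt.1 (hz.2.1 p)
  have h5 := abs_lt.1 (hz.2.1 q)
  rcases hc with hc | hc <;> rw [patchEnergy_add_eq hc] <;> linarith [h4.1, h4.2, h5.1, h5.2]

variable [Fintype V]

lemma patchMean_eq (y : V → ℝ) (p : V) :
    patchMean O v y p = (∑ q ∈ Finset.univ.filter (patchEnergy O y p · ≤ v), y q) /
      (Finset.univ.filter (patchEnergy O y p · ≤ v)).card := by
  unfold patchMean
  congr 1
  · rw [Finset.sum_filter]
    exact Finset.sum_congr rfl fun q _ => by split_ifs <;> simp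
  · simp

lemma sub_patchMean_eq (hv : 0 ≤ v) (y : V → ℝ) (p : V) (a : ℝ) :
    a - patchMean O v y p = (∑ q ∈ Finset.univ.filter (patchEnergy O y p · ≤ v), (a - y q)) /
      (Finset.univ.filter (patchEnergy O y p · ≤ v)).card := by
  have hpos : 0 < (Finset.univ.filter (patchEnergy O y p · ≤ v)).card :=
    Finset.card_pos.2 ⟨p, by simpa using hv⟩
  rw [patchMean_eq, Finset.sum_sub_distrib, Finset.sum_const, nsmul_eq_mul, sub_div,
    mul_div_cancel_left₀ _ (by positivity)]

lemma measurable_patchMean (O : Finset V) (v : ℝ) (x : V → ℝ) (p : V) :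
    Measurable fun z => patchMean O v (x + z) p := by
  unfold patchMean
  have h : ∀ q, Measurable fun z : V → ℝ =>
      if patchEnergy O (x + z) p q ≤ v then (1 : ℝ) else 0 := fun q =>
    Measurable.ite (measurableSet_le (measurable_patchEnergy O x p q) measurable_const)
      measurable_const measurable_const
  refine Measurable.div (Finset.measurable_sum _ fun q _ => (h q).mul ?_)
    (Finset.measurable_sum _ fun q _ => h q)
  simp only [Pi.add_apply]
  fun_prop

/-- Cauchy–Schwarz for the average over the selected set, with the bias of each selected pixel at
most 1. -/
lemma ofReal_sq_sub_patchMean_le (hx : ∀ i, x i ∈ Set.Icc (0 : ℝ) 1) (hv : 0 ≤ v) (p : V)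
    (z : V → ℝ) :
    ENNReal.ofReal ((x p - patchMean O v (x + z) p) ^ 2) ≤ 2 + 2 * ∑ q, ENNReal.ofReal (z q ^ 2) *
      selWeight (fun q z => patchEnergy O (x + z) p q) v q z := by
  set W := Finset.univ.filter (patchEnergy O (x + z) p · ≤ v) with hW
  have hpos : 0 < W.card := Finset.card_pos.2 ⟨p, by simpa [hW] using hv⟩
  have hS : (0 : ℝ) < W.card := by exact_mod_cast hpos
  have h1 : (x p - patchMean O v (x + z) p) ^ 2 ≤ 2 + 2 * ((∑ q ∈ W, z q ^ 2) * (W.card : ℝ)⁻¹) := by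
    rw [sub_patchMean_eq hv, div_pow, div_le_iff₀ (by positivity)]
    calc (∑ q ∈ W, (x p - (x + z) q)) ^ 2 ≤ W.card * ∑ q ∈ W, (x p - (x + z) q) ^ 2 :=
          sq_sum_le_card_mul_sum_sq
      _ ≤ W.card * ∑ q ∈ W, (2 + 2 * z q ^ 2) := by
          gcongr with q
          have a1 := hx p
          have a2 := hx q
          have a3 : (x p - x q) ^ 2 ≤ 1 := by
            rw [sq_le_one_iff_abs_le_one, abs_le]
            constructor <;> linarith [a1.1, a1.2, a2.1, a2.2]
          simp only [Pi.add_apply]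
          nlinarith [sq_nonneg (x p - x q + z q)]
      _ = _ := by
          rw [Finset.sum_add_distrib, ← Finset.mul_sum, Finset.sum_const, nsmul_eq_mul, ← hW]
          field_simp
  have h2 : ∑ q, ENNReal.ofReal (z q ^ 2) *
      selWeight (fun q z => patchEnergy O (x + z) p q) v q z =
      ENNReal.ofReal ((∑ q ∈ W, z q ^ 2) * (W.card : ℝ)⁻¹) := by
    rw [ENNReal.ofReal_mul (Finset.sum_nonneg fun _ _ => sq_nonneg _),
      ENNReal.ofReal_sum_of_nonneg fun _ _ => sq_nonneg _, Finset.sum_mul, hW, Finset.sum_filter]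
    refine Finset.sum_congr rfl fun q _ => ?_
    simp only [selWeight, countLe]
    split_ifs
    · rw [ENNReal.ofReal_inv_of_pos hS, ENNReal.ofReal_natCast]
    · simp
  rw [h2]
  refine (ENNReal.ofReal_le_ofReal h1).trans_eq ?_
  rw [ENNReal.ofReal_add (by norm_num) (by positivity), ENNReal.ofReal_mul (by norm_num)]
  simp

lemma measurableSet_concentrated : MeasurableSet (concentrated O σ τ) := by
  have e : concentrated O σ τ =
      (⋂ p, {z | |∑ l ∈ O, z (p + l) ^ 2 - σ ^ 2 * O.card| < τ * σ ^ 2 * O.card}) ∩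
      ((⋂ p, {z | |∑ l ∈ O, z (p + l)| < τ * σ * O.card}) ∩
      ⋂ p, ⋂ q, ⋂ (_ : p ≠ q), {z | |∑ l ∈ O, z (p + l) * z (q + l)| < τ * σ ^ 2 * O.card}) := by
    ext z; simp [concentrated]
  rw [e]
  refine (MeasurableSet.iInter fun p => ?_).inter ((MeasurableSet.iInter fun p => ?_).inter
    (MeasurableSet.iInter fun p => MeasurableSet.iInter fun q => MeasurableSet.iInter fun _ => ?_))
  all_goals exact measurableSet_lt (by fun_prop) measurable_const

variable [DecidableEq V]

lemma gaussNoise_concentrated_compl_le (hσ : 0 < σ) (hO : ShiftBicolorable O) (hτ0 : 0 ≤ τ)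
    (hτ : τ ≤ 1) :
    gaussNoise V σ (concentrated O σ τ)ᶜ ≤
      ENNReal.ofReal (12 * (Fintype.card V : ℝ) ^ 2 * Real.exp (-(τ ^ 2 * O.card / 16))) := by
  set E := ENNReal.ofReal (4 * Real.exp (-(τ ^ 2 * O.card / 16))) with hE
  have hsub : (concentrated O σ τ)ᶜ ⊆
      (⋃ p, {z | τ * σ ^ 2 * O.card ≤ |∑ l ∈ O, z (p + l) ^ 2 - σ ^ 2 * O.card|}) ∪
      ((⋃ p, {z | τ * σ * O.card ≤ |∑ l ∈ O, (1 : ℝ) * z (p + l)|}) ∪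
      ⋃ r : V × V, {z | r.1 ≠ r.2 ∧
        τ * σ ^ 2 * O.card ≤ |∑ l ∈ O, z (r.1 + l) * z (r.2 + l)|}) := by
    intro z hz
    by_contra h
    simp only [Set.mem_union, Set.mem_iUnion, Set.mem_ofPred_eq, not_or, not_exists, not_le,
      not_and, one_mul] at h
    exact hz ⟨h.1, h.2.1, fun p q hpq => h.2.2 (p, q) hpq⟩
  have hV : (Fintype.card V : ℝ≥0∞) ≤ (Fintype.card V : ℝ≥0∞) ^ 2 := by
    have : Fintype.card V ≤ Fintype.card V ^ 2 := Nat.le_self_pow (by norm_num) _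
    exact_mod_cast this
  calc _ ≤ _ := measure_mono hsub
    _ ≤ Fintype.card V * E + (Fintype.card V * E + (Fintype.card V : ℝ≥0∞) ^ 2 * E) := by
        refine (measure_union_le _ _).trans (add_le_add ?_ ((measure_union_le _ _).trans
          (add_le_add ?_ ?_)))
        · refine (measure_iUnion_fintype_le _ _).trans ?_
          refine (Finset.sum_le_sum fun p _ => gaussNoise_sum_sq_le hσ p (le_refl O.card)
            hτ0 hτ).trans_eq ?_
          simp [hE]
        · refine (measure_iUnion_fintype_le _ _).trans ?_
          refine (Finset.sum_le_sum fun p _ => gaussNoise_sum_le hσ p (le_refl O.card)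
            (c := fun _ => 1) (by simp) τ hτ0).trans_eq ?_
          simp [hE]
        · refine (measure_iUnion_fintype_le _ _).trans ?_
          have : ∀ r : V × V, gaussNoise V σ {z | r.1 ≠ r.2 ∧
              τ * σ ^ 2 * O.card ≤ |∑ l ∈ O, z (r.1 + l) * z (r.2 + l)|} ≤ E := by
            intro r
            by_cases hr : r.1 = r.2
            · simp [hr]
            · exact (measure_mono fun z hz => hz.2).trans
                (gaussNoise_sum_mul_le hσ hO hr (Finset.Subset.refl O) le_rfl hτ0 hτ)
          refine (Finset.sum_le_sum fun r _ => this r).trans_eq ?_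
          rw [Finset.sum_const, Finset.card_univ, Fintype.card_prod, nsmul_eq_mul]
          push_cast; ring
    _ ≤ (Fintype.card V : ℝ≥0∞) ^ 2 * E + ((Fintype.card V : ℝ≥0∞) ^ 2 * E +
        (Fintype.card V : ℝ≥0∞) ^ 2 * E) := by gcongr
    _ = 3 * (Fintype.card V : ℝ≥0∞) ^ 2 * E := by ring
    _ = _ := by
        rw [show (12 : ℝ) * (Fintype.card V : ℝ) ^ 2 * Real.exp (-(τ ^ 2 * O.card / 16)) =
          3 * (Fintype.card V : ℝ) ^ 2 * (4 * Real.exp (-(τ ^ 2 * O.card / 16))) by ring,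
          ENNReal.ofReal_mul (p := 3 * (Fintype.card V : ℝ) ^ 2) (by positivity), ← hE,
          ENNReal.ofReal_mul (p := (3 : ℝ)) (by norm_num),
          ENNReal.ofReal_pow (by positivity), ENNReal.ofReal_natCast]
        simp

end FarClass

/-- The points around which `x` is constantly `a`, on the patch and at the centre. -/
noncomputable def flatSet {V : Type*} [Fintype V] [Add V] (O : Finset V) (x : V → ℝ) (a : ℝ) :
    Finset V :=
  Finset.univ.filter fun p => x p = a ∧ ∀ l ∈ O, x (p + l) = a

lemma mem_flatSet {V : Type*} [Fintype V] [Add V] {O : Finset V} {x : V → ℝ} {a : ℝ} {p : V} :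
    p ∈ flatSet O x a ↔ x p = a ∧ ∀ l ∈ O, x (p + l) = a := by
  simp [flatSet]

section Flat

variable {V : Type*} [AddCommGroup V] [Fintype V] [DecidableEq V] {O : Finset V} {x : V → ℝ}
  {v σ τ : ℝ}

/-- The selected set contains F and lies in F ∪ E. On F the bias vanishes and only the noise sum
remains; the part in E is controlled by Cauchy–Schwarz. Both bounds involve fixed sets, so the
random selection has disappeared. -/
lemma sq_sub_patchMean_le_of_concentrated (hx : ∀ i, x i ∈ Set.Icc (0 : ℝ) 1) {a b : ℝ}
    (hab : a - b = 1 ∨ a - b = -1) {p : V} (hp : p ∈ flatSet O x a) {z : V → ℝ}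
    (hz : z ∈ concentrated O σ τ) (hv0 : 0 ≤ v) (hv1 : O.card * (2 * σ ^ 2 + 4 * τ * σ ^ 2) ≤ v)
    (hv2 : v ≤ O.card * (1 - 4 * τ * σ + 2 * σ ^ 2 - 4 * τ * σ ^ 2)) :
    (x p - patchMean O v (x + z) p) ^ 2 ≤ ((flatSet O x a).card ^ 2 : ℝ)⁻¹ *
      (2 * (∑ q ∈ flatSet O x a, z q) ^ 2 + 4 * ((flatSet O x a ∪ flatSet O x b)ᶜ.card : ℝ) *
        ∑ q ∈ (flatSet O x a ∪ flatSet O x b)ᶜ, (1 + z q ^ 2)) := by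
  set F := flatSet O x a with hF
  set E := (F ∪ flatSet O x b)ᶜ with hE
  set W := Finset.univ.filter (patchEnergy O (x + z) p · ≤ v) with hW
  have hpa : x p = a := (mem_flatSet.1 hp).1
  have hpl : ∀ l ∈ O, x (p + l) = a := (mem_flatSet.1 hp).2
  have hFW : F ⊆ W := fun q hq => by
    have hql : ∀ l ∈ O, x (q + l) = a := (mem_flatSet.1 hq).2
    simp only [hW, Finset.mem_filter, Finset.mem_univ, true_and]
    exact patchEnergy_le_of_concentrated hz hv1 hv0 fun l hl => by rw [hpl l hl, hql l hl]
  have hWE : W \ F ⊆ E := fun q hq => by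
    rw [Finset.mem_sdiff] at hq
    simp only [hE, Finset.mem_compl, Finset.mem_union, not_or]
    refine ⟨hq.2, fun hqb => ?_⟩
    have hqb' := mem_flatSet.1 hqb
    have hpq : p ≠ q := by
      rintro rfl
      rw [hpa] at hqb'
      rcases hab with h | h <;> rw [hqb'.1] at h <;> norm_num at h
    have := lt_patchEnergy_of_concentrated (x := x) hz hpq hv2
      (hab.imp (fun h l hl => by rw [hpl l hl, hqb'.2 l hl, h])
        fun h l hl => by rw [hpl l hl, hqb'.2 l hl, h])
    exact absurd (Finset.mem_filter.1 hq.1).2 this.not_ge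
  have hFpos : 0 < F.card := Finset.card_pos.2 ⟨p, hp⟩
  have hWcard : (F.card : ℝ) ≤ W.card := by exact_mod_cast Finset.card_le_card hFW
  have hFr : (0 : ℝ) < F.card := by exact_mod_cast hFpos
  have hsplit : ∑ q ∈ W, (x p - (x + z) q) =
      ∑ q ∈ W \ F, (x p - (x + z) q) - ∑ q ∈ F, z q := by
    rw [← Finset.sum_sdiff hFW, sub_eq_add_neg, ← Finset.sum_neg_distrib]
    congr 1
    refine Finset.sum_congr rfl fun q hq => ?_
    rw [Pi.add_apply, (mem_flatSet.1 hq).1, hpa]; ring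
  have hrest : (∑ q ∈ W \ F, (x p - (x + z) q)) ^ 2 ≤ E.card * ∑ q ∈ E, 2 * (1 + z q ^ 2) := by
    refine sq_sum_le_card_mul_sum_sq.trans ?_
    refine mul_le_mul (by exact_mod_cast Finset.card_le_card hWE) ?_
      (Finset.sum_nonneg fun _ _ => sq_nonneg _) (by positivity)
    calc _ ≤ ∑ q ∈ W \ F, 2 * (1 + z q ^ 2) := by
          refine Finset.sum_le_sum fun q _ => ?_
          have a1 := hx p
          have a2 := hx q
          have a3 : (x p - x q) ^ 2 ≤ 1 := by
            rw [sq_le_one_iff_abs_le_one, abs_le]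
            constructor <;> linarith [a1.1, a1.2, a2.1, a2.2]
          simp only [Pi.add_apply]
          nlinarith [sq_nonneg (x p - x q + z q)]
      _ ≤ _ := Finset.sum_le_sum_of_subset_of_nonneg hWE fun _ _ _ => by positivity
  rw [sub_patchMean_eq hv0, div_pow, div_eq_inv_mul]
  refine mul_le_mul (inv_anti₀ (by positivity) (by gcongr)) ?_ (sq_nonneg _) (by positivity)
  rw [hsplit]
  rw [← Finset.mul_sum] at hrest
  nlinarith [sq_nonneg (∑ q ∈ W \ F, (x p - (x + z) q) + ∑ q ∈ F, z q)]

/-- The error need not be bounded off the concentration event. It is at most 2 + 2K plus twice the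
sum of all z q² that exceed K, and this excess is integrated over the whole space. -/
lemma setLIntegral_sq_sub_patchMean_le (hσ : 0 < σ) (hO : ShiftBicolorable O)
    (hx : ∀ i, x i ∈ Set.Icc (0 : ℝ) 1) (hv : 0 ≤ v) (hτ0 : 0 ≤ τ) (hτ : τ ≤ 1) {K : ℝ}
    (hK : 0 ≤ K) (p : V) :
    ∫⁻ z in (concentrated O σ τ)ᶜ, ENNReal.ofReal ((x p - patchMean O v (x + z) p) ^ 2)
        ∂gaussNoise V σ ≤
      ENNReal.ofReal ((2 + 2 * K) * (12 * (Fintype.card V : ℝ) ^ 2 *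
        Real.exp (-(τ ^ 2 * O.card / 16))) +
        Fintype.card V * (32 * σ ^ 2 * Real.exp (-K / (8 * σ ^ 2)))) := by
  have hpt : ∀ z : V → ℝ, ENNReal.ofReal ((x p - patchMean O v (x + z) p) ^ 2) ≤
      ENNReal.ofReal (2 + 2 * K) +
        2 * ∑ q, ENNReal.ofReal (if z q ^ 2 ≤ K then 0 else z q ^ 2) := by
    intro z
    refine (ofReal_sq_sub_patchMean_le hx hv p z).trans ?_
    have h : ∀ q, ENNReal.ofReal (z q ^ 2) *
        selWeight (fun q z => patchEnergy O (x + z) p q) v q z ≤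
        ENNReal.ofReal K * selWeight (fun q z => patchEnergy O (x + z) p q) v q z +
        ENNReal.ofReal (if z q ^ 2 ≤ K then 0 else z q ^ 2) := by
      intro q
      split_ifs with h
      · simp only [ENNReal.ofReal_zero, add_zero]
        gcongr
      · exact (mul_le_of_le_one_right' (selWeight_le_one _ _)).trans le_add_self
    calc _ ≤ 2 + 2 * (ENNReal.ofReal K * 1 +
          ∑ q, ENNReal.ofReal (if z q ^ 2 ≤ K then 0 else z q ^ 2)) := by
          gcongr
          refine (Finset.sum_le_sum fun q _ => h q).trans ?_
          rw [Finset.sum_add_distrib, ← Finset.mul_sum]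
          gcongr
          exact sum_selWeight_le _
      _ = _ := by
          rw [ENNReal.ofReal_add (by norm_num) (by positivity), ENNReal.ofReal_mul (by norm_num)]
          simp only [ENNReal.ofReal_ofNat]
          ring
  have hm : ∀ q : V, Measurable fun z : V → ℝ =>
      ENNReal.ofReal (if z q ^ 2 ≤ K then 0 else z q ^ 2) := fun q =>
    (Measurable.ite (measurableSet_le (by fun_prop) measurable_const) measurable_const
      (by fun_prop)).ennreal_ofReal
  refine (lintegral_mono hpt).trans ?_
  rw [lintegral_add_left measurable_const, setLIntegral_const, ENNReal.ofReal_add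
    (p := (2 + 2 * K) * (12 * (Fintype.card V : ℝ) ^ 2 * Real.exp (-(τ ^ 2 * O.card / 16))))
    (by positivity) (by positivity)]
  refine add_le_add ?_ ?_
  · rw [ENNReal.ofReal_mul (p := 2 + 2 * K) (by positivity)]
    gcongr
    exact gaussNoise_concentrated_compl_le hσ hO hτ0 hτ
  · refine (setLIntegral_le_lintegral _ _).trans ?_
    rw [lintegral_const_mul _ (Finset.measurable_sum _ fun q _ => hm q),
      lintegral_finsetSum _ fun q _ => hm q]
    have : ∀ q ∈ (Finset.univ : Finset V), ∫⁻ z, ENNReal.ofReal (if z q ^ 2 ≤ K then 0 else z q ^ 2)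
        ∂gaussNoise V σ ≤ ENNReal.ofReal (16 * σ ^ 2 * Real.exp (-K / (8 * σ ^ 2))) := by
      intro q _
      rw [lintegral_gaussNoise_eval σ q
        (f := fun x => ENNReal.ofReal (if x ^ 2 ≤ K then 0 else x ^ 2))]
      · exact lintegral_sq_tail_gaussianReal_le hσ K
      · exact (Measurable.ite (measurableSet_le (by fun_prop) measurable_const) measurable_const
          (by fun_prop)).ennreal_ofReal
    refine (mul_le_mul' le_rfl (Finset.sum_le_sum this)).trans_eq ?_
    rw [Finset.sum_const, Finset.card_univ, nsmul_eq_mul,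
      ENNReal.ofReal_mul (p := (Fintype.card V : ℝ)) (by positivity), ENNReal.ofReal_natCast, show 32 * σ ^ 2 * Real.exp (-K / (8 * σ ^ 2)) =
        2 * (16 * σ ^ 2 * Real.exp (-K / (8 * σ ^ 2))) by ring,
      ENNReal.ofReal_mul (p := (2 : ℝ)) (by norm_num)]
    simp only [ENNReal.ofReal_ofNat]
    ring

lemma lintegral_sq_sub_patchMean_le_of_flat (hσ : 0 < σ) (hO : ShiftBicolorable O)
    (hx : ∀ i, x i ∈ Set.Icc (0 : ℝ) 1) {a b : ℝ} (hab : a - b = 1 ∨ a - b = -1)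
    {p : V} (hp : p ∈ flatSet O x a) (hv0 : 0 ≤ v)
    (hv1 : O.card * (2 * σ ^ 2 + 4 * τ * σ ^ 2) ≤ v)
    (hv2 : v ≤ O.card * (1 - 4 * τ * σ + 2 * σ ^ 2 - 4 * τ * σ ^ 2)) (hτ0 : 0 ≤ τ) (hτ : τ ≤ 1)
    {K B : ℝ} (hK : 0 ≤ K) (hE : ((flatSet O x a ∪ flatSet O x b)ᶜ.card : ℝ) ≤ B) :
    ∫⁻ z, ENNReal.ofReal ((x p - patchMean O v (x + z) p) ^ 2) ∂gaussNoise V σ ≤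
      ENNReal.ofReal (((flatSet O x a).card ^ 2 : ℝ)⁻¹ *
        (16 * σ ^ 2 * (flatSet O x a).card + 4 * B ^ 2 * (1 + σ ^ 2)) +
      ((2 + 2 * K) * (12 * (Fintype.card V : ℝ) ^ 2 * Real.exp (-(τ ^ 2 * O.card / 16))) +
        Fintype.card V * (32 * σ ^ 2 * Real.exp (-K / (8 * σ ^ 2))))) := by
  rw [← lintegral_add_compl _ (measurableSet_concentrated (O := O) (σ := σ) (τ := τ)),
    ENNReal.ofReal_add (by positivity) (by positivity)]
  refine add_le_add ?_ (setLIntegral_sq_sub_patchMean_le hσ hO hx hv0 hτ0 hτ hK p)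
  refine le_trans ?_ (lintegral_flat_le hσ (Finset.card_pos.2 ⟨p, hp⟩) hE)
  refine (setLIntegral_mono' measurableSet_concentrated fun z hz => ENNReal.ofReal_le_ofReal
    (sq_sub_patchMean_le_of_concentrated hx hab hp hz hv0 hv1 hv2)).trans ?_
  exact setLIntegral_le_lintegral _ _

/-- If F has fewer than B points, the uniform bound D at each of them suffices. Otherwise |F| ·
B²/|F|² ≤ B. -/
lemma sum_flat_lintegral_sq_sub_patchMean_le (hσ : 0 < σ) (hO : ShiftBicolorable O)
    (hx : ∀ i, x i ∈ Set.Icc (0 : ℝ) 1) {a b : ℝ} (hab : a - b = 1 ∨ a - b = -1) (hv0 : 0 ≤ v)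
    (hv1 : O.card * (2 * σ ^ 2 + 4 * τ * σ ^ 2) ≤ v)
    (hv2 : v ≤ O.card * (1 - 4 * τ * σ + 2 * σ ^ 2 - 4 * τ * σ ^ 2)) (hτ0 : 0 ≤ τ) (hτ : τ ≤ 1)
    {K B D : ℝ} (hK : 0 ≤ K) (hE : ((flatSet O x a ∪ flatSet O x b)ᶜ.card : ℝ) ≤ B)
    (hB : 1 ≤ B) (hD : 0 ≤ D)
    (hbad : Fintype.card V * ((2 + 2 * K) * (12 * (Fintype.card V : ℝ) ^ 2 *
      Real.exp (-(τ ^ 2 * O.card / 16))) +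
        Fintype.card V * (32 * σ ^ 2 * Real.exp (-K / (8 * σ ^ 2)))) ≤ 1)
    (hcore : ∀ p, ∫⁻ z, ENNReal.ofReal ((x p - patchMean O v (x + z) p) ^ 2) ∂gaussNoise V σ ≤
      ENNReal.ofReal D) :
    ∑ p ∈ flatSet O x a,
      ∫⁻ z, ENNReal.ofReal ((x p - patchMean O v (x + z) p) ^ 2) ∂gaussNoise V σ ≤
      ENNReal.ofReal (B * (D + 20 * σ ^ 2 + 5)) := by
  set F := flatSet O x a with hF
  have key : ∀ r : ℝ, 0 ≤ r → F.card * r ≤ B * (D + 20 * σ ^ 2 + 5) →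
      (∀ p ∈ F, ∫⁻ z, ENNReal.ofReal ((x p - patchMean O v (x + z) p) ^ 2) ∂gaussNoise V σ ≤
        ENNReal.ofReal r) →
      ∑ p ∈ F, ∫⁻ z, ENNReal.ofReal ((x p - patchMean O v (x + z) p) ^ 2) ∂gaussNoise V σ ≤
        ENNReal.ofReal (B * (D + 20 * σ ^ 2 + 5)) := by
    intro r hr hle h
    refine (Finset.sum_le_sum h).trans ?_
    rw [Finset.sum_const, nsmul_eq_mul, ← ENNReal.ofReal_natCast,
      ← ENNReal.ofReal_mul (by positivity)]
    exact ENNReal.ofReal_le_ofReal hle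
  rcases lt_or_ge (F.card : ℝ) B with h | h
  · refine key D hD ?_ fun p _ => hcore p
    have : (F.card : ℝ) * D ≤ B * D := by gcongr
    nlinarith [sq_nonneg σ]
  · refine key _ ?_ ?_ fun p hp =>
      lintegral_sq_sub_patchMean_le_of_flat hσ hO hx hab hp hv0 hv1 hv2 hτ0 hτ hK hE
    · positivity
    · set R := (2 + 2 * K) * (12 * (Fintype.card V : ℝ) ^ 2 *
        Real.exp (-(τ ^ 2 * O.card / 16))) +
        Fintype.card V * (32 * σ ^ 2 * Real.exp (-K / (8 * σ ^ 2))) with hR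
      have hR0 : 0 ≤ R := by positivity
      have hFpos : (0 : ℝ) < F.card := by linarith
      have h1 : (F.card : ℝ) * R ≤ 1 := by
        refine le_trans ?_ hbad
        gcongr
        exact Finset.card_le_univ F
      have h2 : (F.card : ℝ) * ((F.card ^ 2 : ℝ)⁻¹ *
          (16 * σ ^ 2 * F.card + 4 * B ^ 2 * (1 + σ ^ 2))) ≤
          16 * σ ^ 2 + 4 * B * (1 + σ ^ 2) := by
        have e : (F.card : ℝ) * ((F.card ^ 2 : ℝ)⁻¹ *
          (16 * σ ^ 2 * F.card + 4 * B ^ 2 * (1 + σ ^ 2))) =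
          16 * σ ^ 2 + 4 * B * (1 + σ ^ 2) * (B / F.card) := by field_simp
        rw [e]
        have : B / F.card ≤ 1 := (div_le_one hFpos).2 h
        have h3 : 4 * B * (1 + σ ^ 2) * (B / F.card) ≤ 4 * B * (1 + σ ^ 2) :=
          mul_le_of_le_one_right (by positivity) this
        linarith
      rw [mul_add]
      nlinarith [sq_nonneg σ, mul_nonneg (sub_nonneg.2 hB) (sq_nonneg σ),
        mul_nonneg (zero_le_one.trans hB) hD]

/-- The total risk is of the order of the number of points that are not in a flat region. -/
lemma sum_lintegral_sq_sub_patchMean_le (hσ : 0 < σ) (hO : ShiftBicolorable O)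
    (hx : ∀ i, x i ∈ Set.Icc (0 : ℝ) 1) (hv0 : 0 ≤ v)
    (hv1 : O.card * (2 * σ ^ 2 + 4 * τ * σ ^ 2) ≤ v)
    (hv2 : v ≤ O.card * (1 - 4 * τ * σ + 2 * σ ^ 2 - 4 * τ * σ ^ 2)) (hτ0 : 0 ≤ τ) (hτ : τ ≤ 1)
    {K B D : ℝ} (hK : 0 ≤ K) (hE : ((flatSet O x 1 ∪ flatSet O x 0)ᶜ.card : ℝ) ≤ B)
    (hB : 1 ≤ B) (hD : 0 ≤ D)
    (hbad : Fintype.card V * ((2 + 2 * K) * (12 * (Fintype.card V : ℝ) ^ 2 *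
      Real.exp (-(τ ^ 2 * O.card / 16))) +
        Fintype.card V * (32 * σ ^ 2 * Real.exp (-K / (8 * σ ^ 2)))) ≤ 1)
    (hcore : ∀ p, ∑ q, ∫⁻ z, ENNReal.ofReal (z q ^ 2) *
      selWeight (fun q z => patchEnergy O (x + z) p q) v q z ∂gaussNoise V σ ≤ ENNReal.ofReal D) :
    ∑ p, ∫⁻ z, ENNReal.ofReal ((x p - patchMean O v (x + z) p) ^ 2) ∂gaussNoise V σ ≤
      ENNReal.ofReal (B * (6 * D + 40 * σ ^ 2 + 16)) := by
  have hpt : ∀ p, ∫⁻ z, ENNReal.ofReal ((x p - patchMean O v (x + z) p) ^ 2) ∂gaussNoise V σ ≤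
      ENNReal.ofReal (2 + 2 * D) := by
    intro p
    refine (lintegral_mono fun z => ofReal_sq_sub_patchMean_le hx hv0 p z).trans ?_
    have hm : ∀ q : V, Measurable fun z : V → ℝ => ENNReal.ofReal (z q ^ 2) *
        selWeight (fun q z => patchEnergy O (x + z) p q) v q z := fun q =>
      Measurable.mul (by fun_prop) (measurable_selWeight (measurable_patchEnergy O x p) v q)
    rw [lintegral_add_left measurable_const,
      lintegral_const_mul _ (Finset.measurable_sum _ fun q _ => hm q),
      lintegral_finsetSum _ fun q _ => hm q, ENNReal.ofReal_add (by norm_num) (by positivity),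
      ENNReal.ofReal_mul (by norm_num)]
    simp only [lintegral_const, measure_univ, mul_one, ENNReal.ofReal_ofNat]
    gcongr
    exact hcore p
  have h1 := sum_flat_lintegral_sq_sub_patchMean_le (a := 1) (b := 0) hσ hO hx (by norm_num) hv0
    hv1 hv2 hτ0 hτ hK hE hB (by positivity) hbad hpt
  have h0 := sum_flat_lintegral_sq_sub_patchMean_le (a := 0) (b := 1) hσ hO hx (by norm_num) hv0
    hv1 hv2 hτ0 hτ hK (by rwa [Finset.union_comm]) hB (by positivity) hbad hpt
  have hE' : ∑ p ∈ (flatSet O x 1 ∪ flatSet O x 0)ᶜ,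
      ∫⁻ z, ENNReal.ofReal ((x p - patchMean O v (x + z) p) ^ 2) ∂gaussNoise V σ ≤
      ENNReal.ofReal (B * (2 + 2 * D)) := by
    refine (Finset.sum_le_sum fun p _ => hpt p).trans ?_
    rw [Finset.sum_const, nsmul_eq_mul, ← ENNReal.ofReal_natCast,
      ← ENNReal.ofReal_mul (by positivity)]
    exact ENNReal.ofReal_le_ofReal (by gcongr)
  -- Two flat classes with error constant (2 + 2D) + 20σ² + 5 each, and the remaining pixels with 2
  -- + 2D, add up to 6D + 40σ² + 16.
  rw [← Finset.sum_add_sum_compl (flatSet O x 1 ∪ flatSet O x 0)]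
  refine (add_le_add ((Finset.sum_union_inter.le.trans' le_self_add).trans (add_le_add h1 h0))
    hE').trans_eq ?_
  rw [← ENNReal.ofReal_add (by positivity) (by positivity),
    ← ENNReal.ofReal_add (by positivity) (by positivity)]
  congr 1; ring

end Flat

/-! ### Patch offsets on the periodic grid, and the estimator as a patch mean. -/

/-- The offsets of a patch of half-width `δ` without its centre. -/
noncomputable def boxOffsets (n δ : ℕ) : Finset (ZMod n × ZMod n) :=
  ((Finset.Icc (-(δ : ℤ)) δ ×ˢ Finset.Icc (-(δ : ℤ)) δ).erase 0).image
    fun l => ((l.1 : ZMod n), (l.2 : ZMod n))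

section Offsets

variable {n δ : ℕ}

lemma valMinAbs_intCast_of_abs_lt {a : ℤ} (h : 2 * |a| < n) : (a : ZMod n).valMinAbs = a := by
  have hn : NeZero n := ⟨by rintro rfl; have := abs_nonneg a; push_cast at h; omega⟩
  rw [ZMod.valMinAbs_spec]
  refine ⟨rfl, ?_, ?_⟩ <;> cases abs_cases a <;> omega

lemma injOn_boxCast (h : 2 * δ < n) : Set.InjOn
    (fun l : ℤ × ℤ => ((l.1 : ZMod n), (l.2 : ZMod n)))
    (Finset.Icc (-(δ : ℤ)) δ ×ˢ Finset.Icc (-(δ : ℤ)) δ : Finset (ℤ × ℤ)) := by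
  intro a ha b hb hab
  simp only [Finset.coe_product, Finset.coe_Icc, Set.mem_prod, Set.mem_Icc] at ha hb
  have key : ∀ c : ℤ, -(δ : ℤ) ≤ c → c ≤ δ → (c : ZMod n).valMinAbs = c := fun c h1 h2 =>
    valMinAbs_intCast_of_abs_lt (by cases abs_cases c <;> omega)
  simp only [Prod.mk.injEq] at hab
  ext
  · rw [← key a.1 ha.1.1 ha.1.2, hab.1, key b.1 hb.1.1 hb.1.2]
  · rw [← key a.2 ha.2.1 ha.2.2, hab.2, key b.2 hb.2.1 hb.2.2]

lemma zero_mem_box (δ : ℕ) :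
    (0 : ℤ × ℤ) ∈ Finset.Icc (-(δ : ℤ)) δ ×ˢ Finset.Icc (-(δ : ℤ)) δ := by simp

lemma injOn_boxCast_erase (h : 2 * δ < n) : Set.InjOn
    (fun l : ℤ × ℤ => ((l.1 : ZMod n), (l.2 : ZMod n)))
    ((Finset.Icc (-(δ : ℤ)) δ ×ˢ Finset.Icc (-(δ : ℤ)) δ).erase 0 : Finset (ℤ × ℤ)) :=
  (injOn_boxCast h).mono (by exact_mod_cast Finset.erase_subset _ _)

lemma card_boxOffsets (h : 2 * δ < n) : (boxOffsets n δ).card = (2 * δ + 1) ^ 2 - 1 := by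
  rw [boxOffsets, Finset.card_image_of_injOn (injOn_boxCast_erase h),
    Finset.card_erase_of_mem (zero_mem_box δ), Finset.card_product, Int.card_Icc, sq]
  have : ((δ : ℤ) + 1 - -(δ : ℤ)).toNat = 2 * δ + 1 := by omega
  rw [this]

lemma zero_notMem_boxOffsets (h : 2 * δ < n) : (0 : ZMod n × ZMod n) ∉ boxOffsets n δ := by
  intro h0
  obtain ⟨l, hl, hl0⟩ := Finset.mem_image.1 h0
  have hl' := Finset.mem_erase.1 hl
  refine hl'.1 (injOn_boxCast h hl'.2 (zero_mem_box δ) (hl0.trans ?_))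
  simp only [Prod.fst_zero, Prod.snd_zero, Int.cast_zero, Prod.mk_zero_zero]

lemma exists_int_of_mem_boxOffsets {l : ZMod n × ZMod n} (hl : l ∈ boxOffsets n δ) :
    ∃ a b : ℤ, |a| ≤ δ ∧ |b| ≤ δ ∧ l = ((a : ZMod n), (b : ZMod n)) := by
  obtain ⟨l', hl', rfl⟩ := Finset.mem_image.1 hl
  simp only [Finset.mem_erase, Finset.mem_product, Finset.mem_Icc] at hl'
  exact ⟨l'.1, l'.2, abs_le.2 hl'.2.1, abs_le.2 hl'.2.2, rfl⟩

/-- The colour of an offset is the parity of its quotient by the shift, and adding the shift raises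
the quotient by one. The bound 4δ < n makes the shift between two offsets an integer difference
without wrap-around. -/
lemma even_valMinAbs_ediv_ne (h : 4 * δ < n) {k : ZMod n} (hk : k ≠ 0) {a b : ℤ} (ha : |a| ≤ δ)
    (hb : |b| ≤ δ) (hab : (b : ZMod n) = a + k) :
    decide (Even ((b : ZMod n).valMinAbs / k.valMinAbs)) ≠
      decide (Even ((a : ZMod n).valMinAbs / k.valMinAbs)) := by
  have hba : |b - a| ≤ 2 * δ := (abs_sub b a).trans (by omega)
  have hk' : k = ((b - a : ℤ) : ZMod n) := by push_cast; rw [hab]; ring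
  have hkv : k.valMinAbs = b - a := by
    rw [hk']; exact valMinAbs_intCast_of_abs_lt (by omega)
  rw [hkv, valMinAbs_intCast_of_abs_lt (a := a) (by omega),
    valMinAbs_intCast_of_abs_lt (a := b) (by omega)]
  have hne : b - a ≠ 0 := by
    intro h0; rw [h0] at hk'; exact hk (by simpa using hk')
  have : b / (b - a) = a / (b - a) + 1 := by
    rw [← Int.add_mul_ediv_right _ _ hne]; congr 1; ring
  rw [this, ne_eq, decide_eq_decide, Int.even_add_one]
  tauto

lemma shiftBicolorable_boxOffsets (h : 4 * δ < n) : ShiftBicolorable (boxOffsets n δ) := by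
  intro k hk
  -- The colouring uses a coordinate in which the shift is nonzero.
  by_cases h1 : k.1 = 0
  · have h2 : k.2 ≠ 0 := fun h2 => hk (Prod.ext h1 h2)
    refine ⟨fun l => decide (Even (l.2.valMinAbs / k.2.valMinAbs)), fun l hl hlk => ?_⟩
    obtain ⟨a, b, ha, hb, rfl⟩ := exists_int_of_mem_boxOffsets hl
    obtain ⟨a', b', ha', hb', e⟩ := exists_int_of_mem_boxOffsets hlk
    rw [e]
    exact even_valMinAbs_ediv_ne h h2 hb hb' (by simpa using (congrArg Prod.snd e).symm)
  · refine ⟨fun l => decide (Even (l.1.valMinAbs / k.1.valMinAbs)), fun l hl hlk => ?_⟩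
    obtain ⟨a, b, ha, hb, rfl⟩ := exists_int_of_mem_boxOffsets hl
    obtain ⟨a', b', ha', hb', e⟩ := exists_int_of_mem_boxOffsets hlk
    rw [e]
    exact even_valMinAbs_ediv_ne h h1 ha ha' (by simpa using (congrArg Prod.fst e).symm)

lemma patchDistSq_eq (h : 2 * δ < n) (y : PixelArray n) (p q : ZMod n × ZMod n) :
    patchDistSq δ y p q =
      1 / ((2 * (δ : ℝ) + 1) ^ 2 - 1) * patchEnergy (boxOffsets n δ) y p q := by
  rw [patchDistSq, patchEnergy, boxOffsets, Finset.sum_image (injOn_boxCast_erase h),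
    Finset.sum_erase_eq_sub (zero_mem_box δ), Finset.sum_product_right]
  simp [sq_abs, Prod.add_def]

lemma nlm_eq_patchMean [NeZero n] (hδ : 0 < δ) (h : 2 * δ < n) (σ t : ℝ) (y : PixelArray n)
    (p : ZMod n × ZMod n) :
    nlm n σ δ t y p =
      patchMean (boxOffsets n δ) (((2 * (δ : ℝ) + 1) ^ 2 - 1) * (2 * σ ^ 2 + t)) y p := by
  have hρ : (0 : ℝ) < (2 * (δ : ℝ) + 1) ^ 2 - 1 := by
    have : (0 : ℝ) < δ := by exact_mod_cast hδ
    nlinarith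
  have : ∀ q, nlmWeight σ δ t y p q = if patchEnergy (boxOffsets n δ) y p q ≤
      ((2 * (δ : ℝ) + 1) ^ 2 - 1) * (2 * σ ^ 2 + t) then 1 else 0 := fun q => by
    simp only [nlmWeight, patchDistSq_eq h, one_div, inv_mul_le_iff₀ hρ]
  simp only [nlm, patchMean, this]

end Offsets

/-! ### Geometry of the horizon: counting the pixels that are not flat. -/

section Horizon

variable {n : ℕ} {h : ℝ → ℝ}

lemma IsHolder.abs_sub_le (hh : IsHolder 1 1 h) (s t : ℝ) : |h s - h t| ≤ |s - t| := by
  have := hh.2 s t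
  simpa using this

lemma IsHolder.continuous {a C : ℝ} (hh : IsHolder a C h) : Continuous h := hh.1.continuous

lemma volume_pixel (p : ZMod n × ZMod n) :
    volume (pixel n p) = ENNReal.ofReal (1 / n) * ENNReal.ofReal (1 / n) := by
  rw [pixel, Measure.volume_eq_prod, Measure.prod_prod, Real.volume_Ico, Real.volume_Ico]
  congr 2 <;> ring

lemma volume_pixel_ne_zero [NeZero n] (p : ZMod n × ZMod n) : volume (pixel n p) ≠ 0 := by
  rw [volume_pixel]
  simp [NeZero.ne n]

lemma volume_pixel_ne_top (p : ZMod n × ZMod n) : volume (pixel n p) ≠ ∞ := by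
  rw [volume_pixel]
  exact ENNReal.mul_ne_top ENNReal.ofReal_ne_top ENNReal.ofReal_ne_top

lemma measurableSet_pixel (p : ZMod n × ZMod n) : MeasurableSet (pixel n p) :=
  measurableSet_Ico.prod measurableSet_Ico

lemma measurable_horizonImage (hh : Continuous h) : Measurable (horizonImage h) :=
  measurable_const.indicator
    (isOpen_lt continuous_snd (hh.comp continuous_fst)).measurableSet

lemma horizonImage_mem_Icc (q : ℝ × ℝ) : horizonImage h q ∈ Set.Icc (0 : ℝ) 1 := by
  unfold horizonImage Set.indicator
  split_ifs <;> simp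

lemma pixelAverages_horizonImage_mem_Icc [NeZero n] (hh : Continuous h) (p : ZMod n × ZMod n) :
    pixelAverages n (horizonImage h) p ∈ Set.Icc (0 : ℝ) 1 := by
  refine (convex_Icc 0 1).set_average_mem isClosed_Icc (volume_pixel_ne_zero p)
    (volume_pixel_ne_top p) (Filter.Eventually.of_forall fun q => horizonImage_mem_Icc q) ?_
  refine Measure.integrableOn_of_bounded (M := 1) (volume_pixel_ne_top p)
    (measurable_horizonImage hh).aestronglyMeasurable
    (Filter.Eventually.of_forall fun q => ?_)
  have := horizonImage_mem_Icc (h := h) q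
  rw [Real.norm_eq_abs, abs_le]
  constructor <;> linarith [this.1, this.2]

lemma pixelAverages_eq_of_forall [NeZero n] {f : ℝ × ℝ → ℝ} {p : ZMod n × ZMod n} {a : ℝ}
    (hf : ∀ q ∈ pixel n p, f q = a) : pixelAverages n f p = a := by
  rw [pixelAverages, setAverage_eq, setIntegral_congr_fun (measurableSet_pixel p) hf,
    ← setAverage_eq, setAverage_const (volume_pixel_ne_zero p) (volume_pixel_ne_top p)]

lemma intCast_val_add_intCast [NeZero n] {i : ZMod n} {a : ℤ} (h0 : 0 ≤ (i.val : ℤ) + a)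
    (h1 : (i.val : ℤ) + a < n) : (((i + (a : ZMod n)).val : ℕ) : ℤ) = i.val + a := by
  have e : i + (a : ZMod n) = (((i.val : ℤ) + a : ℤ) : ZMod n) := by simp
  rw [e, ZMod.val_intCast, Int.emod_eq_of_lt h0 h1]

/-- At distance δ from the image boundary the patch does not wrap around, so its pixels fill a
genuine rectangle. -/
lemma mem_flatSet_of_forall_pixel [NeZero n] {δ : ℕ} {p : ZMod n × ZMod n} {f : ℝ × ℝ → ℝ} {c : ℝ}
    (h1 : δ ≤ p.1.val) (h1' : p.1.val + δ < n) (h2 : δ ≤ p.2.val) (h2' : p.2.val + δ < n)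
    (hp : ∀ q : ℝ × ℝ, |q.1 - p.1.val / n| ≤ (δ + 1) / n → ((p.2.val : ℝ) - δ) / n ≤ q.2 →
      q.2 < (p.2.val + δ + 1) / n → f q = c) :
    p ∈ flatSet (boxOffsets n δ) (pixelAverages n f) c := by
  have hn : (0 : ℝ) < n := by exact_mod_cast NeZero.pos n
  have key : ∀ a b : ℤ, |a| ≤ δ → |b| ≤ δ →
      pixelAverages n f (p + ((a : ZMod n), (b : ZMod n))) = c := by
    intro a b ha hb
    have ha' := abs_le.1 ha
    have hb' := abs_le.1 hb
    refine pixelAverages_eq_of_forall fun q hq => ?_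
    have e1 := intCast_val_add_intCast (i := p.1) (a := a) (by omega) (by omega)
    have e2 := intCast_val_add_intCast (i := p.2) (a := b) (by omega) (by omega)
    have e1' : ((p + ((a : ZMod n), (b : ZMod n))).1.val : ℝ) = p.1.val + a := by
      exact_mod_cast e1
    have e2' : ((p + ((a : ZMod n), (b : ZMod n))).2.val : ℝ) = p.2.val + b := by
      exact_mod_cast e2
    simp only [pixel, Set.mem_prod, Set.mem_Ico, e1', e2', div_le_iff₀ hn, lt_div_iff₀ hn] at hq
    have a1 : -(δ : ℝ) ≤ a := by exact_mod_cast ha'.1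
    have a2 : (a : ℝ) ≤ δ := by exact_mod_cast ha'.2
    have b1 : -(δ : ℝ) ≤ b := by exact_mod_cast hb'.1
    have b2 : (b : ℝ) ≤ δ := by exact_mod_cast hb'.2
    refine hp q ?_ ?_ ?_
    · rw [le_div_iff₀ hn, ← abs_of_pos hn, ← abs_mul, sub_mul, abs_of_pos hn,
        div_mul_cancel₀ _ hn.ne', abs_le]
      constructor <;> linarith [hq.1.1, hq.1.2]
    · rw [div_le_iff₀ hn]; linarith [hq.2.1]
    · rw [lt_div_iff₀ hn]; linarith [hq.2.2]
  refine mem_flatSet.2 ⟨?_, fun l hl => ?_⟩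
  · simpa only [Int.cast_zero, Prod.mk_zero_zero, add_zero] using key 0 0 (by simp) (by simp)
  obtain ⟨a, b, ha, hb, rfl⟩ := exists_int_of_mem_boxOffsets hl
  exact key a b ha hb

lemma mem_flatSet_zero_of_le [NeZero n] (hh : IsHolder 1 1 h) {δ : ℕ} {p : ZMod n × ZMod n}
    (h1 : δ ≤ p.1.val) (h1' : p.1.val + δ < n) (h2 : δ ≤ p.2.val) (h2' : p.2.val + δ < n)
    (hp : n * h (p.1.val / n) + (2 * δ + 2) ≤ p.2.val) :
    p ∈ flatSet (boxOffsets n δ) (pixelAverages n (horizonImage h)) 0 := by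
  have hn : (0 : ℝ) < n := by exact_mod_cast NeZero.pos n
  refine mem_flatSet_of_forall_pixel h1 h1' h2 h2' fun q hq1 hq2 hq3 => ?_
  refine Set.indicator_of_notMem ?_ _
  rw [Set.mem_ofPred_eq, not_lt]
  have := (abs_le.1 ((hh.abs_sub_le _ _).trans hq1)).2
  refine le_trans ?_ hq2
  rw [le_div_iff₀ hn]
  have h4 := mul_le_mul_of_nonneg_right this hn.le
  rw [div_mul_cancel₀ _ hn.ne'] at h4
  linarith

/-- Of the margin 2δ + 2, one half is the vertical extent δ + 1 of the patch above its base point;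
the other half bounds the variation of the 1-Lipschitz h over the patch, in units of a pixel. -/
lemma mem_flatSet_one_of_le [NeZero n] (hh : IsHolder 1 1 h) {δ : ℕ} {p : ZMod n × ZMod n}
    (h1 : δ ≤ p.1.val) (h1' : p.1.val + δ < n) (h2 : δ ≤ p.2.val) (h2' : p.2.val + δ < n)
    (hp : (p.2.val : ℝ) + (2 * δ + 2) ≤ n * h (p.1.val / n)) :
    p ∈ flatSet (boxOffsets n δ) (pixelAverages n (horizonImage h)) 1 := by
  have hn : (0 : ℝ) < n := by exact_mod_cast NeZero.pos n
  refine mem_flatSet_of_forall_pixel h1 h1' h2 h2' fun q hq1 hq2 hq3 => ?_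
  refine Set.indicator_of_mem ?_ _
  rw [Set.mem_ofPred_eq]
  have := (abs_le.1 ((hh.abs_sub_le _ _).trans hq1)).1
  refine hq3.trans_le ?_
  rw [div_le_iff₀ hn]
  have h4 := mul_le_mul_of_nonneg_right this hn.le
  rw [neg_mul, div_mul_cancel₀ _ hn.ne'] at h4
  linarith

lemma card_boundary_le [NeZero n] (δ : ℕ) :
    (Finset.univ.filter fun i : ZMod n => i.val < δ ∨ n ≤ i.val + δ).card ≤ 2 * δ := by
  have hsub : (Finset.univ.filter fun i : ZMod n => i.val < δ ∨ n ≤ i.val + δ).image ZMod.val ⊆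
      Finset.range δ ∪ Finset.Ico (n - δ) n := by
    intro k hk
    obtain ⟨i, hi, rfl⟩ := Finset.mem_image.1 hk
    have hi' := (Finset.mem_filter.1 hi).2
    have := ZMod.val_lt i
    simp only [Finset.mem_union, Finset.mem_range, Finset.mem_Ico]
    omega
  rw [← Finset.card_image_of_injective _ (ZMod.val_injective n)]
  refine (Finset.card_le_card hsub).trans ((Finset.card_union_le _ _).trans ?_)
  rw [Finset.card_range, Nat.card_Ico]
  omega

lemma card_abs_val_sub_lt_le [NeZero n] (c : ℝ) (m : ℕ) :
    (Finset.univ.filter fun j : ZMod n => |(j.val : ℝ) - c| < m).card ≤ 2 * m + 1 := by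
  have hinj : Function.Injective fun j : ZMod n => (j.val : ℤ) :=
    Nat.cast_injective.comp (ZMod.val_injective n)
  rw [← Finset.card_image_of_injective _ hinj]
  refine (Finset.card_le_card (t := Finset.Icc (⌊c⌋ - m) (⌊c⌋ + m)) fun k hk => ?_).trans ?_
  · obtain ⟨j, hj, rfl⟩ := Finset.mem_image.1 hk
    have hj' := abs_lt.1 (Finset.mem_filter.1 hj).2
    have h1 := Int.floor_le c
    have h2 := Int.lt_floor_add_one c
    rw [Finset.mem_Icc]
    constructor
    · have : ((⌊c⌋ - m : ℤ) : ℝ) ≤ ((j.val : ℤ) : ℝ) := by push_cast; linarith [hj'.1]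
      exact_mod_cast this
    · have : ((j.val : ℤ) : ℝ) < ((⌊c⌋ + m + 1 : ℤ) : ℝ) := by push_cast; linarith [hj'.2]
      have : (j.val : ℤ) < ⌊c⌋ + m + 1 := by exact_mod_cast this
      omega
  · rw [Int.card_Icc]
    omega

/-- All but `O(n δ)` pixels have a patch on one side of the edge. -/
lemma card_compl_flatSet_le [NeZero n] (hh : IsHolder 1 1 h) (δ : ℕ) :
    (flatSet (boxOffsets n δ) (pixelAverages n (horizonImage h)) 1 ∪
      flatSet (boxOffsets n δ) (pixelAverages n (horizonImage h)) 0)ᶜ.card ≤ n * (8 * δ + 5) := by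
  set B := Finset.univ.filter fun i : ZMod n => i.val < δ ∨ n ≤ i.val + δ with hB
  set S : ZMod n → Finset (ZMod n) := fun i => Finset.univ.filter fun j : ZMod n =>
    |(j.val : ℝ) - n * h (i.val / n)| < (2 * δ + 2 : ℕ) with hS
  have hsub : (flatSet (boxOffsets n δ) (pixelAverages n (horizonImage h)) 1 ∪
      flatSet (boxOffsets n δ) (pixelAverages n (horizonImage h)) 0)ᶜ ⊆
      (B ×ˢ Finset.univ ∪ Finset.univ ×ˢ B) ∪
        Finset.univ.biUnion fun i : ZMod n => ({i} : Finset (ZMod n)) ×ˢ S i := by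
    intro p hp
    by_contra hcon
    simp only [Finset.mem_union, Finset.mem_product, Finset.mem_univ, and_true, true_and,
      Finset.mem_biUnion, Finset.mem_singleton, not_or, hB, Finset.mem_filter, not_exists,
      not_and, not_lt, not_le, hS] at hcon
    obtain ⟨⟨⟨h1, h1'⟩, h2, h2'⟩, h3⟩ := hcon
    have h3' := h3 p.1 rfl
    push_cast at h3'
    rw [Finset.mem_compl, Finset.mem_union, not_or] at hp
    rcases le_abs.1 h3' with h4 | h4
    · exact hp.2 (mem_flatSet_zero_of_le hh h1 h1' h2 h2' (by linarith))
    · exact hp.1 (mem_flatSet_one_of_le hh h1 h1' h2 h2' (by linarith))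
  have c1 : (B ×ˢ (Finset.univ : Finset (ZMod n))).card ≤ 2 * δ * n := by
    rw [Finset.card_product, Finset.card_univ, ZMod.card]
    exact Nat.mul_le_mul_right _ (card_boundary_le δ)
  have c2 : ((Finset.univ : Finset (ZMod n)) ×ˢ B).card ≤ n * (2 * δ) := by
    rw [Finset.card_product, Finset.card_univ, ZMod.card]
    exact Nat.mul_le_mul_left _ (card_boundary_le δ)
  have c3 : (Finset.univ.biUnion fun i : ZMod n => ({i} : Finset (ZMod n)) ×ˢ S i).card ≤
      n * (2 * (2 * δ + 2) + 1) := by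
    refine Finset.card_biUnion_le.trans ((Finset.sum_le_sum fun i _ =>
      (?_ : _ ≤ 2 * (2 * δ + 2) + 1)).trans_eq ?_)
    · rw [Finset.card_product, Finset.card_singleton, one_mul]
      exact card_abs_val_sub_lt_le _ _
    · rw [Finset.sum_const, Finset.card_univ, ZMod.card, smul_eq_mul]
  refine (Finset.card_le_card hsub).trans ((Finset.card_union_le _ _).trans
    ((Nat.add_le_add (Finset.card_union_le _ _) c3).trans ?_))
  -- Boundary strips in the two directions, and in each column at most 2(2δ + 2) + 1 pixels near the
  -- edge.
  calc _ ≤ (2 * δ * n + n * (2 * δ)) + n * (2 * (2 * δ + 2) + 1) := by omega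
    _ = _ := by ring

end Horizon

/-! ### Growth estimates and choice of the parameters, with L = log n. -/

section Growth

open Filter Real

lemma eventually_mul_rpow_le_mul_rpow {r s c : ℝ} (A : ℝ) (hrs : r < s) (hc : 0 < c) :
    ∀ᶠ L : ℝ in atTop, A * L ^ r ≤ c * L ^ s := by
  filter_upwards [(tendsto_rpow_atTop (sub_pos.2 hrs)).eventually_ge_atTop (A / c),
    eventually_gt_atTop 0] with L h1 h2
  have h3 : A ≤ c * L ^ (s - r) := by rwa [div_le_iff₀' hc] at h1
  calc A * L ^ r ≤ c * L ^ (s - r) * L ^ r := by gcongr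
    _ = c * L ^ s := by rw [mul_assoc, ← rpow_add h2, sub_add_cancel]

lemma eventually_mul_rpow_mul_exp_neg_le {κ c : ℝ} (A s : ℝ) (hκ : 0 < κ) (hc : 0 < c) :
    ∀ᶠ L : ℝ in atTop, A * L ^ s * exp (-(c * L ^ κ)) ≤ 1 := by
  have h := ((tendsto_rpow_mul_exp_neg_mul_atTop_nhds_zero (s / κ) c hc).comp
    (tendsto_rpow_atTop hκ)).const_mul A
  rw [mul_zero] at h
  filter_upwards [h.eventually_le_const one_pos, eventually_gt_atTop 0] with L h1 h2
  simp only [Function.comp_apply] at h1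
  rwa [← rpow_mul h2.le, mul_div_cancel₀ _ hκ.ne', ← mul_assoc, neg_mul] at h1

lemma eventually_mul_rpow_mul_exp_sub_le {s c : ℝ} (A a r : ℝ) (hA : 0 ≤ A) (hs : 1 < s)
    (hc : 0 < c) :
    ∀ᶠ L : ℝ in atTop, A * L ^ r * exp (a * L - c * L ^ s) ≤ 1 := by
  filter_upwards [eventually_mul_rpow_le_mul_rpow (a + 1) hs hc,
    eventually_mul_rpow_mul_exp_neg_le A r one_pos one_pos, eventually_gt_atTop 0] with L h1 h2 h3
  rw [rpow_one] at h1 h2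
  refine le_trans ?_ h2
  gcongr
  linarith

lemma eventually_mul_log_add_one_le {κ s η c : ℝ} (A B : ℝ) (hA : 0 ≤ A) (hB : 1 ≤ B)
    (hs : 0 ≤ s) (hκ : 0 ≤ κ) (hη : κ < η) (hc : 0 < c) :
    ∀ᶠ L : ℝ in atTop, L ^ κ * A * log (B * L ^ s) + 1 ≤ c * L ^ η := by
  -- Half of the gap between the exponents absorbs the logarithm, the other half the constants.
  set θ := (η - κ) / 2 with hθ
  have hθ0 : 0 < θ := by rw [hθ]; linarith
  filter_upwards [eventually_mul_rpow_le_mul_rpow (A * (log B + s / θ) + 1)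
    (show κ + θ < η by rw [hθ]; linarith) hc, eventually_ge_atTop 1] with L h1 h2
  have h0 : 0 < L := by linarith
  refine le_trans ?_ h1
  have hθ1 : 1 ≤ L ^ θ := one_le_rpow h2 hθ0.le
  have hκ1 : 1 ≤ L ^ κ := one_le_rpow h2 hκ
  have hB0 : 0 ≤ log B := log_nonneg hB
  have h3 : log (B * L ^ s) ≤ (log B + s / θ) * L ^ θ := by
    rw [log_mul (by positivity) (by positivity), log_rpow h0, add_mul]
    refine add_le_add (le_mul_of_one_le_right hB0 hθ1) ?_
    refine (mul_le_mul_of_nonneg_left (log_le_rpow_div h0.le hθ0) hs).trans_eq ?_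
    ring
  rw [rpow_add h0]
  have h4 : L ^ κ * A * log (B * L ^ s) ≤ L ^ κ * A * ((log B + s / θ) * L ^ θ) := by gcongr
  nlinarith [one_le_mul_of_one_le_of_one_le hκ1 hθ1]

end Growth

section Parameters

open Filter Real

/-- The number of pixels is n² = exp(2L). K is a small power of L, but large enough for exp(-cK) to
beat powers of L. The slope estimate holds for all pixels at once because N is at least L to a power
above 1. -/
lemma eventually_exists_core_parameters {ε σ : ℝ} (hε : 0 < ε) (hσ : 0 < σ) :
    ∀ᶠ L : ℝ in atTop, ∀ N : ℝ, L ^ (1 + 2 * ε) ≤ N → N ≤ 25 * L ^ (1 + 2 * ε) →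
      ∃ (K M : ℝ) (J : ℕ), 1 ≤ K ∧ 0 ≤ M ∧ 0 < J ∧ K ≤ √N ∧
        J * (2 * (4 * (8 * √K * (M + 1))) / (σ ^ 2 * N)) * K * √N ≤ 1 ∧
        2 * exp (-K / (4 * σ ^ 2)) ≤ 1 / 2 ∧
        64 * σ ^ 2 * N * exp (-K / (8 * σ ^ 2)) ≤ 1 ∧
        exp (2 * L) * (exp (2 * L) * (2 * exp (-M ^ 2 / (4 * σ ^ 2)))) ≤ 1 ∧
        K * (exp (2 * L) * (2 * exp (-M ^ 2 / (4 * σ ^ 2)))) ≤ 1 ∧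
        K * (4 * exp (-(K ^ 2 / 16))) ≤ 1 ∧
        K * exp 3 * log (8 * N) ≤ J ∧
        K * exp 3 * (exp (2 * L) * (20 * exp (-(min 1 (σ ^ 2) * N / 1024)))) ≤ 1 := by
  have hκ : 0 < ε / 8 := by linarith
  have hm : 0 < min 1 (σ ^ 2) := by positivity
  filter_upwards [eventually_ge_atTop 1,
    eventually_mul_rpow_mul_exp_neg_le 4 0 hκ (show 0 < 1 / (4 * σ ^ 2) by positivity),
    eventually_mul_rpow_mul_exp_neg_le (64 * σ ^ 2 * 25) (1 + 2 * ε) hκ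
      (show 0 < 1 / (8 * σ ^ 2) by positivity),
    eventually_mul_rpow_mul_exp_neg_le 2 (ε / 8) one_pos (show (0 : ℝ) < 4 by norm_num),
    eventually_mul_rpow_mul_exp_neg_le 4 (ε / 8) (show 0 < ε / 8 * 2 by linarith)
      (show (0 : ℝ) < 1 / 16 by norm_num),
    eventually_mul_log_add_one_le (κ := ε / 8) (s := 1 + 2 * ε) (η := 13 / 16 * ε)
      (c := σ ^ 2 / (64 * (5 * σ + 1))) (exp 3) 200 (exp_pos 3).le (by norm_num) (by linarith)
      hκ.le (by linarith) (by positivity),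
    eventually_mul_rpow_mul_exp_sub_le (20 * exp 3) 2 (ε / 8) (by positivity)
      (show 1 < 1 + 2 * ε by linarith) (show 0 < min 1 (σ ^ 2) / 1024 by positivity)]
    with L hL e1 e2 e3 e4 e5 e6 N hN1 hN2
  have hL0 : 0 < L := by linarith
  set K := L ^ (ε / 8) with hK
  have hK1 : 1 ≤ K := one_le_rpow hL hκ.le
  have hK0 : 0 < K := by linarith
  -- The tail at M is exp(-6L), which beats the factor exp(4L) from the squared number of pixels.
  set M := √(24 * σ ^ 2 * L) with hM
  have hM0 : 0 ≤ M := sqrt_nonneg _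
  have hM2 : M ^ 2 = 24 * σ ^ 2 * L := sq_sqrt (by positivity)
  have hML : -M ^ 2 / (4 * σ ^ 2) = -(6 * L) := by rw [hM2]; field_simp; ring
  have hNpow1 : 1 ≤ L ^ (1 + 2 * ε) := one_le_rpow hL (by linarith)
  have hN0 : 0 < N := by linarith
  have hsqrtN : L ^ (1 / 2 + ε) ≤ √N := by
    refine le_sqrt_of_sq_le ?_
    rw [← rpow_natCast, ← rpow_mul hL0.le]
    refine le_trans (le_of_eq ?_) hN1
    congr 1; push_cast; ring
  have hKN : K ≤ √N := (rpow_le_rpow_of_exponent_le hL (by linarith)).trans hsqrtN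
  have hMle : M + 1 ≤ (5 * σ + 1) * L ^ (1 / 2 : ℝ) := by
    have h1 : 1 ≤ L ^ (1 / 2 : ℝ) := one_le_rpow hL (by norm_num)
    have h2 : M ≤ 5 * σ * L ^ (1 / 2 : ℝ) := by
      refine sqrt_le_iff.2 ⟨by positivity, ?_⟩
      have h3 : (L ^ (1 / 2 : ℝ)) ^ 2 = L := by
        rw [← rpow_natCast, ← rpow_mul hL0.le]; norm_num
      rw [mul_pow, h3]
      nlinarith [mul_pos (sq_pos_of_pos hσ) hL0]
    linarith
  -- The largest J allowed by the bound on the total scaling. Its order is L^(13ε/16), since 13/16 =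
  -- 1 - 1/16 - 1/8 once √K, K and the size L^(1/2) of M are divided out; K·log(8N) is only of order
  -- L^(ε/8)·log L.
  set X := σ ^ 2 * √N / (64 * √K * (M + 1) * K) with hX
  have hX0 : 0 ≤ X := by positivity
  have hXge : σ ^ 2 / (64 * (5 * σ + 1)) * L ^ (13 / 16 * ε) ≤ X := by
    have hsK : √K = L ^ (ε / 16) := by
      rw [sqrt_eq_rpow, hK, ← rpow_mul hL0.le]; congr 1; ring
    rw [hX, le_div_iff₀ (by positivity)]
    calc _ ≤ σ ^ 2 / (64 * (5 * σ + 1)) * L ^ (13 / 16 * ε) *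
          (64 * √K * ((5 * σ + 1) * L ^ (1 / 2 : ℝ)) * K) := by gcongr
      _ = σ ^ 2 * (L ^ (13 / 16 * ε) * (L ^ (ε / 16) * L ^ (1 / 2 : ℝ) * L ^ (ε / 8))) := by
          rw [hsK, hK]; field_simp
      _ = σ ^ 2 * L ^ (1 / 2 + ε) := by
          rw [← rpow_add hL0, ← rpow_add hL0, ← rpow_add hL0]; congr 2; ring
      _ ≤ _ := by gcongr
  have hJlog : K * exp 3 * log (8 * N) ≤ (⌊X⌋₊ : ℝ) := by
    have h1 : log (8 * N) ≤ log (200 * L ^ (1 + 2 * ε)) :=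
      log_le_log (by positivity) (by linarith)
    have h2 : K * exp 3 * log (8 * N) ≤ K * exp 3 * log (200 * L ^ (1 + 2 * ε)) := by gcongr
    have h3 := Nat.lt_floor_add_one X
    linarith
  refine ⟨K, M, ⌊X⌋₊, hK1, hM0, ?_, hKN, ?_, ?_, ?_, ?_, ?_, ?_, hJlog, ?_⟩
  · have : 0 < K * exp 3 * log (8 * N) := by
      have := log_pos (show 1 < 8 * N by linarith)
      positivity
    exact_mod_cast this.trans_le hJlog
  · calc _ ≤ X * (2 * (4 * (8 * √K * (M + 1))) / (σ ^ 2 * N)) * K * √N := by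
          gcongr; exact Nat.floor_le hX0
      _ = √N * √N / N := by rw [hX]; field_simp; ring
      _ = 1 := by rw [mul_self_sqrt hN0.le, div_self hN0.ne']
      _ ≤ 1 := le_rfl
  · rw [rpow_zero, mul_one, ← neg_mul] at e1
    rw [show -K / (4 * σ ^ 2) = -(1 / (4 * σ ^ 2)) * K by ring]
    linarith
  · refine le_trans ?_ e2
    rw [show -K / (8 * σ ^ 2) = -(1 / (8 * σ ^ 2) * K) by ring, mul_assoc (64 * σ ^ 2) 25]
    gcongr
  · rw [hML, show exp (2 * L) * (exp (2 * L) * (2 * exp (-(6 * L)))) =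
      2 * (exp (2 * L) * exp (2 * L) * exp (-(6 * L))) by ring, ← exp_add, ← exp_add]
    have : exp (2 * L + 2 * L + -(6 * L)) ≤ exp (-1) := exp_le_exp.2 (by linarith)
    linarith [exp_neg_one_lt_half]
  · rw [rpow_one] at e3
    rw [hML, show K * (exp (2 * L) * (2 * exp (-(6 * L)))) =
      2 * K * (exp (2 * L) * exp (-(6 * L))) by ring, ← exp_add]
    convert e3 using 3
    ring
  · have hKsq : L ^ (ε / 8 * 2) = K ^ 2 := by rw [rpow_mul hL0.le, rpow_two]
    rw [hKsq] at e4
    calc _ = 4 * K * exp (-(1 / 16 * K ^ 2)) := by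
          rw [show K ^ 2 / 16 = 1 / 16 * K ^ 2 by ring]; ring
      _ ≤ 1 := e4
  · refine le_trans ?_ e6
    rw [show K * exp 3 * (exp (2 * L) * (20 * exp (-(min 1 (σ ^ 2) * N / 1024)))) =
      20 * exp 3 * K * (exp (2 * L) * exp (-(min 1 (σ ^ 2) * N / 1024))) by ring, ← exp_add]
    gcongr
    have : min 1 (σ ^ 2) / 1024 * L ^ (1 + 2 * ε) ≤ min 1 (σ ^ 2) / 1024 * N := by gcongr
    linarith

lemma eventually_exists_flat_parameters {ε σ : ℝ} (hε : 0 < ε) (hσ : 0 < σ) :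
    ∀ᶠ L : ℝ in atTop, ∀ N : ℝ, L ^ (1 + 2 * ε) ≤ N →
      ∃ (τ K : ℝ), 0 ≤ τ ∧ τ ≤ 1 ∧ 0 ≤ K ∧ 4 * τ * σ ^ 2 = 2 * σ ^ 2 / L ^ (ε / 2) ∧
        8 * τ * σ ^ 2 + 4 * τ * σ ≤ 1 ∧
        exp (2 * L) * ((2 + 2 * K) * (12 * exp (2 * L) ^ 2 * exp (-(τ ^ 2 * N / 16))) +
          exp (2 * L) * (32 * σ ^ 2 * exp (-K / (8 * σ ^ 2)))) ≤ 1 := by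
  have hε2 : 0 < ε / 2 := by linarith
  filter_upwards [eventually_ge_atTop 1,
    eventually_mul_rpow_le_mul_rpow (4 * σ ^ 2 + 2 * σ) hε2 one_pos,
    eventually_mul_rpow_mul_exp_neg_le (64 * σ ^ 2) 0 one_pos one_pos,
    eventually_mul_rpow_mul_exp_sub_le (24 * (2 + 80 * σ ^ 2)) 6 1 (by positivity)
      (show 1 < 1 + ε by linarith) (show (0 : ℝ) < 1 / 64 by norm_num)]
    with L hL e1 e2 e3 N hN
  have hL0 : 0 < L := by linarith
  have hp : 0 < L ^ (ε / 2) := by positivity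
  have hp1 : 1 ≤ L ^ (ε / 2) := one_le_rpow hL hε2.le
  rw [rpow_zero, mul_one, one_mul] at e1
  rw [rpow_zero, mul_one, one_mul, rpow_one] at e2
  rw [rpow_one] at e3
  -- This τ makes 4τσ² equal to the threshold parameter. It leaves τ²N of order at least L^(1+ε), so
  -- that failure of concentration beats every power of n. With K = 40σ²L the tail is exp(-5L),
  -- against the factor exp(4L).
  refine ⟨1 / (2 * L ^ (ε / 2)), 40 * σ ^ 2 * L, by positivity, ?_, by positivity, ?_, ?_, ?_⟩
  · rw [div_le_one (by positivity)]; linarith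
  · field_simp; ring
  · rw [show 8 * (1 / (2 * L ^ (ε / 2))) * σ ^ 2 + 4 * (1 / (2 * L ^ (ε / 2))) * σ =
      (4 * σ ^ 2 + 2 * σ) / L ^ (ε / 2) by field_simp; ring, div_le_one hp]
    exact e1
  · have hexp : (1 / (2 * L ^ (ε / 2))) ^ 2 * N / 16 ≥ 1 / 64 * L ^ (1 + ε) := by
      have h1 : L ^ (1 + 2 * ε) = L ^ (1 + ε) * (L ^ (ε / 2)) ^ 2 := by
        rw [← rpow_natCast, ← rpow_mul hL0.le, ← rpow_add hL0]; congr 1; push_cast; ring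
      rw [h1] at hN
      rw [ge_iff_le, div_pow, one_pow, mul_pow]
      calc 1 / 64 * L ^ (1 + ε) =
            1 / (2 ^ 2 * (L ^ (ε / 2)) ^ 2) * (L ^ (1 + ε) * (L ^ (ε / 2)) ^ 2) / 16 := by
            field_simp; ring
        _ ≤ _ := by gcongr
    have hq : -(40 * σ ^ 2 * L) / (8 * σ ^ 2) = -(5 * L) := by field_simp; ring
    have hE2 : exp (2 * L) ^ 2 = exp (4 * L) := by rw [← exp_nat_mul]; congr 1; push_cast; ring
    rw [hq, hE2, mul_add]
    have t1 : exp (2 * L) * ((2 + 2 * (40 * σ ^ 2 * L)) * (12 * exp (4 * L) *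
        exp (-((1 / (2 * L ^ (ε / 2))) ^ 2 * N / 16)))) ≤ 1 / 2 := by
      calc _ = 12 * (2 + 80 * σ ^ 2 * L) * (exp (2 * L) * exp (4 * L) *
            exp (-((1 / (2 * L ^ (ε / 2))) ^ 2 * N / 16))) := by ring
        _ ≤ 12 * ((2 + 80 * σ ^ 2) * L) * exp (6 * L - 1 / 64 * L ^ (1 + ε)) := by
            rw [← exp_add, ← exp_add]
            gcongr
            · nlinarith
            · linarith
        _ ≤ 1 / 2 := by linarith
    have t2 : exp (2 * L) * (exp (2 * L) * (32 * σ ^ 2 * exp (-(5 * L)))) ≤ 1 / 2 := by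
      calc _ = 32 * σ ^ 2 * (exp (2 * L) * exp (2 * L) * exp (-(5 * L))) := by ring
        _ = 32 * σ ^ 2 * exp (-L) := by rw [← exp_add, ← exp_add]; congr 2; ring
        _ ≤ 1 / 2 := by linarith
    linarith

end Parameters

/-! ### Assembly of the risk bound. -/

lemma risk_eq (n : ℕ) [NeZero n] (σ : ℝ) (est : PixelArray n → PixelArray n) (f : ℝ × ℝ → ℝ)
    (hm : ∀ p, Measurable fun z => est (pixelAverages n f + z) p) :
    risk n σ est f = ENNReal.ofReal (1 / (n : ℝ) ^ 2) *
      ∑ p, ∫⁻ z, ENNReal.ofReal ((pixelAverages n f p - est (pixelAverages n f + z) p) ^ 2)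
        ∂gaussNoise (ZMod n × ZMod n) σ := by
  have hm' : ∀ p, Measurable fun z =>
      ENNReal.ofReal ((pixelAverages n f p - est (pixelAverages n f + z) p) ^ 2) := fun p =>
    ((measurable_const.sub (hm p)).pow_const 2).ennreal_ofReal
  rw [← lintegral_finsetSum _ fun p _ => hm' p,
    ← lintegral_const_mul _ (Finset.measurable_sum _ fun p _ => hm' p)]
  refine lintegral_congr fun z => ?_
  rw [ENNReal.ofReal_mul (by positivity), ENNReal.ofReal_sum_of_nonneg fun _ _ => sq_nonneg _]

lemma exists_patchHalfWidth_bounds {ε : ℝ} (hε : 0 < ε) {n : ℕ} (hL : 1 ≤ Real.log n) :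
    0 < patchHalfWidth ε n ∧ (patchHalfWidth ε n : ℝ) ≤ 2 * Real.log n ^ (1 / 2 + ε) ∧
      Real.log n ^ (1 + 2 * ε) ≤ (2 * (patchHalfWidth ε n : ℝ) + 1) ^ 2 - 1 ∧
      (2 * (patchHalfWidth ε n : ℝ) + 1) ^ 2 - 1 ≤ 25 * Real.log n ^ (1 + 2 * ε) := by
  have hL0 : 0 < Real.log n := by linarith
  set a := Real.log n ^ (1 / 2 + ε) with ha
  have ha1 : 1 ≤ a := Real.one_le_rpow hL (by linarith)
  have hsq : Real.log n ^ (1 + 2 * ε) = a ^ 2 := by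
    rw [ha, ← Real.rpow_natCast, ← Real.rpow_mul hL0.le]; congr 1; push_cast; ring
  have h1 : (patchHalfWidth ε n : ℝ) ≤ 2 * a := Nat.floor_le (by positivity)
  have h2 : 2 * a < patchHalfWidth ε n + 1 := Nat.lt_floor_add_one (2 * a)
  have h3 : (0 : ℝ) < patchHalfWidth ε n := by linarith
  refine ⟨by exact_mod_cast h3, h1, ?_, ?_⟩ <;> rw [hsq] <;> nlinarith

theorem theorem4 (ε σ α C : ℝ) (hε : 0 < ε) (hσ : 0 < σ) (hα : 0 < α) (hC : 0 < C) :
    ∃ (c : ℝ) (n₀ : ℕ), ∀ (n : ℕ) [NeZero n], n₀ < n →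
      worstCaseRisk n σ (nlm n σ (patchHalfWidth ε n) (thresholdParam ε σ n)) (horizonClass α C)
        ≤ ENNReal.ofReal (c * (Real.log n ^ (1 / 2 + ε) / n)) := by
  set D := 43 * σ ^ 2 + 5 with hD
  obtain ⟨n₀, hn₀⟩ := Filter.eventually_atTop.1
    ((Real.tendsto_log_atTop.comp tendsto_natCast_atTop_atTop).eventually
      ((Filter.eventually_ge_atTop (1 : ℝ)).and
        ((eventually_mul_rpow_mul_exp_neg_le 9 (1 / 2 + ε) one_pos one_pos).and
          ((eventually_exists_core_parameters hε hσ).and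
            (eventually_exists_flat_parameters hε hσ)))))
  -- The factor 21 comes from 8δ + 5 ≤ 16a + 5 ≤ 21a with a = (log n)^(1/2+ε) ≥ 1.
  refine ⟨21 * (6 * D + 40 * σ ^ 2 + 16), n₀, fun n _ hn => ?_⟩
  obtain ⟨hL, hbox, hcore, hflat⟩ := hn₀ n hn.le
  simp only [Function.comp_apply] at hL hbox hcore hflat
  obtain ⟨hδ, hδle, hN1, hN2⟩ := exists_patchHalfWidth_bounds hε hL
  set δ := patchHalfWidth ε n with hδdef
  set L := Real.log n with hLdef
  have hn0 : (0 : ℝ) < n := by exact_mod_cast NeZero.pos n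
  have hexpL : Real.exp L = n := Real.exp_log hn0
  have ha1 : 1 ≤ L ^ (1 / 2 + ε) := Real.one_le_rpow hL (by linarith)
  -- The growth condition `hbox` says 9a ≤ n with a = L^(1/2+ε), while 4δ ≤ 8a.
  have hδn : 4 * δ < n := by
    rw [Real.rpow_one, one_mul, Real.exp_neg, hexpL, ← div_eq_mul_inv, div_le_one hn0] at hbox
    have : (4 : ℝ) * δ < n := by linarith
    exact_mod_cast this
  set O := boxOffsets n δ with hOdef
  have hOcard : (O.card : ℝ) = (2 * (δ : ℝ) + 1) ^ 2 - 1 := by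
    rw [hOdef, card_boxOffsets (by omega), Nat.cast_sub (Nat.one_le_pow _ _ (by omega))]
    push_cast; ring
  have hVcard : (Fintype.card (ZMod n × ZMod n) : ℝ) = Real.exp (2 * L) := by
    rw [Fintype.card_prod, ZMod.card, two_mul, Real.exp_add, hexpL]; push_cast; ring
  have hObi : ShiftBicolorable O := shiftBicolorable_boxOffsets hδn
  have hO0 : 0 ∉ O := zero_notMem_boxOffsets (by omega)
  rw [← hOcard] at hN1 hN2
  have hOpos : (0 : ℝ) < O.card := by
    have := Real.one_le_rpow hL (show 0 ≤ 1 + 2 * ε by linarith)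
    linarith
  have hOne : O.Nonempty := Finset.card_pos.1 (by exact_mod_cast hOpos)
  obtain ⟨K, M, J, hK1, hM0, hJ, hKO, hstep, hhalf, htail, hmax, hmaxK, hKexp, hJK, hslope⟩ :=
    hcore O.card hN1 hN2
  obtain ⟨τ, K', hτ0, hτ1, hK', hτt, hτsep, hbad⟩ := hflat O.card hN1
  rw [← hVcard] at hmax hmaxK hslope hbad
  set v := (O.card : ℝ) * (2 * σ ^ 2 + thresholdParam ε σ n) with hv
  have ht : thresholdParam ε σ n = 4 * τ * σ ^ 2 := hτt.symm
  have hv0 : 0 ≤ v := by rw [hv, ht]; positivity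
  refine iSup₂_le fun f hf => ?_
  obtain ⟨h, -, hh, rfl⟩ := hf
  set x := pixelAverages n (horizonImage h) with hx
  have hxI : ∀ p, x p ∈ Set.Icc (0 : ℝ) 1 := pixelAverages_horizonImage_mem_Icc hh.continuous
  have hnlm : ∀ y p, nlm n σ δ (thresholdParam ε σ n) y p = patchMean O v y p := fun y p => by
    rw [nlm_eq_patchMean hδ (by omega), hv, hOcard]
  rw [risk_eq _ _ _ _ fun p => by simpa only [hnlm] using measurable_patchMean O v x p]
  simp only [hnlm, ← hx]
  have hE := card_compl_flatSet_le (n := n) hh δ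
  have hsum := sum_lintegral_sq_sub_patchMean_le (x := x) (v := v) (τ := τ) (K := K')
    (B := n * (8 * δ + 5)) (D := D) hσ hObi hxI hv0 (by rw [hv, ht])
    (by rw [hv, ht]; gcongr; linarith) hτ0 hτ1 hK' (by exact_mod_cast hE)
    (by
      have : (1 : ℝ) ≤ n := by exact_mod_cast NeZero.one_le
      have h2 : (0 : ℝ) ≤ δ := by positivity
      nlinarith) (by positivity) hbad
    (fun p => sum_lintegral_sq_selWeight_patchEnergy_le hσ hObi hO0 hOne hxI hv0 hK1 hM0 hJ hKO
      hstep hhalf htail hmax hmaxK hKexp hJK hslope p)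
  refine (mul_le_mul' le_rfl hsum).trans ?_
  rw [← ENNReal.ofReal_mul (by positivity)]
  refine ENNReal.ofReal_le_ofReal ?_
  have e : 1 / (n : ℝ) ^ 2 * (n * (8 * δ + 5) * (6 * D + 40 * σ ^ 2 + 16)) =
      (6 * D + 40 * σ ^ 2 + 16) * ((8 * δ + 5) / n) := by field_simp
  rw [e]
  calc _ ≤ (6 * D + 40 * σ ^ 2 + 16) * (21 * L ^ (1 / 2 + ε) / n) := by
        gcongr
        linarith
    _ = _ := by ring
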